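/- Let $Q=\{x+iy: x,y\in[-1,1]\}$ and let $\partial Q$ be its boundary, oriented counterclockwise. A Jordan domain is a bounded connected component of the complement in $\mathbb C$ of a Jordan curve. For a compact set $X\subset\mathbb C$ let $|f|_X=\sup_{z\in X}|f(z)|$, let $R_0(X)$ be the algebra of restrictions to $X$ of rational functions with no poles on $X$, and let $R(X)$ be the uniform closure of $R_0(X)$ in $C(X)$. A uniform algebra $A$ on a compact Hausdorff space $K$ is a closed subalgebra of $C(K)$ (with the uniform norm) that contains the constants and separates the points of $K$. It is regular if for every point $\varphi$ of its character space and every compact subset $S$ of the character space with $\varphi\notin S$ there is $f\in A$ with $\varphi(f)=1$ and $\psi(f)=0$ for all $\psi\in S$. A bounded point derivation of $A$ at a character $\varphi$ is a continuous linear functional $d$ on $A$ with $d(fg)=\varphi(f)d(g)+\varphi(g)d(f)$ for all $f,g\in A$. A commutative Banach algebra $A$ is weakly amenable if there is no non-zero continuous derivation from $A$ into any commutative Banach $A$-bimodule. **Theorem 1.1.** For every $C>0$ there are a countable family $\mathcal U$ of Jordan domains contained in $Q$ and a compact set $X=Q\setminus\bigcup_{U\in\mathcal U}U$ such that $\partial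 Q\subset X$; $R(X)$ is a uniform algebra on $X$ and is regular; $R(X)$ has no non-zero bounded point derivations; for all rational functions $f,g$ with no poles on $X$, $$\left|\int_{\partial Q}f'(z)g(z)\,dz\right|\le C\,|f|_X\,|g|_X;$$ and $R(X)$ is not weakly amenable. -/

import Mathlib

open TopologicalSpace

noncomputable section

/-! ### Plane geometry -/

/-- The closed square `Q = {x + i y : x, y ∈ [-1, 1]}`. -/
def squareQ : Set ℂ := Set.Icc (-1 : ℝ) 1 ×ℂ Set.Icc (-1 : ℝ) 1

/-- The integral of `h` over the boundary of `Q`, counterclockwise: bottom side, right side,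
top side (backwards), left side (backwards). -/
def integralBoundaryQ (h : ℂ → ℂ) : ℂ :=
  (∫ x : ℝ in (-1 : ℝ)..1, h (x - Complex.I))
    + Complex.I * (∫ y : ℝ in (-1 : ℝ)..1, h (1 + y * Complex.I))
    - (∫ x : ℝ in (-1 : ℝ)..1, h (x + Complex.I))
    - Complex.I * (∫ y : ℝ in (-1 : ℝ)..1, h (-1 + y * Complex.I))

/-- A Jordan domain: a bounded connected component of the complement of a Jordan curve, i.e. of
the image of an injective continuous map of the circle into the plane. -/
def IsJordanDomain (U : Set ℂ) : Prop :=
  ∃ γ : Circle → ℂ, Continuous γ ∧ Function.Injective γ ∧ Bornology.IsBounded U ∧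
    ∃ z ∈ (Set.range γ)ᶜ, U = connectedComponentIn (Set.range γ)ᶜ z

/-! ### The algebras `R₀(X)` and `R(X)` -/

/-- `F` is (the function given by) a rational function with no poles on `X`. -/
def IsRationalOff (X : Set ℂ) (F : ℂ → ℂ) : Prop :=
  ∃ p q : Polynomial ℂ, (∀ z ∈ X, q.eval z ≠ 0) ∧ ∀ z, F z = p.eval z / q.eval z

/-- The uniform norm of `F` on `X`. -/
def supNormOn (X : Set ℂ) (F : ℂ → ℂ) : ℝ := sSup ((fun z => ‖F z‖) '' X)

/-- `R₀(X)`: the restrictions to `X` of the rational functions with no poles on `X`. -/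
def ratAlgebra (X : Compacts ℂ) : Subalgebra ℂ C(X, ℂ) where
  carrier := {f | ∃ F : ℂ → ℂ, IsRationalOff X F ∧ ∀ z : X, f z = F z}
  mul_mem' := by
    rintro f g ⟨F, ⟨p, q, hq, hF⟩, hf⟩ ⟨G, ⟨r, s, hs, hG⟩, hg⟩
    refine ⟨fun z => F z * G z, ⟨p * r, q * s, fun z hz => ?_, fun z => ?_⟩, fun z => ?_⟩
    · simpa using ⟨hq z hz, hs z hz⟩
    · simp [hF, hG, div_mul_div_comm]
    · simp [hf, hg]
  add_mem' := by
    rintro f g ⟨F, ⟨p, q, hq, hF⟩, hf⟩ ⟨G, ⟨r, s, hs, hG⟩, hg⟩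
    refine ⟨fun z => (p * s + q * r).eval z / (q * s).eval z,
      ⟨p * s + q * r, q * s, fun z hz => ?_, fun z => rfl⟩, fun z => ?_⟩
    · simpa using ⟨hq z hz, hs z hz⟩
    · simp [hf, hg, hF, hG, div_add_div _ _ (hq z z.2) (hs z z.2)]
  algebraMap_mem' := by
    intro c
    refine ⟨fun _ => c, ⟨Polynomial.C c, 1, ?_, ?_⟩, ?_⟩ <;> simp

/-- `R(X)`: the uniform closure of `R₀(X)` in `C(X)`. -/
def ratClosure (X : Compacts ℂ) : Subalgebra ℂ C(X, ℂ) := (ratAlgebra X).topologicalClosure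

/-! ### Banach algebra notions -/

/-- `A` is a uniform algebra on the compact space `K`: a closed subalgebra of `C(K)` that contains
the constants (as every unital subalgebra does) and separates the points of `K`. -/
def IsUniformAlgebra {K : Type*} [TopologicalSpace K] [CompactSpace K]
    (A : Subalgebra ℂ C(K, ℂ)) : Prop :=
  IsClosed (A : Set C(K, ℂ)) ∧ A.SeparatesPoints

/-- `A` is regular on its character space. -/
def IsRegularOnCharacters (A : Type*) [NormedCommRing A] [NormedAlgebra ℂ A] : Prop :=
  ∀ (φ : WeakDual.characterSpace ℂ A) (K : Set (WeakDual.characterSpace ℂ A)),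
    IsCompact K → φ ∉ K → ∃ f : A, φ f = 1 ∧ ∀ ψ ∈ K, ψ f = 0

/-- A bounded point derivation of `A` at the character `φ`. -/
def IsBoundedPointDerivation {A : Type*} [NormedCommRing A] [NormedAlgebra ℂ A]
    (φ : WeakDual.characterSpace ℂ A) (d : A →L[ℂ] ℂ) : Prop :=
  ∀ f g : A, d (f * g) = φ f * d g + φ g * d f

/-- `A` is weakly amenable: every continuous derivation `D` from `A` into a commutative Banach
`A`-bimodule `E` is zero. As left and right actions on `E` agree, the bimodule is given by the
one jointly continuous action `act`. -/
def IsWeaklyAmenable (A : Type) [NormedCommRing A] [NormedAlgebra ℂ A] : Prop :=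
  ∀ (E : Type) [NormedAddCommGroup E] [NormedSpace ℂ E] [CompleteSpace E]
    (act : A →L[ℂ] E →L[ℂ] E), (∀ (a b : A) (x : E), act (a * b) x = act a (act b x)) →
    ∀ D : A →L[ℂ] E, (∀ a b : A, D (a * b) = act a (D b) + act b (D a)) → D = 0

end

/-!
The set `X` is the square `Q` with countably many small open discs removed (a `HoleFamily`; the
discs may overlap). All the required properties of `X` are inherited by smaller sets, except for the
bound on the form `B(f, g) = ∫_{∂Q} f' g`; and that bound depends on one number only, the weight
`∑ rᵢ / dᵢ²`, where `rᵢ` is the radius of the `i`-th disc and `dᵢ` the distance that its double keeps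
from `∂Q`. So each property is obtained from a family of discs of tiny weight, and countably many such
families are simply united (`exists_hole_family`).

*The bound.* A rational function `f` without poles on `∂Q` splits as `f₀ + f₁` with `f₀` holomorphic
on `Q`, and `f₁` holomorphic outside the open square and zero at infinity. By Cauchy's theorem inside
and outside the square, and partial integration, `B(f, g) = ∫ f₀' g - ∫ g₀' f`
(`SplitsAlongQ.integral_deriv_mul`). Cauchy's formula bounds `f₀'` by `2 |f|_X / d²` at distance `d`
from `∂Q`. The integrand `f₀' g` is holomorphic off the holes; finitely many discs contain
all points of `Q` at which `|g|` exceeds `|g|_X` by a fixed amount, and Green's formula with a product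
of cutoffs vanishing on these discs gives `|∫ f₀' g| ≤ M ∑ rᵢ · |f|_X |g|_X / dᵢ²`
(`exists_norm_integral_deriv_mul_le`).

*Regularity.* For `|b| < 1` the product of the functions `1 / (1 + exp (2π mₖ (z - cₖ)))`, with
`cₖ ↑ b` and `mₖ → ∞` geometrically, converges to a function that vanishes exactly for
`Re z ≥ b`, as soon as tiny discs around the poles are removed (`exists_strip_holes`). Turning this by
right angles gives enough functions in `R(X)` to separate a point from the complement of a small square
around it, and the character space of `R(X)` is `X` (`character_eq_eval`).

*Point derivations.* After the removal of tiny discs around the points of a fine lattice there are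
sums of simple fractions bounded by `2` on `X` with large derivative at a given point: the
derivative has the size of a small constant times a partial sum of the harmonic series
(`exists_lattice_holes`). A bounded point derivation at `x` is a multiple of `f ↦ f'(x)` on `R₀(X)`, so it
is zero.

*Weak amenability.* The bounded form `B` extends to `R(X)`. By the product rule `f ↦ B(f, ·)` is a
derivation into the dual of `R(X)`, and `B(z, 1 / (z - a)) = 2πi` if `a` lies in a hole
(`not_isWeaklyAmenable_ratClosure`).
-/

/-! ### Integrals over the boundary of the square -/

lemma mem_squareQ {z : ℂ} : z ∈ squareQ ↔ |z.re| ≤ 1 ∧ |z.im| ≤ 1 := by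
  simp only [squareQ, Complex.mem_reProdIm, Set.mem_Icc, abs_le]

lemma mem_frontier_squareQ {z : ℂ} :
    z ∈ frontier squareQ ↔ (|z.re| ≤ 1 ∧ |z.im| ≤ 1) ∧ (1 ≤ |z.re| ∨ 1 ≤ |z.im|) := by
  have hcl : IsClosed squareQ := isClosed_Icc.reProdIm isClosed_Icc
  rw [hcl.frontier_eq, squareQ, Complex.interior_reProdIm, interior_Icc, ← squareQ]
  simp only [Set.mem_sdiff, mem_squareQ, Complex.mem_reProdIm, Set.mem_Ioo, ← abs_lt]
  rw [not_and_or, not_lt, not_lt]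

lemma frontier_squareQ_subset : frontier squareQ ⊆ squareQ := fun _ hz =>
  mem_squareQ.2 (mem_frontier_squareQ.1 hz).1

lemma isCompact_squareQ : IsCompact squareQ := isCompact_Icc.reProdIm isCompact_Icc

lemma side_mem_frontier {t : ℝ} (ht : t ∈ Set.Icc (-1 : ℝ) 1) :
    (t - Complex.I) ∈ frontier squareQ ∧ (1 + t * Complex.I) ∈ frontier squareQ ∧
      (t + Complex.I) ∈ frontier squareQ ∧ (-1 + t * Complex.I) ∈ frontier squareQ := by
  have := abs_le.2 ht
  refine ⟨?_, ?_, ?_, ?_⟩ <;> rw [mem_frontier_squareQ] <;> simp [this]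

lemma integralBoundaryQ_congr {h k : ℂ → ℂ} (hk : ∀ z ∈ frontier squareQ, h z = k z) :
    integralBoundaryQ h = integralBoundaryQ k := by
  have key : ∀ t ∈ Set.uIcc (-1 : ℝ) 1, t ∈ Set.Icc (-1 : ℝ) 1 := fun t ht => by
    rwa [Set.uIcc_of_le (by norm_num)] at ht
  unfold integralBoundaryQ
  rw [intervalIntegral.integral_congr fun t ht => hk _ (side_mem_frontier (key t ht)).1,
    intervalIntegral.integral_congr fun t ht => hk _ (side_mem_frontier (key t ht)).2.1,
    intervalIntegral.integral_congr fun t ht => hk _ (side_mem_frontier (key t ht)).2.2.1,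
    intervalIntegral.integral_congr fun t ht => hk _ (side_mem_frontier (key t ht)).2.2.2]

lemma intervalIntegrable_sides {h : ℂ → ℂ} (hh : ContinuousOn h (frontier squareQ)) :
    IntervalIntegrable (fun t : ℝ => h (t - Complex.I)) MeasureTheory.volume (-1) 1 ∧
    IntervalIntegrable (fun t : ℝ => h (1 + t * Complex.I)) MeasureTheory.volume (-1) 1 ∧
    IntervalIntegrable (fun t : ℝ => h (t + Complex.I)) MeasureTheory.volume (-1) 1 ∧
    IntervalIntegrable (fun t : ℝ => h (-1 + t * Complex.I)) MeasureTheory.volume (-1) 1 := by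
  have key : ∀ t ∈ Set.uIcc (-1 : ℝ) 1, t ∈ Set.Icc (-1 : ℝ) 1 := fun t ht => by
    rwa [Set.uIcc_of_le (by norm_num)] at ht
  refine ⟨?_, ?_, ?_, ?_⟩ <;> apply ContinuousOn.intervalIntegrable <;>
    refine hh.comp (by fun_prop) fun t ht => ?_
  exacts [(side_mem_frontier (key t ht)).1, (side_mem_frontier (key t ht)).2.1,
    (side_mem_frontier (key t ht)).2.2.1, (side_mem_frontier (key t ht)).2.2.2]

lemma integralBoundaryQ_add {h k : ℂ → ℂ} (hh : ContinuousOn h (frontier squareQ))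
    (hk : ContinuousOn k (frontier squareQ)) :
    integralBoundaryQ (fun z => h z + k z) = integralBoundaryQ h + integralBoundaryQ k := by
  obtain ⟨a1, a2, a3, a4⟩ := intervalIntegrable_sides hh
  obtain ⟨b1, b2, b3, b4⟩ := intervalIntegrable_sides hk
  unfold integralBoundaryQ
  rw [intervalIntegral.integral_add a1 b1, intervalIntegral.integral_add a2 b2,
    intervalIntegral.integral_add a3 b3, intervalIntegral.integral_add a4 b4]
  ring

lemma integralBoundaryQ_const_mul (c : ℂ) (h : ℂ → ℂ) :
    integralBoundaryQ (fun z => c * h z) = c * integralBoundaryQ h := by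
  unfold integralBoundaryQ
  simp only [intervalIntegral.integral_const_mul]
  ring

lemma norm_integralBoundaryQ_le {h : ℂ → ℂ} {B : ℝ}
    (hB : ∀ z ∈ frontier squareQ, ‖h z‖ ≤ B) : ‖integralBoundaryQ h‖ ≤ 8 * B := by
  have key : ∀ t ∈ Set.uIoc (-1 : ℝ) 1, t ∈ Set.Icc (-1 : ℝ) 1 := fun t ht => by
    rw [Set.uIoc_of_le (by norm_num)] at ht
    exact ⟨ht.1.le, ht.2⟩
  have n1 := intervalIntegral.norm_integral_le_of_norm_le_const
    fun t ht => hB _ (side_mem_frontier (key t ht)).1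
  have n2 := intervalIntegral.norm_integral_le_of_norm_le_const
    fun t ht => hB _ (side_mem_frontier (key t ht)).2.1
  have n3 := intervalIntegral.norm_integral_le_of_norm_le_const
    fun t ht => hB _ (side_mem_frontier (key t ht)).2.2.1
  have n4 := intervalIntegral.norm_integral_le_of_norm_le_const
    fun t ht => hB _ (side_mem_frontier (key t ht)).2.2.2
  have habs : |(1 : ℝ) - -1| = 2 := by norm_num
  rw [habs] at n1 n2 n3 n4
  unfold integralBoundaryQ
  refine (norm_sub_le _ _).trans ?_
  refine (add_le_add ((norm_sub_le _ _).trans (add_le_add (norm_add_le _ _) le_rfl)) le_rfl).trans ?_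
  rw [norm_mul, norm_mul, Complex.norm_I, one_mul, one_mul]
  linarith

lemma integralBoundaryQ_eq_rect (h : ℂ → ℂ) :
    integralBoundaryQ h =
      (∫ x : ℝ in (-1 : ℝ)..1, h (x + (-1 : ℝ) * Complex.I))
      - (∫ x : ℝ in (-1 : ℝ)..1, h (x + (1 : ℝ) * Complex.I))
      + Complex.I * (∫ y : ℝ in (-1 : ℝ)..1, h ((1 : ℝ) + y * Complex.I))
      - Complex.I * (∫ y : ℝ in (-1 : ℝ)..1, h ((-1 : ℝ) + y * Complex.I)) := by
  unfold integralBoundaryQ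
  simp only [Complex.ofReal_neg, Complex.ofReal_one, neg_mul, one_mul, sub_eq_add_neg]
  ring

lemma squareQ_eq_uIcc : squareQ = Set.uIcc (-1 : ℝ) 1 ×ℂ Set.uIcc (-1 : ℝ) 1 := by
  rw [Set.uIcc_of_le (by norm_num), squareQ]

lemma integralBoundaryQ_eq_zero_of_differentiableOn {h : ℂ → ℂ}
    (hh : DifferentiableOn ℂ h squareQ) : integralBoundaryQ h = 0 := by
  have := Complex.integral_boundary_rect_eq_zero_of_differentiableOn h ⟨-1, -1⟩ ⟨1, 1⟩
    (by simpa only [squareQ_eq_uIcc] using hh)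
  rw [integralBoundaryQ_eq_rect]
  simpa only [smul_eq_mul] using this

lemma integralBoundaryQ_eq_zero_of_hasDerivAt {F f : ℂ → ℂ}
    (hF : ∀ z ∈ frontier squareQ, HasDerivAt F (f z) z)
    (hf : ContinuousOn f (frontier squareQ)) : integralBoundaryQ f = 0 := by
  have key : ∀ t ∈ Set.uIcc (-1 : ℝ) 1, t ∈ Set.Icc (-1 : ℝ) 1 := fun t ht => by
    rwa [Set.uIcc_of_le (by norm_num)] at ht
  obtain ⟨a1, a2, a3, a4⟩ := intervalIntegrable_sides hf
  have vert : ∀ (c : ℂ) (t : ℝ), HasDerivAt (fun s : ℂ => c + s * Complex.I) Complex.I t :=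
    fun c t => by simpa using ((hasDerivAt_id (t : ℂ)).mul_const Complex.I).const_add c
  have e1 := intervalIntegral.integral_eq_sub_of_hasDerivAt (f := fun t : ℝ => F (t - Complex.I))
    (fun t ht => ((hF _ (side_mem_frontier (key t ht)).1).comp_sub_const
      (t : ℂ) Complex.I).comp_ofReal) a1
  have e3 := intervalIntegral.integral_eq_sub_of_hasDerivAt (f := fun t : ℝ => F (t + Complex.I))
    (fun t ht => ((hF _ (side_mem_frontier (key t ht)).2.2.1).comp_add_const
      (t : ℂ) Complex.I).comp_ofReal) a3
  have e2 := intervalIntegral.integral_eq_sub_of_hasDerivAt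
    (f := fun t : ℝ => F (1 + t * Complex.I))
    (fun t ht => ((hF _ (side_mem_frontier (key t ht)).2.1).comp
      (t : ℂ) (vert 1 t)).comp_ofReal) (a2.mul_const _)
  have e4 := intervalIntegral.integral_eq_sub_of_hasDerivAt
    (f := fun t : ℝ => F (-1 + t * Complex.I))
    (fun t ht => ((hF _ (side_mem_frontier (key t ht)).2.2.2).comp
      (t : ℂ) (vert (-1) t)).comp_ofReal) (a4.mul_const _)
  rw [intervalIntegral.integral_mul_const] at e2 e4
  unfold integralBoundaryQ
  rw [e1, e3, mul_comm Complex.I, mul_comm Complex.I, e2, e4]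
  push_cast
  simp only [one_mul, neg_mul, sub_eq_add_neg]
  ring

/-- The part of the plane outside the open square. -/
def outerQ : Set ℂ := {z | 1 ≤ |z.re| ∨ 1 ≤ |z.im|}

lemma frontier_subset_outerQ : frontier squareQ ⊆ outerQ := fun _ hz =>
  (mem_frontier_squareQ.1 hz).2

/-- A function holomorphic outside the open square and decaying there like `|z|⁻²` has zero
integral over the boundary: that boundary may be replaced by the one of `[-T, T]²`, `T → ∞`. -/
lemma integralBoundaryQ_eq_zero_of_decay {h : ℂ → ℂ} {K : ℝ}
    (hd : ∀ z ∈ outerQ, DifferentiableAt ℂ h z)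
    (hK : ∀ z ∈ outerQ, ‖h z‖ ≤ K / ‖z‖ ^ 2) : integralBoundaryQ h = 0 := by
  have main : ∀ T : ℝ, 1 ≤ T → ‖integralBoundaryQ h‖ ≤ 8 * K / T := by
    intro T hT
    have hreg : ∀ s : Set ℂ, s ⊆ outerQ → DifferentiableOn ℂ h s := fun s hs z hz =>
      (hd z (hs hz)).differentiableWithinAt
    have hhor : ∀ y : ℝ, 1 ≤ |y| → ∀ a b : ℝ,
        IntervalIntegrable (fun x : ℝ => h (x + y * Complex.I)) MeasureTheory.volume a b := by
      intro y hy a b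
      refine ContinuousOn.intervalIntegrable fun x _ => ?_
      have : DifferentiableAt ℂ h (x + y * Complex.I) := hd _ (Or.inr (by simpa using hy))
      exact ContinuousAt.continuousWithinAt
        (ContinuousAt.comp (f := fun x : ℝ => (x + y * Complex.I : ℂ)) this.continuousAt
          (by fun_prop))
    have hver : ∀ x : ℝ, 1 ≤ |x| → ∀ a b : ℝ,
        IntervalIntegrable (fun y : ℝ => h (x + y * Complex.I)) MeasureTheory.volume a b := by
      intro x hx a b
      refine ContinuousOn.intervalIntegrable fun y _ => ?_
      have : DifferentiableAt ℂ h (x + y * Complex.I) := hd _ (Or.inl (by simpa using hx))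
      exact ContinuousAt.continuousWithinAt
        (ContinuousAt.comp (f := fun y : ℝ => (x + y * Complex.I : ℂ)) this.continuousAt
          (by fun_prop))
    have hTabs : 1 ≤ |T| := hT.trans (le_abs_self T)
    have hTabs' : 1 ≤ |-T| := by rwa [abs_neg]
    have r1 := Complex.integral_boundary_rect_eq_zero_of_differentiableOn h ⟨-T, -T⟩ ⟨T, -1⟩
      (hreg _ fun z hz => by
        rw [Complex.mem_reProdIm, Set.uIcc_of_le (by linarith), Set.uIcc_of_le (by linarith)] at hz
        exact Or.inr (le_abs.2 (Or.inr (by linarith [hz.2.2]))))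
    have r2 := Complex.integral_boundary_rect_eq_zero_of_differentiableOn h ⟨-T, 1⟩ ⟨T, T⟩
      (hreg _ fun z hz => by
        rw [Complex.mem_reProdIm, Set.uIcc_of_le (by linarith), Set.uIcc_of_le (by linarith)] at hz
        exact Or.inr (le_abs.2 (Or.inl (by linarith [hz.2.1]))))
    have r3 := Complex.integral_boundary_rect_eq_zero_of_differentiableOn h ⟨-T, -1⟩ ⟨-1, 1⟩
      (hreg _ fun z hz => by
        rw [Complex.mem_reProdIm, Set.uIcc_of_le (by linarith), Set.uIcc_of_le (by linarith)] at hz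
        exact Or.inl (le_abs.2 (Or.inr (by linarith [hz.1.2]))))
    have r4 := Complex.integral_boundary_rect_eq_zero_of_differentiableOn h ⟨1, -1⟩ ⟨T, 1⟩
      (hreg _ fun z hz => by
        rw [Complex.mem_reProdIm, Set.uIcc_of_le (by linarith), Set.uIcc_of_le (by linarith)] at hz
        exact Or.inl (le_abs.2 (Or.inl (by linarith [hz.1.1]))))
    have split : ∀ u : ℝ → ℂ, (∀ a b : ℝ, IntervalIntegrable u MeasureTheory.volume a b) →
        ∫ x in (-T)..T, u x = (∫ x in (-T)..(-1), u x) + (∫ x in (-1)..1, u x) + ∫ x in 1..T, u x :=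
      fun u hu => by
        rw [intervalIntegral.integral_add_adjacent_intervals (hu _ _) (hu _ _),
          intervalIntegral.integral_add_adjacent_intervals (hu _ _) (hu _ _)]
    simp only [smul_eq_mul] at r1 r2 r3 r4
    have s1 := split _ (hhor (-1) (by simp))
    have s2 := split _ (hhor 1 (by simp))
    have s3 := split _ (hver T hTabs)
    have s4 := split _ (hver (-T) hTabs')
    have big : integralBoundaryQ h =
        (∫ x : ℝ in (-T)..T, h (x + (-T : ℝ) * Complex.I))
        - (∫ x : ℝ in (-T)..T, h (x + T * Complex.I))
        + Complex.I * (∫ y : ℝ in (-T)..T, h (T + y * Complex.I))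
        - Complex.I * (∫ y : ℝ in (-T)..T, h ((-T : ℝ) + y * Complex.I)) := by
      rw [integralBoundaryQ_eq_rect]
      linear_combination (norm := skip) -r1 - r2 - r3 - r4 - s1 + s2 - Complex.I * s3
        + Complex.I * s4
      ring
    have hpt : ∀ z : ℂ, T ≤ |z.re| ∨ T ≤ |z.im| → ‖h z‖ ≤ K / T ^ 2 := by
      intro z hz
      have hzT : T ≤ ‖z‖ := by
        rcases hz with hz | hz
        · exact hz.trans (Complex.abs_re_le_norm z)
        · exact hz.trans (Complex.abs_im_le_norm z)
      have h1 : ‖h z‖ ≤ K / ‖z‖ ^ 2 :=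
        hK z (hz.imp (fun h => hT.trans h) fun h => hT.trans h)
      have hK0 : 0 ≤ K := by
        have h2 := (norm_nonneg _).trans h1
        by_contra hneg
        have hz0 : 0 < ‖z‖ := by linarith
        have : K / ‖z‖ ^ 2 < 0 := div_neg_of_neg_of_pos (not_le.1 hneg) (by positivity)
        linarith
      refine h1.trans ?_
      gcongr
    have n1 : ‖∫ x : ℝ in (-T)..T, h (x + (-T : ℝ) * Complex.I)‖ ≤ _ :=
      intervalIntegral.norm_integral_le_of_norm_le_const
        fun t _ => hpt _ (Or.inr (by simpa using le_abs_self T))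
    have n2 : ‖∫ x : ℝ in (-T)..T, h (x + T * Complex.I)‖ ≤ _ :=
      intervalIntegral.norm_integral_le_of_norm_le_const
        fun t _ => hpt _ (Or.inr (by simpa using le_abs_self T))
    have n3 : ‖∫ y : ℝ in (-T)..T, h (T + y * Complex.I)‖ ≤ _ :=
      intervalIntegral.norm_integral_le_of_norm_le_const
        fun t _ => hpt _ (Or.inl (by simpa using le_abs_self T))
    have n4 : ‖∫ y : ℝ in (-T)..T, h ((-T : ℝ) + y * Complex.I)‖ ≤ _ :=
      intervalIntegral.norm_integral_le_of_norm_le_const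
        fun t _ => hpt _ (Or.inl (by simpa using le_abs_self T))
    have habs : |T - -T| = 2 * T := by
      rw [abs_of_nonneg (by linarith)]; ring
    rw [habs] at n1 n2 n3 n4
    rw [big]
    refine (norm_sub_le _ _).trans ?_
    refine (add_le_add ((norm_add_le _ _).trans (add_le_add (norm_sub_le _ _) le_rfl))
      le_rfl).trans ?_
    rw [norm_mul, norm_mul, Complex.norm_I, one_mul, one_mul]
    have : K / T ^ 2 * (2 * T) = 2 * K / T := by
      field_simp
    rw [this] at n1 n2 n3 n4
    have h8 : 8 * K / T = 2 * K / T + 2 * K / T + 2 * K / T + 2 * K / T := by ring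
    linarith
  have hlim : Filter.Tendsto (fun T : ℝ => 8 * K / T) Filter.atTop (nhds 0) :=
    tendsto_const_nhds.div_atTop Filter.tendsto_id
  have := ge_of_tendsto hlim (Filter.eventually_atTop.2 ⟨1, main⟩)
  exact norm_le_zero_iff.1 this

lemma exists_le_norm_sub_of_mem_outerQ {a : ℂ} (ha : |a.re| < 1 ∧ |a.im| < 1) :
    ∃ c : ℝ, 0 < c ∧ ∀ z ∈ outerQ, c * ‖z‖ ≤ ‖z - a‖ := by
  set α := max |a.re| |a.im| with hα
  have hα1 : α < 1 := max_lt ha.1 ha.2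
  have hα0 : 0 ≤ α := (abs_nonneg _).trans (le_max_left _ _)
  refine ⟨(1 - α) / 2, by linarith, fun z hz => ?_⟩
  set m := max |z.re| |z.im| with hm
  have hm1 : 1 ≤ m := by
    rcases hz with h | h
    · exact h.trans (le_max_left _ _)
    · exact h.trans (le_max_right _ _)
  have h1 : ‖z‖ ≤ 2 * m := by
    have := Complex.norm_le_abs_re_add_abs_im z
    linarith [le_max_left |z.re| |z.im|, le_max_right |z.re| |z.im|]
  have h2 : m - α ≤ ‖z - a‖ := by
    rcases max_choice |z.re| |z.im| with h | h
    · have h3 := Complex.abs_re_le_norm (z - a)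
      have h4 := abs_sub_abs_le_abs_sub z.re a.re
      rw [Complex.sub_re] at h3
      linarith [le_max_left |a.re| |a.im|]
    · have h3 := Complex.abs_im_le_norm (z - a)
      have h4 := abs_sub_abs_le_abs_sub z.im a.im
      rw [Complex.sub_im] at h3
      linarith [le_max_right |a.re| |a.im|]
  nlinarith

lemma ne_zero_of_mem_outerQ {z : ℂ} (hz : z ∈ outerQ) : z ≠ 0 := by
  rintro rfl
  rcases hz with h | h <;> norm_num at h

lemma integralBoundaryQ_inv : integralBoundaryQ (fun z => z⁻¹) = 2 * Real.pi * Complex.I := by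
  have c1 : ContinuousOn (fun z : ℂ => z⁻¹) (frontier squareQ) :=
    continuousOn_inv₀.mono fun z hz => ne_zero_of_mem_outerQ (frontier_subset_outerQ hz)
  obtain ⟨a1, a2, a3, a4⟩ := intervalIntegrable_sides c1
  have hbase : ∫ x : ℝ in (-1 : ℝ)..1, (((1 + x ^ 2)⁻¹ : ℝ) : ℂ) = ((Real.pi / 2 : ℝ) : ℂ) := by
    rw [intervalIntegral.integral_ofReal, integral_inv_one_add_sq, Real.arctan_neg,
      Real.arctan_one]
    congr 1; ring
  have hne : ∀ x : ℝ, (1 + (x : ℂ) ^ 2) ≠ 0 := fun x => by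
    have : (1 + x ^ 2 : ℝ) ≠ 0 := by positivity
    exact_mod_cast this
  have hI := Complex.I_sq
  -- opposite sides are taken together: `1 / (x - i) - 1 / (x + i) = 2i / (1 + x²)`
  have e1 : (∫ x : ℝ in (-1 : ℝ)..1, ((x : ℂ) - Complex.I)⁻¹)
      - (∫ x : ℝ in (-1 : ℝ)..1, ((x : ℂ) + Complex.I)⁻¹) = 2 * Complex.I * (Real.pi / 2 : ℝ) := by
    rw [← intervalIntegral.integral_sub a1 a3, ← hbase, ← intervalIntegral.integral_const_mul]
    refine intervalIntegral.integral_congr fun x _ => ?_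
    have f1 : (x : ℂ) - Complex.I ≠ 0 := fun h => hne x (by linear_combination (x + Complex.I) * h + hI)
    have f2 : (x : ℂ) + Complex.I ≠ 0 := fun h => hne x (by linear_combination (x - Complex.I) * h + hI)
    have f3 := hne x
    push_cast
    field_simp
    linear_combination (2 * Complex.I) * hI
  have e2 : (∫ x : ℝ in (-1 : ℝ)..1, (1 + (x : ℂ) * Complex.I)⁻¹)
      - (∫ x : ℝ in (-1 : ℝ)..1, (-1 + (x : ℂ) * Complex.I)⁻¹) = 2 * (Real.pi / 2 : ℝ) := by
    rw [← intervalIntegral.integral_sub a2 a4, ← hbase, ← intervalIntegral.integral_const_mul]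
    refine intervalIntegral.integral_congr fun x _ => ?_
    have f1 : 1 + (x : ℂ) * Complex.I ≠ 0 := fun h => hne x (by
      linear_combination (1 - x * Complex.I) * h + (x : ℂ) ^ 2 * hI)
    have f2 : -1 + (x : ℂ) * Complex.I ≠ 0 := fun h => hne x (by
      linear_combination (-1 - x * Complex.I) * h + (x : ℂ) ^ 2 * hI)
    have f3 := hne x
    push_cast
    field_simp
    linear_combination (-2 * (x : ℂ) ^ 2) * hI
  unfold integralBoundaryQ
  push_cast at e1 e2
  linear_combination e1 + Complex.I * e2

/-- By comparison with the case `a = 0`: the difference of the two integrands decays like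
`|z|⁻²`. -/
lemma integralBoundaryQ_sub_inv {a : ℂ} (ha : |a.re| < 1 ∧ |a.im| < 1) :
    integralBoundaryQ (fun z => (z - a)⁻¹) = 2 * Real.pi * Complex.I := by
  obtain ⟨c, hc, hca⟩ := exists_le_norm_sub_of_mem_outerQ ha
  have hz0 : ∀ z ∈ outerQ, z ≠ 0 := fun z => ne_zero_of_mem_outerQ
  have hza : ∀ z ∈ outerQ, z - a ≠ 0 := fun z hz h => by
    have := hca z hz
    rw [h, norm_zero] at this
    have h2 : 0 < ‖z‖ := norm_pos_iff.2 (hz0 z hz)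
    nlinarith
  have hzero : integralBoundaryQ (fun z => a * ((z - a)⁻¹ * z⁻¹)) = 0 := by
    refine integralBoundaryQ_eq_zero_of_decay (K := ‖a‖ / c) (fun z hz => ?_) fun z hz => ?_
    · have h1 := hz0 z hz
      have h2 := hza z hz
      fun_prop (disch := assumption)
    · have h2 : 0 < ‖z‖ := norm_pos_iff.2 (hz0 z hz)
      rw [norm_mul, norm_mul, norm_inv, norm_inv, ← mul_inv, ← div_eq_mul_inv, div_div]
      have h3 : c * ‖z‖ ^ 2 ≤ ‖z - a‖ * ‖z‖ := by nlinarith [hca z hz]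
      gcongr
  rw [← integralBoundaryQ_inv, ← sub_eq_zero, ← hzero, sub_eq_iff_eq_add,
    ← integralBoundaryQ_add]
  · refine integralBoundaryQ_congr fun z hz => ?_
    have h1 := hz0 z (frontier_subset_outerQ hz)
    have h2 := hza z (frontier_subset_outerQ hz)
    field_simp
    ring
  · intro z hz
    have h1 := hz0 z (frontier_subset_outerQ hz)
    have h2 := hza z (frontier_subset_outerQ hz)
    fun_prop (disch := assumption)
  · intro z hz
    have h1 := hz0 z (frontier_subset_outerQ hz)
    fun_prop (disch := assumption)

/-! ### Splitting a rational function along the square -/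

/-- The open square, written with coordinates. -/
def innerQ : Set ℂ := {z | |z.re| < 1 ∧ |z.im| < 1}

lemma innerQ_subset_squareQ : innerQ ⊆ squareQ := fun _ hz => mem_squareQ.2 ⟨hz.1.le, hz.2.le⟩

lemma mem_outerQ_iff {z : ℂ} : z ∈ outerQ ↔ z ∉ innerQ := by
  simp only [outerQ, innerQ, Set.mem_ofPred_eq, not_and_or, not_lt]

lemma one_le_norm_of_mem_outerQ {z : ℂ} (hz : z ∈ outerQ) : 1 ≤ ‖z‖ := by
  rcases hz with h | h
  · exact h.trans (Complex.abs_re_le_norm z)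
  · exact h.trans (Complex.abs_im_le_norm z)

lemma exists_le_norm_prod (m : Multiset ℂ) (hm : ∀ a ∈ m, a ∈ innerQ) :
    ∃ c : ℝ, 0 < c ∧ ∀ z ∈ outerQ,
      c * ‖z‖ ^ (Multiset.card m) ≤
        ‖((m.map fun a => Polynomial.X - Polynomial.C a).prod).eval z‖ := by
  induction m using Multiset.induction_on with
  | empty => exact ⟨1, one_pos, fun z _ => by simp⟩
  | cons a m ih =>
    obtain ⟨c, hc, h⟩ := ih fun b hb => hm b (Multiset.mem_cons_of_mem hb)
    obtain ⟨c', hc', h'⟩ := exists_le_norm_sub_of_mem_outerQ (hm a (Multiset.mem_cons_self a m))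
    refine ⟨c' * c, by positivity, fun z hz => ?_⟩
    rw [Multiset.map_cons, Multiset.prod_cons, Polynomial.eval_mul, norm_mul, Multiset.card_cons]
    have h1 := h z hz
    have h2 := h' z hz
    simp only [Polynomial.eval_sub, Polynomial.eval_X, Polynomial.eval_C]
    calc c' * c * ‖z‖ ^ (Multiset.card m + 1) = (c' * ‖z‖) * (c * ‖z‖ ^ Multiset.card m) := by ring
      _ ≤ _ := by gcongr

/-- A proper fraction with all its poles in the open square is `O(1 / |z|)` outside. -/
lemma exists_decay_bound {u q : Polynomial ℂ} (hq : ∀ a, q.IsRoot a → a ∈ innerQ)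
    (hu : u.degree < q.degree) :
    ∃ K : ℝ, ∀ z ∈ outerQ, ‖u.eval z / q.eval z‖ ≤ K / ‖z‖ := by
  by_cases hu0 : u = 0
  · exact ⟨0, fun z _ => by simp [hu0]⟩
  have hq0 : q ≠ 0 := by
    rintro rfl
    simp at hu
  have hdeg : u.natDegree < q.natDegree := Polynomial.natDegree_lt_natDegree hu0 hu
  obtain ⟨c, hc, hcz⟩ := exists_le_norm_prod q.roots
    fun a ha => hq a (Polynomial.isRoot_of_mem_roots ha)
  have hsplit := IsAlgClosed.splits q
  have hcard : Multiset.card q.roots = q.natDegree := hsplit.natDegree_eq_card_roots.symm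
  have hlead : 0 < ‖q.leadingCoeff‖ := norm_pos_iff.2 (Polynomial.leadingCoeff_ne_zero.2 hq0)
  set n := q.natDegree with hn
  refine ⟨(∑ i ∈ Finset.range n, ‖u.coeff i‖) / (‖q.leadingCoeff‖ * c), fun z hz => ?_⟩
  have hz1 := one_le_norm_of_mem_outerQ hz
  have hz0 : 0 < ‖z‖ := by linarith
  have hqz : ‖q.leadingCoeff‖ * c * ‖z‖ ^ n ≤ ‖q.eval z‖ := by
    conv_rhs => rw [hsplit.eq_prod_roots, Polynomial.eval_mul, Polynomial.eval_C, norm_mul]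
    rw [mul_assoc]
    gcongr
    rw [← hcard]
    exact hcz z hz
  have huz : ‖u.eval z‖ * ‖z‖ ≤ (∑ i ∈ Finset.range n, ‖u.coeff i‖) * ‖z‖ ^ n := by
    rw [Polynomial.eval_eq_sum_range' hdeg, Finset.sum_mul]
    refine (mul_le_mul_of_nonneg_right (norm_sum_le _ _) hz0.le).trans ?_
    rw [Finset.sum_mul]
    refine Finset.sum_le_sum fun i hi => ?_
    rw [norm_mul, norm_pow, mul_assoc, ← pow_succ]
    gcongr
    exact Finset.mem_range.1 hi
  rw [norm_div, div_div, div_le_div_iff₀ (lt_of_lt_of_le (by positivity) hqz) (by positivity)]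
  calc ‖u.eval z‖ * (‖q.leadingCoeff‖ * c * ‖z‖)
      = ‖u.eval z‖ * ‖z‖ * (‖q.leadingCoeff‖ * c) := by ring
    _ ≤ (∑ i ∈ Finset.range n, ‖u.coeff i‖) * ‖z‖ ^ n * (‖q.leadingCoeff‖ * c) := by gcongr
    _ = (∑ i ∈ Finset.range n, ‖u.coeff i‖) * (‖q.leadingCoeff‖ * c * ‖z‖ ^ n) := by ring
    _ ≤ _ := by gcongr

open Classical in
/-- The denominator is divided into the factor `q₁` with its roots in the open square and the factor
`q₂` with its roots outside the square; then `p / q = u / q₁ + v / q₂`. -/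
lemma exists_partialFraction (p q : Polynomial ℂ) (hq : ∀ z ∈ frontier squareQ, q.eval z ≠ 0) :
    ∃ u q₁ v q₂ : Polynomial ℂ, q = q₁ * q₂ ∧ u.degree < q₁.degree ∧
      (∀ a, q₁.IsRoot a → a ∈ innerQ) ∧ (∀ z ∈ squareQ, q₂.eval z ≠ 0) ∧
      p = u * q₂ + v * q₁ := by
  have hq0 : q ≠ 0 := by
    rintro rfl
    exact hq (1 + (0 : ℝ) * Complex.I) (side_mem_frontier (by simp)).2.1 (by simp)
  set q₁ := ((q.roots.filter (· ∈ innerQ)).map fun a => Polynomial.X - Polynomial.C a).prod with h1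
  set q₂ := Polynomial.C q.leadingCoeff *
    ((q.roots.filter (· ∉ innerQ)).map fun a => Polynomial.X - Polynomial.C a).prod with h2
  have hmonic : q₁.Monic := Polynomial.monic_multisetProd_X_sub_C _
  have hfac : q = q₁ * q₂ := by
    conv_lhs => rw [(IsAlgClosed.splits q).eq_prod_roots,
      ← Multiset.filter_add_not (· ∈ innerQ) q.roots, Multiset.map_add, Multiset.prod_add]
    rw [h1, h2]
    ring
  have hroot₁ : ∀ a, q₁.IsRoot a → a ∈ innerQ := by
    intro a ha
    have : a ∈ q₁.roots := (Polynomial.mem_roots hmonic.ne_zero).2 ha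
    rw [h1, Polynomial.roots_multiset_prod_X_sub_C] at this
    exact (Multiset.mem_filter.1 this).2
  have hroot₂ : ∀ z ∈ squareQ, q₂.eval z ≠ 0 := by
    intro z hz h0
    rw [h2, Polynomial.eval_mul, Polynomial.eval_C, mul_eq_zero] at h0
    rcases h0 with h0 | h0
    · exact hq0 (Polynomial.leadingCoeff_eq_zero.1 h0)
    · have hm : z ∈ (((q.roots.filter (· ∉ innerQ)).map
          fun a => Polynomial.X - Polynomial.C a).prod).roots :=
        (Polynomial.mem_roots (Polynomial.monic_multisetProd_X_sub_C _).ne_zero).2 h0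
      rw [Polynomial.roots_multiset_prod_X_sub_C, Multiset.mem_filter] at hm
      refine hq z ?_ (Polynomial.isRoot_of_mem_roots hm.1)
      exact mem_frontier_squareQ.2 ⟨mem_squareQ.1 hz, mem_outerQ_iff.2 hm.2⟩
  have hcop : IsCoprime q₁ q₂ := by
    rw [Polynomial.isCoprime_iff_aeval_ne_zero_of_isAlgClosed ℂ ℂ]
    intro a
    by_contra! h
    simp only [Polynomial.coe_aeval_eq_eval] at h
    exact hroot₂ a (innerQ_subset_squareQ (hroot₁ a h.1)) h.2
  obtain ⟨s, t, hst⟩ := hcop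
  refine ⟨(p * t) %ₘ q₁, q₁, p * s + (p * t) /ₘ q₁ * q₂, q₂, hfac,
    Polynomial.degree_modByMonic_lt _ hmonic, hroot₁, hroot₂, ?_⟩
  have hdiv := Polynomial.modByMonic_add_div (p * t) q₁
  linear_combination (-p) * hst - q₂ * hdiv

lemma analyticAt_eval_div_eval {p q : Polynomial ℂ} {z : ℂ} (hz : q.eval z ≠ 0) :
    AnalyticAt ℂ (fun w => p.eval w / q.eval w) z :=
  (p.differentiable.analyticAt z).fun_div (q.differentiable.analyticAt z) hz

lemma eventually_eval_ne_zero {q : Polynomial ℂ} {z : ℂ} (hz : q.eval z ≠ 0) :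
    ∀ᶠ w in nhds z, q.eval w ≠ 0 :=
  q.continuous.continuousAt.eventually_ne hz

/-- `F` splits as `F₀ + F₁` near the boundary of the square, with `F₀` holomorphic on the closed
square and `F₁` holomorphic outside the open one and vanishing at infinity. -/
structure SplitsAlongQ (F F₀ F₁ : ℂ → ℂ) : Prop where
  inner : ∀ z ∈ squareQ, AnalyticAt ℂ F₀ z
  outer : ∀ z ∈ outerQ, AnalyticAt ℂ F₁ z
  decay : ∃ K, ∀ z ∈ outerQ, ‖F₁ z‖ ≤ K / ‖z‖
  decay_deriv : ∃ K, ∀ z ∈ outerQ, ‖deriv F₁ z‖ ≤ K / ‖z‖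
  eq : ∀ z ∈ frontier squareQ, F =ᶠ[nhds z] fun w => F₀ w + F₁ w

lemma IsRationalOff.exists_split {F : ℂ → ℂ} (hF : IsRationalOff (frontier squareQ) F) :
    ∃ F₀ F₁ : ℂ → ℂ, SplitsAlongQ F F₀ F₁ := by
  obtain ⟨p, q, hq, hpq⟩ := hF
  obtain ⟨u, q₁, v, q₂, hfac, hdeg, h1, h2, hp⟩ := exists_partialFraction p q hq
  have h1' : ∀ z ∈ outerQ, q₁.eval z ≠ 0 := fun z hz h0 => mem_outerQ_iff.1 hz (h1 z h0)
  refine ⟨fun z => v.eval z / q₂.eval z, fun z => u.eval z / q₁.eval z,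
    fun z hz => analyticAt_eval_div_eval (h2 z hz),
    fun z hz => analyticAt_eval_div_eval (h1' z hz),
    exists_decay_bound h1 hdeg, ?_, ?_⟩
  · have hq₁ : q₁ ≠ 0 := by
      rintro rfl
      simp at hdeg
    have hder : ∀ z ∈ outerQ, deriv (fun z => u.eval z / q₁.eval z) z =
        (u.derivative * q₁ - u * q₁.derivative).eval z / (q₁ ^ 2).eval z := by
      intro z hz
      rw [deriv_fun_div u.differentiableAt q₁.differentiableAt (h1' z hz)]
      simp
    obtain ⟨K, hK⟩ := exists_decay_bound (u := u.derivative * q₁ - u * q₁.derivative) (q := q₁ ^ 2)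
      (fun a ha => h1 a (by simpa using ha)) (by
        by_cases hu0 : u = 0
        · subst hu0
          rw [Polynomial.derivative_zero, zero_mul, zero_mul, sub_zero, Polynomial.degree_zero,
            bot_lt_iff_ne_bot, Ne, Polynomial.degree_eq_bot]
          exact pow_ne_zero 2 hq₁
        have e1 : (q₁ ^ 2).degree = q₁.degree + q₁.degree := by rw [pow_two, Polynomial.degree_mul]
        have hb : q₁.degree ≠ ⊥ := by simpa [Polynomial.degree_eq_bot] using hq₁
        have hub : u.degree ≠ ⊥ := by simpa [Polynomial.degree_eq_bot] using hu0
        refine (Polynomial.degree_sub_le _ _).trans_lt (max_lt ?_ ?_)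
        · rw [e1]
          refine (Polynomial.degree_mul_le _ _).trans_lt ?_
          exact WithBot.add_lt_add_right hb
            (lt_of_le_of_lt Polynomial.degree_derivative_le hdeg)
        · rw [e1]
          refine (Polynomial.degree_mul_le _ _).trans_lt ?_
          exact lt_of_le_of_lt (add_le_add le_rfl Polynomial.degree_derivative_le)
            (WithBot.add_lt_add_right hb hdeg))
    exact ⟨K, fun z hz => by rw [hder z hz]; exact hK z hz⟩
  · intro z hz
    filter_upwards [eventually_eval_ne_zero (hq z hz)] with w hw
    rw [hpq w, hp]
    rw [hfac, Polynomial.eval_mul, mul_ne_zero_iff] at hw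
    have ha := hw.1
    have hb := hw.2
    simp only [hfac, Polynomial.eval_add, Polynomial.eval_mul]
    field_simp
    ring

section Splits
variable {F F₀ F₁ G G₀ G₁ : ℂ → ℂ}

lemma SplitsAlongQ.analyticAt (hF : SplitsAlongQ F F₀ F₁) {z : ℂ} (hz : z ∈ frontier squareQ) :
    AnalyticAt ℂ F z :=
  ((hF.inner z (frontier_squareQ_subset hz)).add
    (hF.outer z (frontier_subset_outerQ hz))).congr (hF.eq z hz).symm

lemma continuousOn_of_analyticAt {h : ℂ → ℂ} {s : Set ℂ} (hh : ∀ z ∈ s, AnalyticAt ℂ h z) :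
    ContinuousOn h s := fun z hz => (hh z hz).continuousAt.continuousWithinAt

lemma differentiableOn_of_analyticAt {h : ℂ → ℂ} {s : Set ℂ} (hh : ∀ z ∈ s, AnalyticAt ℂ h z) :
    DifferentiableOn ℂ h s := fun z hz => (hh z hz).differentiableAt.differentiableWithinAt

/-- The outer parts do not contribute: `F₁' G₁` decays like `|z|⁻²`. The inner parts do not
contribute either, by Cauchy's theorem, and the mixed terms are integrated by parts. -/
lemma SplitsAlongQ.integral_deriv_mul (hF : SplitsAlongQ F F₀ F₁) (hG : SplitsAlongQ G G₀ G₁) :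
    integralBoundaryQ (fun z => deriv F z * G z) =
      integralBoundaryQ (fun z => deriv F₀ z * G z) -
        integralBoundaryQ (fun z => deriv G₀ z * F z) := by
  have i {z} (hz : z ∈ frontier squareQ) := frontier_squareQ_subset hz
  have o {z} (hz : z ∈ frontier squareQ) := frontier_subset_outerQ hz
  have cF := continuousOn_of_analyticAt fun z => hF.analyticAt (z := z)
  have cF' := continuousOn_of_analyticAt fun z hz => (hF.analyticAt (z := z) hz).deriv
  have cG := continuousOn_of_analyticAt fun z => hG.analyticAt (z := z)
  have cG' := continuousOn_of_analyticAt fun z hz => (hG.analyticAt (z := z) hz).deriv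
  have cF₀ : ContinuousOn F₀ (frontier squareQ) :=
    continuousOn_of_analyticAt fun z hz => hF.inner z (i hz)
  have cF₀' : ContinuousOn (deriv F₀) (frontier squareQ) :=
    continuousOn_of_analyticAt fun z hz => (hF.inner z (i hz)).deriv
  have cG₀ : ContinuousOn G₀ (frontier squareQ) :=
    continuousOn_of_analyticAt fun z hz => hG.inner z (i hz)
  have cG₀' : ContinuousOn (deriv G₀) (frontier squareQ) :=
    continuousOn_of_analyticAt fun z hz => (hG.inner z (i hz)).deriv
  have cF₁ : ContinuousOn F₁ (frontier squareQ) :=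
    continuousOn_of_analyticAt fun z hz => hF.outer z (o hz)
  have cG₁ : ContinuousOn G₁ (frontier squareQ) :=
    continuousOn_of_analyticAt fun z hz => hG.outer z (o hz)
  have cF₁' : ContinuousOn (deriv F₁) (frontier squareQ) :=
    continuousOn_of_analyticAt fun z hz => (hF.outer z (o hz)).deriv
  have eF' : ∀ z ∈ frontier squareQ, deriv F z = deriv F₀ z + deriv F₁ z := fun z hz => by
    rw [(hF.eq z hz).deriv_eq, deriv_fun_add (hF.inner z (i hz)).differentiableAt
      (hF.outer z (o hz)).differentiableAt]
  have eF : ∀ z ∈ frontier squareQ, F z = F₀ z + F₁ z := fun z hz => (hF.eq z hz).eq_of_nhds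
  have eG : ∀ z ∈ frontier squareQ, G z = G₀ z + G₁ z := fun z hz => (hG.eq z hz).eq_of_nhds
  -- the outer parts
  have z11 : integralBoundaryQ (fun z => deriv F₁ z * G₁ z) = 0 := by
    obtain ⟨K, hK⟩ := hF.decay_deriv
    obtain ⟨K', hK'⟩ := hG.decay
    refine integralBoundaryQ_eq_zero_of_decay (K := K * K') (fun z hz => ?_) fun z hz => ?_
    · exact ((hF.outer z hz).deriv.mul (hG.outer z hz)).differentiableAt
    · rw [norm_mul, pow_two, ← div_mul_div_comm]
      exact mul_le_mul (hK z hz) (hK' z hz) (norm_nonneg _) ((norm_nonneg _).trans (hK z hz))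
  -- the inner parts
  have z00 : integralBoundaryQ (fun z => deriv G₀ z * F₀ z) = 0 :=
    integralBoundaryQ_eq_zero_of_differentiableOn <| differentiableOn_of_analyticAt fun z hz =>
      (hG.inner z hz).deriv.mul (hF.inner z hz)
  -- integration by parts
  have parts : integralBoundaryQ (fun z => deriv F₁ z * G₀ z + F₁ z * deriv G₀ z) = 0 :=
    integralBoundaryQ_eq_zero_of_hasDerivAt (F := fun z => F₁ z * G₀ z)
      (fun z hz => (hF.outer z (o hz)).differentiableAt.hasDerivAt.mul
        (hG.inner z (i hz)).differentiableAt.hasDerivAt)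
      ((cF₁'.mul cG₀).add (cF₁.mul cG₀'))
  rw [integralBoundaryQ_add (cF₁'.fun_mul cG₀) (cF₁.fun_mul cG₀')] at parts
  have s1 : integralBoundaryQ (fun z => deriv F z * G z) =
      integralBoundaryQ (fun z => deriv F₀ z * G z) +
        (integralBoundaryQ (fun z => deriv F₁ z * G₀ z) +
          integralBoundaryQ (fun z => deriv F₁ z * G₁ z)) := by
    rw [← integralBoundaryQ_add (cF₁'.fun_mul cG₀) (cF₁'.fun_mul cG₁),
      ← integralBoundaryQ_add (cF₀'.fun_mul cG) ((cF₁'.fun_mul cG₀).fun_add (cF₁'.fun_mul cG₁))]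
    refine integralBoundaryQ_congr fun z hz => ?_
    rw [eF' z hz, eG z hz]
    ring
  have s2 : integralBoundaryQ (fun z => deriv G₀ z * F z) =
      integralBoundaryQ (fun z => deriv G₀ z * F₀ z) +
        integralBoundaryQ (fun z => F₁ z * deriv G₀ z) := by
    rw [← integralBoundaryQ_add (cG₀'.fun_mul cF₀) (cF₁.fun_mul cG₀')]
    refine integralBoundaryQ_congr fun z hz => ?_
    rw [eF z hz]
    ring
  rw [s1, s2, z11, z00]
  linear_combination parts

/-- Cauchy's formula for the derivative of the inner part, in which the outer part is invisible. -/
lemma SplitsAlongQ.deriv_inner_eq (hF : SplitsAlongQ F F₀ F₁) {a : ℂ} (ha : a ∈ innerQ) :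
    2 * Real.pi * Complex.I * deriv F₀ a = integralBoundaryQ (fun z => F z * ((z - a)⁻¹) ^ 2) := by
  have i {z} (hz : z ∈ frontier squareQ) := frontier_squareQ_subset hz
  have o {z} (hz : z ∈ frontier squareQ) := frontier_subset_outerQ hz
  have hne : ∀ z ∈ outerQ, z - a ≠ 0 := fun z hz h =>
    mem_outerQ_iff.1 hz (by rwa [sub_eq_zero.1 h])
  have hinv : ∀ z ∈ outerQ, AnalyticAt ℂ (fun z => (z - a)⁻¹) z := fun z hz =>
    (analyticAt_id.sub analyticAt_const).inv (hne z hz)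
  have cinv : ContinuousOn (fun z => (z - a)⁻¹) (frontier squareQ) :=
    continuousOn_of_analyticAt fun z hz => hinv z (o hz)
  obtain ⟨c, hc, hca⟩ := exists_le_norm_sub_of_mem_outerQ ha
  have hle : ∀ z ∈ outerQ, ‖(z - a)⁻¹‖ ≤ (1 / c) / ‖z‖ := fun z hz => by
    have := one_le_norm_of_mem_outerQ hz
    rw [norm_inv, ← one_div, div_div]
    exact one_div_le_one_div_of_le (by positivity) (hca z hz)
  have o1 : integralBoundaryQ (fun z => F₁ z * ((z - a)⁻¹) ^ 2) = 0 := by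
    obtain ⟨K, hK⟩ := hF.decay
    refine integralBoundaryQ_eq_zero_of_decay (K := K * (1 / c) ^ 2) (fun z hz => ?_) fun z hz => ?_
    · exact ((hF.outer z hz).mul ((hinv z hz).pow 2)).differentiableAt
    · have h1 := one_le_norm_of_mem_outerQ hz
      rw [norm_mul, norm_pow, mul_div_assoc, ← div_pow]
      have h2 := hK z hz
      have hK0 : 0 ≤ K := by
        have := (norm_nonneg _).trans h2
        rwa [le_div_iff₀ (by linarith), zero_mul] at this
      have h3 : ‖F₁ z‖ ≤ K := h2.trans (div_le_self hK0 h1)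
      exact mul_le_mul h3 (pow_le_pow_left₀ (norm_nonneg _) (hle z hz) 2) (by positivity) hK0
  have o2 : integralBoundaryQ (fun z => ((z - a)⁻¹) ^ 2) = 0 := by
    refine integralBoundaryQ_eq_zero_of_decay (K := (1 / c) ^ 2) (fun z hz => ?_) fun z hz => ?_
    · exact ((hinv z hz).pow 2).differentiableAt
    · rw [norm_pow, ← div_pow]
      exact pow_le_pow_left₀ (norm_nonneg _) (hle z hz) 2
  have hnhds : squareQ ∈ nhds a := by
    rw [← mem_interior_iff_mem_nhds, squareQ, Complex.interior_reProdIm, interior_Icc]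
    exact ⟨abs_lt.1 ha.1, abs_lt.1 ha.2⟩
  have d0 : DifferentiableOn ℂ F₀ squareQ := differentiableOn_of_analyticAt hF.inner
  have d1 : DifferentiableOn ℂ (dslope F₀ a) squareQ :=
    (Complex.differentiableOn_dslope hnhds).2 d0
  have d2 : DifferentiableOn ℂ (dslope (dslope F₀ a) a) squareQ :=
    (Complex.differentiableOn_dslope hnhds).2 d1
  have o3 := integralBoundaryQ_eq_zero_of_differentiableOn d2
  have c3 := d2.continuousOn.mono frontier_squareQ_subset
  have expand : integralBoundaryQ (fun z => F z * ((z - a)⁻¹) ^ 2) =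
      F₀ a * integralBoundaryQ (fun z => ((z - a)⁻¹) ^ 2) +
      (deriv F₀ a * integralBoundaryQ (fun z => (z - a)⁻¹) +
      (integralBoundaryQ (dslope (dslope F₀ a) a) +
        integralBoundaryQ (fun z => F₁ z * ((z - a)⁻¹) ^ 2))) := by
    have k1 : ContinuousOn (fun z => F₀ a * ((z - a)⁻¹) ^ 2) (frontier squareQ) :=
      continuousOn_const.mul (cinv.pow 2)
    have k2 : ContinuousOn (fun z => deriv F₀ a * (z - a)⁻¹) (frontier squareQ) :=
      continuousOn_const.mul cinv
    have k4 : ContinuousOn (fun z => F₁ z * ((z - a)⁻¹) ^ 2) (frontier squareQ) :=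
      (continuousOn_of_analyticAt fun z hz => hF.outer z (o hz)).mul (cinv.pow 2)
    rw [← integralBoundaryQ_const_mul, ← integralBoundaryQ_const_mul,
      ← integralBoundaryQ_add c3 k4, ← integralBoundaryQ_add k2 (c3.fun_add k4),
      ← integralBoundaryQ_add k1 (k2.fun_add (c3.fun_add k4))]
    refine integralBoundaryQ_congr fun z hz => ?_
    have hz0 := hne z (o hz)
    have hza : z ≠ a := sub_ne_zero.1 hz0
    rw [(hF.eq z hz).eq_of_nhds, dslope_of_ne _ hza, slope_def_field, dslope_same,
      dslope_of_ne _ hza, slope_def_field]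
    field_simp
    ring
  rw [expand, o1, o2, o3, integralBoundaryQ_sub_inv ha]
  ring

/-- The derivative of the inner part at distance `d` from the boundary. -/
lemma SplitsAlongQ.norm_deriv_inner_le (hF : SplitsAlongQ F F₀ F₁) {a : ℂ} (ha : a ∈ innerQ)
    {d B : ℝ} (hd : 0 < d) (hda : ∀ z ∈ frontier squareQ, d ≤ ‖z - a‖)
    (hB : ∀ z ∈ frontier squareQ, ‖F z‖ ≤ B) : ‖deriv F₀ a‖ ≤ 2 * B / d ^ 2 := by
  have h1 := norm_integralBoundaryQ_le (h := fun z => F z * ((z - a)⁻¹) ^ 2) (B := B / d ^ 2)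
    fun z hz => by
      have hd' := hda z hz
      rw [norm_mul, norm_pow, norm_inv, div_eq_mul_inv, inv_pow]
      have := (norm_nonneg _).trans (hB z hz)
      exact mul_le_mul (hB z hz) (inv_anti₀ (by positivity) (by gcongr)) (by positivity) this
  rw [← hF.deriv_inner_eq ha] at h1
  rw [norm_mul, norm_mul, norm_mul, Complex.norm_I, Complex.norm_real, Complex.norm_two,
    Real.norm_of_nonneg Real.pi_pos.le] at h1
  have h3 := Real.pi_gt_three
  have h4 : 8 * (B / d ^ 2) = 4 * (2 * B / d ^ 2) := by ring
  nlinarith [norm_nonneg (deriv F₀ a)]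

end Splits

/-! ### Green's formula with cutoffs -/

/-- Smooth cutoffs vanishing on a disc, with gradient of the order of the inverse radius. -/
lemma exists_cutoff : ∃ M : ℝ, 0 < M ∧ ∀ (a : ℂ) (r : ℝ), 0 < r → ∃ χ : ℂ → ℝ,
    Differentiable ℝ χ ∧ (∀ z ∈ Metric.ball a r, χ z = 0) ∧
    (∀ z ∉ Metric.closedBall a (2 * r), χ z = 1) ∧ (∀ z, 0 ≤ χ z ∧ χ z ≤ 1) ∧
    (∀ z, ‖fderiv ℝ χ z‖ ≤ M / r) ∧ ∀ z ∉ Metric.closedBall a (2 * r), fderiv ℝ χ z = 0 := by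
  let β : ContDiffBump (0 : ℂ) := ⟨1, 2, one_pos, one_lt_two⟩
  have hβ : ContDiff ℝ 1 β := β.contDiff
  obtain ⟨M, hM⟩ := (β.hasCompactSupport.fderiv (𝕜 := ℝ)).exists_bound_of_continuous
    (hβ.continuous_fderiv one_ne_zero)
  refine ⟨max M 1, by positivity, fun a r hr => ?_⟩
  have hin : Differentiable ℝ fun z : ℂ => r⁻¹ • (z - a) := by fun_prop
  have hd : Differentiable ℝ fun z : ℂ => 1 - β (r⁻¹ • (z - a)) :=
    ((hβ.differentiable one_ne_zero).comp hin).const_sub 1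
  have hnorm : ∀ z : ℂ, ‖r⁻¹ • (z - a)‖ = dist z a / r := fun z => by
    rw [norm_smul, norm_inv, Real.norm_of_nonneg hr.le, dist_eq_norm]
    ring
  have hone : ∀ z ∉ Metric.closedBall a (2 * r), 1 - β (r⁻¹ • (z - a)) = 1 := fun z hz => by
    rw [Metric.mem_closedBall, not_le] at hz
    rw [β.zero_of_le_dist, sub_zero]
    rw [dist_zero_right, hnorm, le_div_iff₀ hr]
    exact hz.le
  refine ⟨fun z => 1 - β (r⁻¹ • (z - a)), hd, fun z hz => ?_, hone, fun z => ?_, fun z => ?_,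
    fun z hz => ?_⟩
  · change 1 - β (r⁻¹ • (z - a)) = 0
    rw [β.one_of_mem_closedBall, sub_self]
    rw [mem_closedBall_zero_iff, hnorm, div_le_one hr]
    exact (Metric.mem_ball.1 hz).le
  · exact ⟨sub_nonneg.2 β.le_one, sub_le_self _ β.nonneg⟩
  · have h1 : HasFDerivAt (fun z : ℂ => r⁻¹ • (z - a)) (r⁻¹ • ContinuousLinearMap.id ℝ ℂ) z :=
      ((hasFDerivAt_id z).sub_const a).const_smul r⁻¹
    have h2 := ((((hβ.differentiable one_ne_zero) _).hasFDerivAt).comp z h1).const_sub 1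
    have h3 : fderiv ℝ (fun z => 1 - β (r⁻¹ • (z - a))) z = _ := h2.fderiv
    rw [h3, norm_neg]
    refine (ContinuousLinearMap.opNorm_comp_le _ _).trans ?_
    rw [norm_smul, norm_inv, Real.norm_of_nonneg hr.le, div_eq_mul_inv]
    refine mul_le_mul ((hM _).trans (le_max_left _ _)) ?_ (by positivity) (by positivity)
    exact mul_le_of_le_one_right (by positivity) ContinuousLinearMap.norm_id_le
  · have : (fun z => 1 - β (r⁻¹ • (z - a))) =ᶠ[nhds z] fun _ => 1 := by
      filter_upwards [Metric.isClosed_closedBall.isOpen_compl.mem_nhds hz] with w hw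
      exact hone w hw
    rw [this.fderiv_eq, fderiv_fun_const]
    rfl

lemma intervalIntegrable_indicator_Icc (α β : ℝ) :
    IntervalIntegrable ((Set.Icc α β).indicator (1 : ℝ → ℝ)) MeasureTheory.volume (-1) 1 := by
  rw [intervalIntegrable_iff]
  exact (MeasureTheory.integrableOn_const (by simp)).indicator measurableSet_Icc

lemma intervalIntegrable_sum_indicator {ι : Type} (s : Finset ι) (c α β : ι → ℝ) :
    IntervalIntegrable (fun x => ∑ i ∈ s, c i * (Set.Icc (α i) (β i)).indicator (1 : ℝ → ℝ) x)
      MeasureTheory.volume (-1) 1 := by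
  have h : (fun x => ∑ i ∈ s, c i * (Set.Icc (α i) (β i)).indicator (1 : ℝ → ℝ) x) =
      ∑ i ∈ s, fun x => c i * (Set.Icc (α i) (β i)).indicator (1 : ℝ → ℝ) x := by
    ext x
    rw [Finset.sum_apply]
  rw [h]
  exact IntervalIntegrable.sum s fun i _ =>
    (intervalIntegrable_indicator_Icc (α i) (β i)).const_mul (c i)

lemma integral_indicator_Icc_le {α β : ℝ} (h : α ≤ β) :
    ∫ x in (-1 : ℝ)..1, (Set.Icc α β).indicator (1 : ℝ → ℝ) x ≤ β - α := by
  rw [intervalIntegral.integral_of_le (by norm_num)]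
  have h1 : MeasureTheory.Integrable ((Set.Icc α β).indicator (1 : ℝ → ℝ)) := by
    rw [MeasureTheory.integrable_indicator_iff measurableSet_Icc]
    exact MeasureTheory.integrableOn_const (by simp)
  refine (MeasureTheory.setIntegral_le_integral h1 (Filter.Eventually.of_forall fun x =>
    Set.indicator_nonneg (fun _ _ => zero_le_one) x)).trans ?_
  rw [MeasureTheory.integral_indicator_one measurableSet_Icc, MeasureTheory.measureReal_def,
    Real.volume_Icc, ENNReal.toReal_ofReal (by linarith)]

/-- If `k` is holomorphic on the square off finitely many discs lying well inside, then its
integral over the boundary is controlled by the radii of the discs and by the size of `k` near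
them: by Green's formula the integral equals that of `2i ∂̄χ · k` over the square, where the cutoff
`χ` vanishes on the discs. The discs may overlap. -/
lemma exists_norm_integralBoundaryQ_le_sum : ∃ M : ℝ, 0 < M ∧
    ∀ {ι : Type} (s : Finset ι) (a : ι → ℂ) (r B : ι → ℝ) (k : ℂ → ℂ), (∀ i ∈ s, 0 < r i) →
      (∀ i ∈ s, 0 ≤ B i) → (∀ i ∈ s, Metric.closedBall (a i) (2 * r i) ⊆ innerQ) →
      (∀ z ∈ squareQ, (∀ i ∈ s, z ∉ Metric.ball (a i) (r i)) → DifferentiableAt ℂ k z) →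
      (∀ i ∈ s, ∀ z ∈ Metric.closedBall (a i) (2 * r i),
        (∀ j ∈ s, z ∉ Metric.ball (a j) (r j)) → ‖k z‖ ≤ B i) →
      ‖integralBoundaryQ k‖ ≤ M * ∑ i ∈ s, r i * B i := by
  obtain ⟨M, hM, hcut⟩ := exists_cutoff
  refine ⟨32 * M, by positivity, fun {ι} s a r B k hr hB0 hin hk hB => ?_⟩
  classical
  have hex : ∀ i, ∃ χ : ℂ → ℝ, i ∈ s → Differentiable ℝ χ ∧
      (∀ z ∈ Metric.ball (a i) (r i), χ z = 0) ∧
      (∀ z ∉ Metric.closedBall (a i) (2 * r i), χ z = 1) ∧ (∀ z, 0 ≤ χ z ∧ χ z ≤ 1) ∧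
      (∀ z, ‖fderiv ℝ χ z‖ ≤ M / r i) ∧
      ∀ z ∉ Metric.closedBall (a i) (2 * r i), fderiv ℝ χ z = 0 := fun i => by
    by_cases hi : i ∈ s
    · obtain ⟨χ, h⟩ := hcut (a i) (r i) (hr i hi)
      exact ⟨χ, fun _ => h⟩
    · exact ⟨0, fun h => absurd h hi⟩
  choose χ hχ using hex
  set X : ℂ → ℝ := fun z => ∏ i ∈ s, χ i z with hX
  have hXd : ∀ z, HasFDerivAt X (∑ i ∈ s, (∏ j ∈ s.erase i, χ j z) • fderiv ℝ (χ i) z) z :=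
    fun z => HasFDerivAt.finsetProd fun i hi => ((hχ i hi).1 z).hasFDerivAt
  have hXnorm : ∀ z, ‖fderiv ℝ X z‖ ≤ ∑ i ∈ s, ‖fderiv ℝ (χ i) z‖ := fun z => by
    rw [(hXd z).fderiv]
    refine (norm_sum_le _ _).trans (Finset.sum_le_sum fun i hi => ?_)
    rw [norm_smul]
    refine mul_le_of_le_one_left (norm_nonneg _) ?_
    rw [Real.norm_of_nonneg (Finset.prod_nonneg fun j hj =>
      ((hχ j (Finset.mem_of_mem_erase hj)).2.2.2.1 z).1)]
    exact Finset.prod_le_one (fun j hj => ((hχ j (Finset.mem_of_mem_erase hj)).2.2.2.1 z).1)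
      fun j hj => ((hχ j (Finset.mem_of_mem_erase hj)).2.2.2.1 z).2
  set F : ℂ → ℂ := fun z => X z • k z with hF
  have hFball : ∀ i ∈ s, ∀ z ∈ Metric.ball (a i) (r i), HasFDerivAt F (0 : ℂ →L[ℝ] ℂ) z := by
    intro i hi z hz
    refine (hasFDerivAt_const (0 : ℂ) z).congr_of_eventuallyEq ?_
    filter_upwards [Metric.isOpen_ball.mem_nhds hz] with w hw
    have : X w = 0 := Finset.prod_eq_zero hi ((hχ i hi).2.1 w hw)
    simp only [hF, this, zero_smul]
  have hFoff : ∀ z ∈ squareQ, (∀ i ∈ s, z ∉ Metric.ball (a i) (r i)) →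
      HasFDerivAt F (X z • ((fderiv ℂ k z).restrictScalars ℝ) + (fderiv ℝ X z).smulRight (k z)) z :=
    fun z hz hzs => (hXd z).differentiableAt.hasFDerivAt.smul
      ((hk z hz hzs).hasFDerivAt.restrictScalars ℝ)
  have hFd : DifferentiableOn ℝ F squareQ := by
    intro z hz
    by_cases hzs : ∀ i ∈ s, z ∉ Metric.ball (a i) (r i)
    · exact (hFoff z hz hzs).differentiableAt.differentiableWithinAt
    · push Not at hzs
      obtain ⟨i, hi, hzi⟩ := hzs
      exact (hFball i hi z hzi).differentiableAt.differentiableWithinAt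
  set E : ℂ → ℂ := fun z => Complex.I • fderiv ℝ F z 1 - fderiv ℝ F z Complex.I with hE
  set u : ι → ℝ → ℝ := fun i =>
    (Set.Icc ((a i).re - 2 * r i) ((a i).re + 2 * r i)).indicator 1 with hu
  set v : ι → ℝ → ℝ := fun i =>
    (Set.Icc ((a i).im - 2 * r i) ((a i).im + 2 * r i)).indicator 1 with hv
  have hu0 : ∀ i x, 0 ≤ u i x := fun i x => Set.indicator_nonneg (fun _ _ => zero_le_one) x
  have hv0 : ∀ i x, 0 ≤ v i x := fun i x => Set.indicator_nonneg (fun _ _ => zero_le_one) x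
  have hu1 : ∀ i x, u i x ≤ 1 := fun i x => Set.indicator_le_self' (fun _ _ => zero_le_one) x
  have hv1 : ∀ i x, v i x ≤ 1 := fun i x => Set.indicator_le_self' (fun _ _ => zero_le_one) x
  set c : ι → ℝ := fun i => 2 * (M / r i) * B i with hc
  have hc0 : ∀ i ∈ s, 0 ≤ c i := fun i hi => by
    have h1 := hr i hi
    have h2 := hB0 i hi
    positivity
  have hEle : ∀ z ∈ squareQ, ‖E z‖ ≤ ∑ i ∈ s, c i * u i z.re * v i z.im := by
    intro z hz
    have hsum : 0 ≤ ∑ i ∈ s, c i * u i z.re * v i z.im := Finset.sum_nonneg fun i hi =>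
      mul_nonneg (mul_nonneg (hc0 i hi) (hu0 i _)) (hv0 i _)
    by_cases hzs : ∀ i ∈ s, z ∉ Metric.ball (a i) (r i)
    · have h1 : E z = (Complex.I * (fderiv ℝ X z 1 : ℝ) - (fderiv ℝ X z Complex.I : ℝ)) * k z := by
        have hlin : fderiv ℂ k z Complex.I = Complex.I * fderiv ℂ k z 1 := by
          rw [← smul_eq_mul, ← map_smul, smul_eq_mul, mul_one]
        simp only [hE, (hFoff z hz hzs).fderiv, add_apply,
          smul_apply, ContinuousLinearMap.coe_restrictScalars',
          ContinuousLinearMap.smulRight_apply, smul_eq_mul, Complex.real_smul, hlin]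
        ring
      have h2 : ‖E z‖ ≤ 2 * ‖fderiv ℝ X z‖ * ‖k z‖ := by
        rw [h1, norm_mul]
        gcongr
        refine (norm_sub_le _ _).trans ?_
        rw [norm_mul, Complex.norm_I, one_mul, Complex.norm_real, Complex.norm_real]
        have e1 := (fderiv ℝ X z).le_opNorm 1
        have e2 := (fderiv ℝ X z).le_opNorm Complex.I
        rw [norm_one, mul_one] at e1
        rw [Complex.norm_I, mul_one] at e2
        linarith
      refine h2.trans ?_
      calc 2 * ‖fderiv ℝ X z‖ * ‖k z‖ ≤ 2 * (∑ i ∈ s, ‖fderiv ℝ (χ i) z‖) * ‖k z‖ := by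
            gcongr
            exact hXnorm z
        _ = ∑ i ∈ s, 2 * ‖fderiv ℝ (χ i) z‖ * ‖k z‖ := by rw [Finset.mul_sum, Finset.sum_mul]
        _ ≤ _ := Finset.sum_le_sum fun i hi => ?_
      by_cases hzi : z ∈ Metric.closedBall (a i) (2 * r i)
      · have hnz : ‖z - a i‖ ≤ 2 * r i := by rwa [← dist_eq_norm, ← Metric.mem_closedBall]
        have hre : u i z.re = 1 := by
          have := (Complex.abs_re_le_norm (z - a i)).trans hnz
          rw [Complex.sub_re, abs_le] at this
          exact Set.indicator_of_mem (Set.mem_Icc.2 ⟨by linarith, by linarith⟩) _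
        have him : v i z.im = 1 := by
          have := (Complex.abs_im_le_norm (z - a i)).trans hnz
          rw [Complex.sub_im, abs_le] at this
          exact Set.indicator_of_mem (Set.mem_Icc.2 ⟨by linarith, by linarith⟩) _
        rw [hre, him, mul_one, mul_one]
        have h3 := (hχ i hi).2.2.2.2.1 z
        have h4 := hB i hi z hzi hzs
        have h5 := hr i hi
        simp only [hc]
        gcongr
      · rw [(hχ i hi).2.2.2.2.2 z hzi, norm_zero, mul_zero, zero_mul]
        exact mul_nonneg (mul_nonneg (hc0 i hi) (hu0 i _)) (hv0 i _)
    · push Not at hzs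
      obtain ⟨i, hi, hzi⟩ := hzs
      have : E z = 0 := by simp [hE, (hFball i hi z hzi).fderiv]
      rwa [this, norm_zero]
  have hEint : MeasureTheory.IntegrableOn E squareQ := by
    refine MeasureTheory.Measure.integrableOn_of_bounded (M := ∑ i ∈ s, c i)
      isCompact_squareQ.measure_lt_top.ne ?_ ?_
    · exact (((measurable_fderiv_apply_const ℝ F 1).const_smul Complex.I).sub
        (measurable_fderiv_apply_const ℝ F Complex.I)).aestronglyMeasurable
    · refine (MeasureTheory.ae_restrict_mem isCompact_squareQ.measurableSet).mono fun z hz => ?_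
      refine (hEle z hz).trans (Finset.sum_le_sum fun i hi => ?_)
      have h1 := hc0 i hi
      calc c i * u i z.re * v i z.im ≤ c i * 1 * 1 := by
            gcongr
            · exact hv0 i _
            · exact hu1 i _
            · exact hv1 i _
        _ = c i := by ring
  have hgreen := Complex.integral_boundary_rect_of_differentiableOn_real F ⟨-1, -1⟩ ⟨1, 1⟩
    (by simpa only [squareQ_eq_uIcc] using hFd) (by simpa only [squareQ_eq_uIcc] using hEint)
  have hFk : integralBoundaryQ k = integralBoundaryQ F := by
    refine integralBoundaryQ_congr fun z hz => ?_
    have : X z = 1 := Finset.prod_eq_one fun i hi => (hχ i hi).2.2.1 z fun hzi =>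
      mem_outerQ_iff.1 (frontier_subset_outerQ hz) (hin i hi hzi)
    simp only [hF, this, one_smul]
  simp only [smul_eq_mul] at hgreen
  rw [hFk, integralBoundaryQ_eq_rect, hgreen]
  have hinner : ∀ x ∈ Set.Ioc (-1 : ℝ) 1, ‖∫ y in (-1 : ℝ)..1, E (x + y * Complex.I)‖ ≤
      ∑ i ∈ s, c i * (4 * r i) * u i x := by
    intro x hx
    refine (intervalIntegral.norm_integral_le_of_norm_le (by norm_num)
      (g := fun y => ∑ i ∈ s, c i * u i x * v i y)
      (Filter.Eventually.of_forall fun y hy => ?_) ?_).trans ?_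
    · have := hEle (x + y * Complex.I) (mem_squareQ.2
        ⟨by simpa using abs_le.2 ⟨hx.1.le, hx.2⟩, by simpa using abs_le.2 ⟨hy.1.le, hy.2⟩⟩)
      simpa using this
    · exact intervalIntegrable_sum_indicator _ _ _ _
    · rw [intervalIntegral.integral_finsetSum fun i _ =>
        (intervalIntegrable_indicator_Icc _ _).const_mul _]
      refine Finset.sum_le_sum fun i hi => ?_
      rw [intervalIntegral.integral_const_mul]
      have h1 := hr i hi
      have h2 : ∫ y in (-1 : ℝ)..1, v i y ≤ 4 * r i :=
        (integral_indicator_Icc_le (by linarith)).trans (by linarith)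
      calc c i * u i x * ∫ y in (-1 : ℝ)..1, v i y ≤ c i * u i x * (4 * r i) :=
            mul_le_mul_of_nonneg_left h2 (mul_nonneg (hc0 i hi) (hu0 i x))
        _ = _ := by ring
  refine (intervalIntegral.norm_integral_le_of_norm_le (by norm_num)
    (g := fun x => ∑ i ∈ s, c i * (4 * r i) * u i x)
    (Filter.Eventually.of_forall fun x hx => hinner x hx) ?_).trans ?_
  · exact intervalIntegrable_sum_indicator _ _ _ _
  · rw [intervalIntegral.integral_finsetSum fun i _ =>
      (intervalIntegrable_indicator_Icc _ _).const_mul _, Finset.mul_sum]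
    refine Finset.sum_le_sum fun i hi => ?_
    rw [intervalIntegral.integral_const_mul]
    have h1 := hr i hi
    have h2 : ∫ x in (-1 : ℝ)..1, u i x ≤ 4 * r i :=
      (integral_indicator_Icc_le (by linarith)).trans (by linarith)
    calc c i * (4 * r i) * ∫ x in (-1 : ℝ)..1, u i x ≤ c i * (4 * r i) * (4 * r i) :=
          mul_le_mul_of_nonneg_left h2 (mul_nonneg (hc0 i hi) (by linarith))
      _ = 32 * M * (r i * B i) := by
          simp only [hc]
          field_simp
          ring

/-! ### Families of holes and the estimate for the bilinear form -/

/-- A countable family of discs whose doubles lie in the open square; `gap i` is a lower bound for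
the distance from the `i`-th double disc to the boundary of the square. The discs may overlap. -/
structure HoleFamily where
  /-- The index set. -/
  ι : Type
  countable : Countable ι
  /-- The centers of the discs. -/
  center : ι → ℂ
  /-- The radii of the discs. -/
  radius : ι → ℝ
  /-- The distances to be kept from the boundary of the square. -/
  gap : ι → ℝ
  radius_pos : ∀ i, 0 < radius i
  gap_pos : ∀ i, 0 < gap i
  re_le : ∀ i, |(center i).re| + 2 * radius i + gap i ≤ 1
  im_le : ∀ i, |(center i).im| + 2 * radius i + gap i ≤ 1

namespace HoleFamily

/-- The quantity `∑ rᵢ / dᵢ²`, which controls the bilinear form `∫ f' g`. -/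
noncomputable def weight (H : HoleFamily) : ENNReal := ∑' i, ENNReal.ofReal (H.radius i / H.gap i ^ 2)

/-- The union of the open discs of the family. -/
def holes (H : HoleFamily) : Set ℂ := ⋃ i, Metric.ball (H.center i) (H.radius i)

lemma isOpen_holes (H : HoleFamily) : IsOpen H.holes := isOpen_iUnion fun _ => Metric.isOpen_ball

lemma abs_le_of_mem_closedBall (H : HoleFamily) {i : H.ι} {z : ℂ}
    (hz : z ∈ Metric.closedBall (H.center i) (2 * H.radius i)) :
    |z.re| ≤ 1 - H.gap i ∧ |z.im| ≤ 1 - H.gap i := by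
  have hn : ‖z - H.center i‖ ≤ 2 * H.radius i := by rwa [← dist_eq_norm, ← Metric.mem_closedBall]
  have h1 := (Complex.abs_re_le_norm (z - H.center i)).trans hn
  have h2 := (Complex.abs_im_le_norm (z - H.center i)).trans hn
  rw [Complex.sub_re] at h1
  rw [Complex.sub_im] at h2
  have h3 := abs_sub_abs_le_abs_sub z.re (H.center i).re
  have h4 := abs_sub_abs_le_abs_sub z.im (H.center i).im
  have h5 := H.re_le i
  have h6 := H.im_le i
  exact ⟨by linarith, by linarith⟩

lemma closedBall_subset_innerQ (H : HoleFamily) (i : H.ι) :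
    Metric.closedBall (H.center i) (2 * H.radius i) ⊆ innerQ := fun z hz => by
  have h := H.abs_le_of_mem_closedBall hz
  have h1 := H.gap_pos i
  exact ⟨by linarith [h.1], by linarith [h.2]⟩

lemma gap_le_norm_sub (H : HoleFamily) {i : H.ι} {z w : ℂ}
    (hz : z ∈ Metric.closedBall (H.center i) (2 * H.radius i)) (hw : w ∈ outerQ) :
    H.gap i ≤ ‖w - z‖ := by
  have h := H.abs_le_of_mem_closedBall hz
  rcases hw with hw | hw
  · have h1 := Complex.abs_re_le_norm (w - z)
    rw [Complex.sub_re] at h1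
    linarith [abs_sub_abs_le_abs_sub w.re z.re]
  · have h1 := Complex.abs_im_le_norm (w - z)
    rw [Complex.sub_im] at h1
    linarith [abs_sub_abs_le_abs_sub w.im z.im]

lemma ball_subset_innerQ (H : HoleFamily) (i : H.ι) :
    Metric.ball (H.center i) (H.radius i) ⊆ innerQ :=
  (Metric.ball_subset_closedBall.trans (Metric.closedBall_subset_closedBall
    (by linarith [H.radius_pos i]))).trans (H.closedBall_subset_innerQ i)

lemma holes_subset_innerQ (H : HoleFamily) : H.holes ⊆ innerQ :=
  Set.iUnion_subset H.ball_subset_innerQ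

lemma frontier_subset_diff (H : HoleFamily) : frontier squareQ ⊆ squareQ \ H.holes := fun _ hz =>
  ⟨frontier_squareQ_subset hz, fun h =>
    mem_outerQ_iff.1 (frontier_subset_outerQ hz) (H.holes_subset_innerQ h)⟩

lemma isCompact_diff (H : HoleFamily) : IsCompact (squareQ \ H.holes) :=
  isCompact_squareQ.diff H.isOpen_holes

/-- The square with the holes removed. -/
def carrier (H : HoleFamily) : Compacts ℂ := ⟨squareQ \ H.holes, H.isCompact_diff⟩

lemma coe_carrier (H : HoleFamily) : (H.carrier : Set ℂ) = squareQ \ H.holes := rfl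

end HoleFamily

lemma IsRationalOff.mono {X Y : Set ℂ} {F : ℂ → ℂ} (h : IsRationalOff X F) (hY : Y ⊆ X) :
    IsRationalOff Y F := by
  obtain ⟨p, q, hq, hF⟩ := h
  exact ⟨p, q, fun z hz => hq z (hY hz), hF⟩

lemma IsRationalOff.continuousOn {X : Set ℂ} {F : ℂ → ℂ} (h : IsRationalOff X F) :
    ContinuousOn F X := by
  obtain ⟨p, q, hq, hF⟩ := h
  have : F = fun z => p.eval z / q.eval z := funext hF
  rw [this]
  exact p.continuous.continuousOn.div q.continuous.continuousOn hq

lemma supNormOn_nonneg (X : Set ℂ) (F : ℂ → ℂ) : 0 ≤ supNormOn X F := by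
  refine Real.sSup_nonneg ?_
  rintro _ ⟨z, _, rfl⟩
  exact norm_nonneg _

lemma le_supNormOn {X : Set ℂ} (hX : IsCompact X) {F : ℂ → ℂ} (hF : ContinuousOn F X) {z : ℂ}
    (hz : z ∈ X) : ‖F z‖ ≤ supNormOn X F :=
  le_csSup (hX.image_of_continuousOn hF.norm).bddAbove ⟨z, hz, rfl⟩

/-- The mixed terms `∫ f₀' g` of the bilinear form. The set where `|g|` exceeds `|g|_X + η` is
compact and covered by the holes, hence by finitely many of them, and near a hole at distance `d`
from the boundary of the square one has `|f₀'| ≤ 2 |f|_X / d²`. -/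
lemma exists_norm_integral_deriv_inner_mul_le : ∃ M : ℝ, 0 < M ∧
    ∀ (H : HoleFamily) (w : ℝ), 0 ≤ w → H.weight ≤ ENNReal.ofReal w →
      ∀ f f₀ f₁ g : ℂ → ℂ, SplitsAlongQ f f₀ f₁ → IsRationalOff H.carrier f →
        IsRationalOff H.carrier g →
        ‖integralBoundaryQ (fun z => deriv f₀ z * g z)‖ ≤
          M * w * supNormOn H.carrier f * supNormOn H.carrier g := by
  obtain ⟨M, hM, hgreen⟩ := exists_norm_integralBoundaryQ_le_sum
  refine ⟨2 * M, by positivity, fun H w hw hHw f f₀ f₁ g hs hf hg => ?_⟩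
  set A := supNormOn H.carrier f with hA
  set B := supNormOn H.carrier g with hB
  have hA0 : 0 ≤ A := supNormOn_nonneg _ _
  have hB0 : 0 ≤ B := supNormOn_nonneg _ _
  have key : ∀ η : ℝ, 0 < η →
      ‖integralBoundaryQ (fun z => deriv f₀ z * g z)‖ ≤ 2 * M * w * A * (B + η) := by
    intro η hη
    have hgB : ∀ z ∈ squareQ \ H.holes, ‖g z‖ ≤ B := fun z hz =>
      le_supNormOn H.isCompact_diff hg.continuousOn hz
    have hfA : ∀ z ∈ frontier squareQ, ‖f z‖ ≤ A := fun z hz =>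
      le_supNormOn H.isCompact_diff hf.continuousOn (H.frontier_subset_diff hz)
    obtain ⟨p, q, hq, hpq⟩ := hg
    set K : Set ℂ := squareQ ∩ {z | (B + η) * ‖q.eval z‖ ≤ ‖p.eval z‖} with hK
    have hKc : IsCompact K := isCompact_squareQ.inter_right
      (isClosed_le (continuous_const.mul q.continuous.norm) p.continuous.norm)
    have hKH : K ⊆ ⋃ i, Metric.ball (H.center i) (H.radius i) := by
      intro z hz
      by_contra hzH
      have hzX : z ∈ squareQ \ H.holes := ⟨hz.1, hzH⟩
      have h1 := hgB z hzX
      have hq0 : 0 < ‖q.eval z‖ := norm_pos_iff.2 (hq z hzX)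
      rw [hpq, norm_div, div_le_iff₀ hq0] at h1
      have h2 : (B + η) * ‖q.eval z‖ ≤ ‖p.eval z‖ := hz.2
      nlinarith
    obtain ⟨t, ht⟩ := hKc.elim_finite_subcover _ (fun _ => Metric.isOpen_ball) hKH
    have hoff : ∀ z ∈ squareQ, (∀ i ∈ t, z ∉ Metric.ball (H.center i) (H.radius i)) →
        q.eval z ≠ 0 ∧ ‖g z‖ ≤ B + η := by
      intro z hz hzt
      have hzK : z ∉ K := fun h => by
        obtain ⟨i, hi, hzi⟩ := Set.mem_iUnion₂.1 (ht h)
        exact hzt i hi hzi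
      have h1 : ‖p.eval z‖ < (B + η) * ‖q.eval z‖ := by
        by_contra h
        exact hzK ⟨hz, not_lt.1 h⟩
      have h2 : 0 < ‖q.eval z‖ := by
        by_contra h
        have : ‖q.eval z‖ = 0 := le_antisymm (not_lt.1 h) (norm_nonneg _)
        rw [this, mul_zero] at h1
        exact absurd h1 (not_lt.2 (norm_nonneg _))
      refine ⟨norm_pos_iff.1 h2, ?_⟩
      rw [hpq, norm_div, div_le_iff₀ h2]
      exact h1.le
    have hmain := hgreen t H.center H.radius (fun i => 2 * A / H.gap i ^ 2 * (B + η))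
      (fun z => deriv f₀ z * g z) (fun i _ => H.radius_pos i)
      (fun i _ => by have := H.gap_pos i; positivity) (fun i _ => H.closedBall_subset_innerQ i)
      (fun z hz hzt => by
        have hgz : DifferentiableAt ℂ g z := by
          have : g = fun z => p.eval z / q.eval z := funext hpq
          rw [this]
          exact p.differentiableAt.fun_div q.differentiableAt (hoff z hz hzt).1
        exact (hs.inner z hz).deriv.differentiableAt.fun_mul hgz)
      (fun i _ z hz hzt => by
        have hzin := H.closedBall_subset_innerQ i hz
        rw [norm_mul]
        refine mul_le_mul ?_ (hoff z (innerQ_subset_squareQ hzin) hzt).2 (norm_nonneg _) ?_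
        · exact hs.norm_deriv_inner_le hzin (H.gap_pos i)
            (fun w hw => H.gap_le_norm_sub hz (frontier_subset_outerQ hw)) hfA
        · have := H.gap_pos i
          positivity)
    have hsum : ∑ i ∈ t, H.radius i / H.gap i ^ 2 ≤ w := by
      have h1 : ∑ i ∈ t, ENNReal.ofReal (H.radius i / H.gap i ^ 2) ≤ ENNReal.ofReal w :=
        (ENNReal.sum_le_tsum t).trans hHw
      rw [← ENNReal.ofReal_sum_of_nonneg fun i _ =>
        div_nonneg (H.radius_pos i).le (sq_nonneg _)] at h1
      exact (ENNReal.ofReal_le_ofReal_iff hw).1 h1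
    calc ‖integralBoundaryQ (fun z => deriv f₀ z * g z)‖
        ≤ M * ∑ i ∈ t, H.radius i * (2 * A / H.gap i ^ 2 * (B + η)) := hmain
      _ = 2 * M * A * (B + η) * ∑ i ∈ t, H.radius i / H.gap i ^ 2 := by
          rw [Finset.mul_sum, Finset.mul_sum]
          refine Finset.sum_congr rfl fun i _ => ?_
          ring
      _ ≤ 2 * M * A * (B + η) * w := by gcongr
      _ = 2 * M * w * A * (B + η) := by ring
  set D := 2 * M * w * A with hD
  have hD0 : 0 ≤ D := by positivity
  refine le_of_forall_pos_le_add fun ε hε => (key (ε / (D + 1)) (by positivity)).trans ?_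
  have : D * (ε / (D + 1)) ≤ ε := by
    rw [mul_div_assoc', div_le_iff₀ (by positivity)]
    nlinarith
  linarith

/-- The form `∫ f' g` is bounded on the square minus the holes, with a bound proportional to the
weight of the holes. -/
lemma exists_norm_integral_deriv_mul_le : ∃ M : ℝ, 0 < M ∧
    ∀ (H : HoleFamily) (w : ℝ), 0 ≤ w → H.weight ≤ ENNReal.ofReal w →
      ∀ f g : ℂ → ℂ, IsRationalOff H.carrier f → IsRationalOff H.carrier g →
        ‖integralBoundaryQ (fun z => deriv f z * g z)‖ ≤
          M * w * supNormOn H.carrier f * supNormOn H.carrier g := by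
  obtain ⟨M, hM, h⟩ := exists_norm_integral_deriv_inner_mul_le
  refine ⟨2 * M, by positivity, fun H w hw hHw f g hf hg => ?_⟩
  obtain ⟨f₀, f₁, hfs⟩ := (hf.mono H.frontier_subset_diff).exists_split
  obtain ⟨g₀, g₁, hgs⟩ := (hg.mono H.frontier_subset_diff).exists_split
  rw [hfs.integral_deriv_mul hgs]
  refine (norm_sub_le _ _).trans ?_
  have h1 := h H w hw hHw f f₀ f₁ g hfs hf hg
  have h2 := h H w hw hHw g g₀ g₁ f hgs hg hf
  linarith

/-! ### Lattices of holes and large derivatives -/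

/-- Sums of `(1 + |j|)^(-1/2)` over `M` consecutive integers. Products of two such sums dominate sums
of `1 / |z - p|` over square blocks of lattice points `p`. -/
lemma sum_inv_sqrt_le (M : ℕ) (t : ℤ) :
    ∑ j ∈ Finset.range M, (√(1 + |((t + j : ℤ) : ℝ)|))⁻¹ ≤ 4 * √M := by
  induction M generalizing t with
  | zero => simp
  | succ M ih =>
    -- the term farthest from the origin is removed
    have hstep : 4 * √(M : ℝ) + √2 / √(M + 2) ≤ 4 * √((M + 1 : ℕ) : ℝ) := by
      have h1 : √(M : ℝ) * √(M : ℝ) = M := Real.mul_self_sqrt (by positivity)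
      have h2 : √((M + 1 : ℕ) : ℝ) * √((M + 1 : ℕ) : ℝ) = M + 1 := by
        rw [Real.mul_self_sqrt (by positivity)]; push_cast; ring
      have h3 : √(M : ℝ) ≤ √((M + 1 : ℕ) : ℝ) := Real.sqrt_le_sqrt (by push_cast; linarith)
      have h4 : 0 < √((M + 1 : ℕ) : ℝ) := by positivity
      have h5 : √((M + 1 : ℕ) : ℝ) ≤ √((M : ℝ) + 2) := Real.sqrt_le_sqrt (by push_cast; linarith)
      have h6 : √2 ≤ 2 := by
        rw [Real.sqrt_le_left (by norm_num)]; norm_num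
      have h7 : √2 / √((M : ℝ) + 2) ≤ 2 / √((M + 1 : ℕ) : ℝ) := by gcongr
      have h8 : 2 / √((M + 1 : ℕ) : ℝ) ≤ 4 * (√((M + 1 : ℕ) : ℝ) - √(M : ℝ)) := by
        rw [div_le_iff₀ h4]
        nlinarith [Real.sqrt_nonneg (M : ℝ)]
      linarith
    have hfar : ∀ u : ℝ, (M : ℝ) ≤ 2 * |u| → (√(1 + |u|))⁻¹ ≤ √2 / √(M + 2) := by
      intro u hu
      rw [inv_eq_one_div, div_le_div_iff₀ (by positivity) (by positivity), one_mul,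
        ← Real.sqrt_mul (by norm_num)]
      exact Real.sqrt_le_sqrt (by linarith)
    by_cases hc : (M : ℝ) ≤ 2 * |((t + M : ℤ) : ℝ)|
    · rw [Finset.sum_range_succ]
      linarith [ih t, hfar _ hc]
    · rw [Finset.sum_range_succ']
      have h1 : (M : ℝ) ≤ 2 * |((t + (0 : ℕ) : ℤ) : ℝ)| := by
        push_cast at hc ⊢
        rw [not_le] at hc
        have h2 := abs_lt.1 (show |(t : ℝ) + M| < M / 2 by linarith)
        rw [add_zero, abs_of_nonpos (by linarith)]
        linarith
      have h2 := ih (t + 1)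
      have h3 : ∑ k ∈ Finset.range M, (√(1 + |((t + (k + 1 : ℕ) : ℤ) : ℝ)|))⁻¹ =
          ∑ j ∈ Finset.range M, (√(1 + |((t + 1 + j : ℤ) : ℝ)|))⁻¹ := by
        refine Finset.sum_congr rfl fun k _ => ?_
        push_cast
        ring_nf
      rw [h3]
      linarith [hfar _ h1]

/-- The points of the square lattice of mesh `1 / N`. -/
noncomputable def latticePoint (N : ℕ) (j k : ℤ) : ℂ := ⟨j / N, k / N⟩

/-- The lattice point nearest to `z` may come as close as `r` and is bounded by `1`; for the others
`1 / |z - p|` is bounded by a product of functions of the two coordinates. -/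
lemma div_norm_sub_latticePoint_le {N : ℕ} (hN : 0 < N) {r : ℝ} (hr : 0 < r) {z : ℂ} {j k : ℤ}
    (hz : r ≤ ‖z - latticePoint N j k‖) :
    r / ‖z - latticePoint N j k‖ ≤
      (if (j, k) = (round (N * z.re), round (N * z.im)) then 1 else 0) +
        4 * r * N * ((√(1 + |((j - round (N * z.re) : ℤ) : ℝ)|))⁻¹ *
          (√(1 + |((k - round (N * z.im) : ℤ) : ℝ)|))⁻¹) := by
  have hN' : (0 : ℝ) < N := by exact_mod_cast hN
  have hz0 : 0 < ‖z - latticePoint N j k‖ := hr.trans_le hz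
  split_ifs with h
  · have : r / ‖z - latticePoint N j k‖ ≤ 1 := (div_le_one hz0).2 hz
    have h2 : 0 ≤ 4 * r * N * ((√(1 + |((j - round (N * z.re) : ℤ) : ℝ)|))⁻¹ *
          (√(1 + |((k - round (N * z.im) : ℤ) : ℝ)|))⁻¹) := by positivity
    linarith
  · set α : ℤ := j - round (N * z.re) with hα
    set β : ℤ := k - round (N * z.im) with hβ
    have hne : α ≠ 0 ∨ β ≠ 0 := by
      by_contra! h0
      exact h (Prod.ext (by simpa [hα, sub_eq_zero] using h0.1)
        (by simpa [hβ, sub_eq_zero] using h0.2))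
    set m : ℝ := max |(α : ℝ)| |(β : ℝ)| with hm
    have hm1 : 1 ≤ m := by
      rcases hne with h0 | h0
      · exact le_max_of_le_left (by exact_mod_cast Int.one_le_abs h0)
      · exact le_max_of_le_right (by exact_mod_cast Int.one_le_abs h0)
    have hre : |(α : ℝ)| - 1 / 2 ≤ N * ‖z - latticePoint N j k‖ := by
      have h1 := Complex.abs_re_le_norm (z - latticePoint N j k)
      have h2 := abs_sub_round (N * z.re)
      have h3 : (N : ℝ) * |(z - latticePoint N j k).re| = |N * z.re - j| := by
        rw [← abs_of_pos hN', ← abs_mul, abs_of_pos hN', Complex.sub_re, latticePoint]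
        congr 1
        field_simp
      have h4 : |(α : ℝ)| ≤ |N * z.re - j| + |N * z.re - round (N * z.re)| := by
        have : (α : ℝ) = (N * z.re - round (N * z.re)) - (N * z.re - j) := by
          rw [hα]; push_cast; ring
        rw [this, add_comm]
        exact abs_sub _ _
      nlinarith
    have him : |(β : ℝ)| - 1 / 2 ≤ N * ‖z - latticePoint N j k‖ := by
      have h1 := Complex.abs_im_le_norm (z - latticePoint N j k)
      have h2 := abs_sub_round (N * z.im)
      have h3 : (N : ℝ) * |(z - latticePoint N j k).im| = |N * z.im - k| := by
        rw [← abs_of_pos hN', ← abs_mul, abs_of_pos hN', Complex.sub_im, latticePoint]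
        congr 1
        field_simp
      have h4 : |(β : ℝ)| ≤ |N * z.im - k| + |N * z.im - round (N * z.im)| := by
        have : (β : ℝ) = (N * z.im - round (N * z.im)) - (N * z.im - k) := by
          rw [hβ]; push_cast; ring
        rw [this, add_comm]
        exact abs_sub _ _
      nlinarith
    have hmN : m / 2 ≤ N * ‖z - latticePoint N j k‖ := by
      have : m - 1 / 2 ≤ N * ‖z - latticePoint N j k‖ := by
        rcases max_choice |(α : ℝ)| |(β : ℝ)| with h0 | h0 <;> rw [hm, h0] <;> assumption
      linarith
    have hprod : √(1 + |(α : ℝ)|) * √(1 + |(β : ℝ)|) ≤ 2 * m := by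
      calc √(1 + |(α : ℝ)|) * √(1 + |(β : ℝ)|) ≤ √(1 + m) * √(1 + m) := by
            gcongr
            · exact le_max_left _ _
            · exact le_max_right _ _
        _ = 1 + m := Real.mul_self_sqrt (by linarith)
        _ ≤ 2 * m := by linarith
    rw [zero_add, ← mul_inv, ← div_eq_mul_inv, div_le_div_iff₀ hz0 (by positivity)]
    calc r * (√(1 + |(α : ℝ)|) * √(1 + |(β : ℝ)|)) ≤ r * (2 * m) := by gcongr
      _ ≤ r * (4 * (N * ‖z - latticePoint N j k‖)) :=
          mul_le_mul_of_nonneg_left (by linarith) hr.le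
      _ = _ := by ring

/-- At `x` there are sums of simple fractions with poles off `X` that are bounded by `2` on `X`
and whose derivatives at `x` are arbitrarily large. -/
def HasLargeDerivatives (X : Set ℂ) (x : ℂ) : Prop :=
  ∀ n : ℕ, ∃ (κ : Type) (s : Finset κ) (c b : κ → ℂ), (∀ k ∈ s, b k ∉ X) ∧
    (∀ z ∈ X, ‖∑ k ∈ s, c k / (z - b k)‖ ≤ 2) ∧ (n : ℝ) ≤ ‖∑ k ∈ s, c k / (x - b k) ^ 2‖

/-- Sums of `r / |z - p|` over a triangular block of lattice points `p`, the kind of block that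
`exists_lattice_holes` uses. -/
lemma sum_sigma_le_of_shift {M N : ℕ} (hN : 0 < N) {r : ℝ} (hr : 0 < r) {z : ℂ} {j₀ k₀ : ℤ}
    (hz : ∀ j ∈ Finset.range M, ∀ k ∈ Finset.range (j + 1),
      r ≤ ‖z - latticePoint N (j₀ + j) (k₀ + k)‖) :
    ∑ p ∈ (Finset.range M).sigma fun j => Finset.range (j + 1),
      r / ‖z - latticePoint N (j₀ + p.1) (k₀ + p.2)‖ ≤ 1 + 64 * r * N * M := by
  set T := (Finset.range M).sigma fun j => Finset.range (j + 1) with hT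
  have h1 : ∀ p ∈ T, r / ‖z - latticePoint N (j₀ + p.1) (k₀ + p.2)‖ ≤ _ := fun p hp =>
    div_norm_sub_latticePoint_le hN hr
      (hz p.1 (Finset.mem_sigma.1 hp).1 p.2 (Finset.mem_sigma.1 hp).2)
  refine (Finset.sum_le_sum h1).trans ?_
  rw [Finset.sum_add_distrib, ← Finset.mul_sum]
  refine add_le_add ?_ ?_
  · rw [← Finset.sum_filter, Finset.sum_const, nsmul_eq_mul, mul_one]
    have : (T.filter fun p => (j₀ + (p.1 : ℤ), k₀ + (p.2 : ℤ)) =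
        (round (N * z.re), round (N * z.im))).card ≤ 1 := by
      refine Finset.card_le_one.2 fun p hp q hq => ?_
      have h2 := (Finset.mem_filter.1 hp).2
      have h3 := (Finset.mem_filter.1 hq).2
      rw [← h3, Prod.mk.injEq] at h2
      have e1 : p.1 = q.1 := by have := h2.1; omega
      have e2 : p.2 = q.2 := by have := h2.2; omega
      exact Sigma.ext e1 (heq_of_eq e2)
    exact_mod_cast this
  · have hsub : T ⊆ (Finset.range M).sigma fun _ => Finset.range M := by
      intro p hp
      obtain ⟨h2, h3⟩ := Finset.mem_sigma.1 hp
      rw [Finset.mem_range] at h2 h3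
      exact Finset.mem_sigma.2 ⟨Finset.mem_range.2 h2, Finset.mem_range.2 (by omega)⟩
    have hsum := Finset.sum_le_sum_of_subset_of_nonneg (f := fun p : Σ _ : ℕ, ℕ =>
      (√(1 + |((j₀ + p.1 - round (N * z.re) : ℤ) : ℝ)|))⁻¹ *
          (√(1 + |((k₀ + p.2 - round (N * z.im) : ℤ) : ℝ)|))⁻¹) hsub
      fun p _ _ => by positivity
    rw [Finset.sum_sigma (Finset.range M) fun _ => Finset.range M] at hsum
    dsimp only at hsum
    rw [← Finset.sum_mul_sum] at hsum
    have hs1 := sum_inv_sqrt_le M (j₀ - round (N * z.re))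
    have hs2 := sum_inv_sqrt_le M (k₀ - round (N * z.im))
    simp only [sub_add_eq_add_sub] at hs1 hs2
    have hM : √(M : ℝ) * √(M : ℝ) = M := Real.mul_self_sqrt (by positivity)
    calc _ ≤ 4 * r * N * ((4 * √M) * (4 * √M)) := by
          refine mul_le_mul_of_nonneg_left (hsum.trans ?_) (by positivity)
          exact mul_le_mul hs1 hs2 (Finset.sum_nonneg fun _ _ => by positivity) (by positivity)
      _ = 64 * r * N * M := by linear_combination 64 * r * N * hM

/-- A fine lattice of tiny discs. With mesh `1 / N` and radii `A / N²` the total radius is of order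
`A`, whereas the derivatives at `x` of functions bounded by `2` reach `A ∑_{j ≤ M} 1 / j`, where `M`
is comparable to `N`; so a small total radius is compensated by the logarithmic divergence of
the harmonic series. -/
lemma exists_lattice_holes (n : ℕ) {ε : ℝ} (hε : 0 < ε) : ∃ H : HoleFamily, Nonempty H.ι ∧
    H.weight ≤ ENNReal.ofReal ε ∧
    ∀ x : ℂ, |x.re| ≤ 1 - 1 / (n + 1) → |x.im| ≤ 1 - 1 / (n + 1) → x ∉ H.holes →
      ∃ (κ : Type) (s : Finset κ) (c b : κ → ℂ), (∀ k ∈ s, b k ∈ H.holes) ∧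
        (∀ z ∉ H.holes, ‖∑ k ∈ s, c k / (z - b k)‖ ≤ 2) ∧
        (n : ℝ) ≤ ‖∑ k ∈ s, c k / (x - b k) ^ 2‖ := by
  -- the holes stay at distance `s` from the boundary, and `x` at distance `4 * s`
  set s : ℝ := 1 / (4 * (n + 1)) with hs
  have hs0 : 0 < s := by positivity
  have hs4 : s ≤ 1 / 4 := by
    rw [hs]
    exact one_div_le_one_div_of_le (by norm_num) (by linarith [(Nat.cast_nonneg n : (0:ℝ) ≤ n)])
  have hsn : (1 : ℝ) / (n + 1) = 4 * s := by
    rw [hs]; field_simp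
  set A : ℝ := min (1 / 64) (ε * s ^ 2 / 9) with hA
  have hA0 : 0 < A := by positivity
  have hA1 : A ≤ 1 / 64 := min_le_left _ _
  have hA2 : A ≤ ε * s ^ 2 / 9 := min_le_right _ _
  obtain ⟨M, hM⟩ := (Real.tendsto_sum_range_one_div_nat_succ_atTop.eventually_ge_atTop
    (4 * n / A)).exists
  obtain ⟨N, hN⟩ := exists_nat_ge ((M + 2) / s)
  rw [div_le_iff₀ hs0] at hN
  have hMnn : (0 : ℝ) ≤ M := Nat.cast_nonneg M
  have hNpos : (0 : ℝ) < N := by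
    by_contra h
    nlinarith
  have hN1 : (1 : ℝ) ≤ N := by exact_mod_cast (Nat.cast_pos.1 hNpos : 0 < N)
  have hN0 : 0 < N := Nat.cast_pos.1 hNpos
  set r : ℝ := A / N ^ 2 with hr
  have hr0 : 0 < r := by positivity
  have hrs : 2 * r ≤ s := by
    have h1 : r ≤ 1 / 64 / N := by
      rw [hr]
      gcongr
      exact le_self_pow₀ hN1 two_ne_zero
    have h2 : 1 / 64 / (N : ℝ) ≤ s / 2 := by
      rw [div_le_iff₀ hNpos]
      linarith
    linarith
  set J : ℤ := ⌊N * (1 - 2 * s)⌋ with hJ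
  have hJle : (J : ℝ) ≤ N * (1 - 2 * s) := Int.floor_le _
  have hJ0 : 0 ≤ J := Int.floor_nonneg.2 (by nlinarith)
  set I : Finset (ℤ × ℤ) := Finset.Icc (-J) J ×ˢ Finset.Icc (-J) J with hI
  have hdiv : ∀ j : ℤ, j ∈ Finset.Icc (-J) J → |(j : ℝ) / N| + 2 * r + s ≤ 1 := by
    intro j hj
    have h1 : |(j : ℝ)| ≤ J := by
      rw [Finset.mem_Icc, ← abs_le] at hj
      exact_mod_cast hj
    rw [abs_div, abs_of_pos hNpos]
    have : |(j : ℝ)| / N ≤ 1 - 2 * s := by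
      rw [div_le_iff₀ hNpos]
      linarith
    linarith
  let H : HoleFamily :=
    { ι := I
      countable := inferInstance
      center := fun p => latticePoint N p.1.1 p.1.2
      radius := fun _ => r
      gap := fun _ => s
      radius_pos := fun _ => hr0
      gap_pos := fun _ => hs0
      re_le := fun p => hdiv _ (Finset.mem_product.1 p.2).1
      im_le := fun p => hdiv _ (Finset.mem_product.1 p.2).2 }
  have hball : ∀ j ∈ Finset.Icc (-J) J, ∀ k ∈ Finset.Icc (-J) J,
      Metric.ball (latticePoint N j k) r ⊆ H.holes := fun j hj k hk =>
    Set.subset_iUnion_of_subset (⟨(j, k), Finset.mem_product.2 ⟨hj, hk⟩⟩ : I) subset_rfl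
  refine ⟨H, ⟨⟨(0, 0), ?_⟩⟩, ?_, fun x hx1 hx2 hx => ?_⟩
  · simp [hI, hJ0]
  · have h1 : H.weight = ∑' _ : I, ENNReal.ofReal (r / s ^ 2) := rfl
    rw [h1, tsum_fintype, Finset.sum_const, nsmul_eq_mul, ← ENNReal.ofReal_natCast,
      ← ENNReal.ofReal_mul (Nat.cast_nonneg _)]
    refine ENNReal.ofReal_le_ofReal ?_
    have h2 : ((Finset.univ : Finset I).card : ℝ) ≤ 9 * N ^ 2 := by
      have h3 : ((Finset.univ : Finset I).card : ℝ) = (2 * J + 1) * (2 * J + 1) := by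
        rw [Finset.card_univ, Fintype.card_coe, hI, Finset.card_product, Int.card_Icc]
        have : (((J + 1 - -J).toNat : ℤ) : ℝ) = 2 * J + 1 := by
          rw [Int.toNat_of_nonneg (by linarith)]
          push_cast
          ring
        rw [Nat.cast_mul]
        rw [Int.cast_natCast] at this
        rw [this]
      have h4 : (J : ℝ) ≤ N := by nlinarith
      have h5 : (0 : ℝ) ≤ J := by exact_mod_cast hJ0
      rw [h3]
      nlinarith
    calc ((Finset.univ : Finset I).card : ℝ) * (r / s ^ 2) ≤ 9 * N ^ 2 * (r / s ^ 2) := by gcongr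
      _ = 9 * A / s ^ 2 := by rw [hr]; field_simp
      _ ≤ ε := by
        rw [div_le_iff₀ (by positivity)]
        linarith
  · rw [hsn] at hx1 hx2
    -- poles at the lattice points in a triangle of side `M` above and to the right of `x`
    set j₀ : ℤ := ⌊N * x.re⌋ + 1 with hj₀
    set k₀ : ℤ := ⌊N * x.im⌋ + 1 with hk₀
    have hrange : ∀ t : ℝ, |t| ≤ 1 - 4 * s → ∀ i < M,
        ⌊N * t⌋ + 1 + (i : ℤ) ∈ Finset.Icc (-J) J := by
      intro t ht i hi
      have hfl := Int.floor_le (N * t)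
      have hfl2 := Int.lt_floor_add_one (N * t)
      have hi' : (i : ℝ) + 1 ≤ M := by exact_mod_cast hi
      have hi0 : (0 : ℝ) ≤ i := Nat.cast_nonneg i
      rw [abs_le] at ht
      have hNt1 : N * t ≤ N * (1 - 4 * s) := by gcongr; exact ht.2
      have hNt2 : N * -(1 - 4 * s) ≤ N * t := by gcongr; exact ht.1
      have up : ⌊N * t⌋ + 1 + (i : ℤ) ≤ J := by
        rw [hJ, Int.le_floor]
        push_cast
        nlinarith
      have low : -(⌊N * t⌋ + 1 + (i : ℤ)) ≤ J := by
        rw [hJ, Int.le_floor]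
        push_cast
        nlinarith
      exact Finset.mem_Icc.2 ⟨by linarith, up⟩
    have hsub : ∀ j ∈ Finset.range M, ∀ k ∈ Finset.range (j + 1),
        Metric.ball (latticePoint N (j₀ + j) (k₀ + k)) r ⊆ H.holes := by
      intro j hj k hk
      rw [Finset.mem_range] at hj hk
      exact hball _ (hrange _ hx1 j hj) _ (hrange _ hx2 k (by omega))
    have hfar : ∀ z ∉ H.holes, ∀ j ∈ Finset.range M, ∀ k ∈ Finset.range (j + 1),
        r ≤ ‖z - latticePoint N (j₀ + j) (k₀ + k)‖ := by
      intro z hz j hj k hk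
      by_contra h
      refine hz (hsub j hj k hk ?_)
      rw [Metric.mem_ball, dist_eq_norm]
      exact not_le.1 h
    set T := (Finset.range M).sigma fun j => Finset.range (j + 1) with hT
    set b : (Σ _ : ℕ, ℕ) → ℂ := fun p => latticePoint N (j₀ + p.1) (k₀ + p.2) with hb
    have hTmem : ∀ p ∈ T, p.1 ∈ Finset.range M ∧ p.2 ∈ Finset.range (p.1 + 1) := fun p hp =>
      Finset.mem_sigma.1 hp
    have hxb : ∀ p ∈ T, 0 < ‖x - b p‖ := fun p hp =>
      hr0.trans_le (hfar x hx _ (hTmem p hp).1 _ (hTmem p hp).2)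
    -- the coefficients are turned so that all contributions to the derivative at `x` add up
    refine ⟨Σ _ : ℕ, ℕ, T, fun p => r * ((x - b p) ^ 2 / (‖x - b p‖ : ℂ) ^ 2), b,
      fun p hp => ?_, fun z hz => ?_, ?_⟩
    · exact hsub _ (hTmem p hp).1 _ (hTmem p hp).2 (Metric.mem_ball_self hr0)
    · refine (norm_sum_le _ _).trans ?_
      have h1 : ∀ p ∈ T, ‖r * ((x - b p) ^ 2 / (‖x - b p‖ : ℂ) ^ 2) / (z - b p)‖ =
          r / ‖z - b p‖ := by
        intro p hp
        rw [norm_div, norm_mul, norm_div, norm_pow, norm_pow, Complex.norm_real, Complex.norm_real,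
          norm_norm, div_self (pow_ne_zero 2 (hxb p hp).ne'), mul_one, Real.norm_of_nonneg hr0.le]
      rw [Finset.sum_congr rfl h1]
      refine (sum_sigma_le_of_shift hN0 hr0 (hfar z hz)).trans ?_
      have hMN : (M : ℝ) ≤ N := by nlinarith
      have : 64 * r * N * M ≤ 1 := by
        calc 64 * r * N * M ≤ 64 * r * N * N := by gcongr
          _ = 64 * A := by rw [hr]; field_simp
          _ ≤ 1 := by linarith
      linarith
    · have h1 : ∀ p ∈ T, r * ((x - b p) ^ 2 / (‖x - b p‖ : ℂ) ^ 2) / (x - b p) ^ 2 =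
          ((r / ‖x - b p‖ ^ 2 : ℝ) : ℂ) := by
        intro p hp
        have h2 : x - b p ≠ 0 := norm_pos_iff.1 (hxb p hp)
        have h3 : (‖x - b p‖ : ℂ) ≠ 0 := by exact_mod_cast (hxb p hp).ne'
        push_cast
        field_simp
      rw [Finset.sum_congr rfl h1, ← Complex.ofReal_sum, Complex.norm_real]
      refine le_trans ?_ (le_abs_self _)
      have h2 : ∀ p ∈ T, A / (4 * ((p.1 : ℝ) + 1) ^ 2) ≤ r / ‖x - b p‖ ^ 2 := by
        intro p hp
        have hcoord : ∀ (t : ℝ) (i : ℕ), |t - ((⌊N * t⌋ + 1 + (i : ℤ) : ℤ) : ℝ) / N| ≤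
            (i + 1) / N := by
          intro t i
          have hfl := Int.floor_le (N * t)
          have hfl2 := Int.lt_floor_add_one (N * t)
          have : t - ((⌊N * t⌋ + 1 + (i : ℤ) : ℤ) : ℝ) / N =
              (N * t - ⌊N * t⌋ - 1 - i) / N := by
            push_cast
            field_simp
            ring
          rw [this, abs_div, abs_of_pos hNpos]
          gcongr
          rw [abs_le]
          have hi0 : (0 : ℝ) ≤ i := Nat.cast_nonneg i
          exact ⟨by linarith, by linarith⟩
        have hp2 : (p.2 : ℝ) ≤ p.1 := by
          have := Finset.mem_range.1 (hTmem p hp).2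
          exact_mod_cast Nat.lt_succ_iff.1 this
        have hnorm : ‖x - b p‖ ≤ 2 * (p.1 + 1) / N := by
          refine (Complex.norm_le_abs_re_add_abs_im _).trans ?_
          refine (add_le_add (hcoord x.re p.1) (hcoord x.im p.2)).trans ?_
          rw [← add_div]
          gcongr
          linarith
        have hpos := hxb p hp
        have : A / (4 * ((p.1 : ℝ) + 1) ^ 2) = r / (2 * (p.1 + 1) / N) ^ 2 := by
          rw [hr]
          field_simp
          ring
        rw [this]
        gcongr
      refine le_trans ?_ (Finset.sum_le_sum h2)
      rw [hT, Finset.sum_sigma]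
      have h3 : ∀ j ∈ Finset.range M, ∑ _k ∈ Finset.range (j + 1), A / (4 * ((j : ℝ) + 1) ^ 2) =
          A / 4 * (1 / ((j : ℝ) + 1)) := by
        intro j _
        rw [Finset.sum_const, Finset.card_range, nsmul_eq_mul]
        push_cast
        field_simp
      rw [Finset.sum_congr rfl h3, ← Finset.mul_sum]
      have h4 : A / 4 * (4 * n / A) ≤ A / 4 * ∑ i ∈ Finset.range M, 1 / ((i : ℝ) + 1) := by
        gcongr
      calc (n : ℝ) = A / 4 * (4 * n / A) := by field_simp
        _ ≤ _ := h4

/-! ### Functions vanishing on a half-plane -/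

lemma norm_one_sub_exp_sq (v : ℂ) : ‖1 - Complex.exp v‖ ^ 2 =
    (1 - Real.exp v.re) ^ 2 + 2 * Real.exp v.re * (1 - Real.cos v.im) := by
  rw [Complex.sq_norm, Complex.normSq_apply, Complex.sub_re, Complex.sub_im, Complex.exp_re,
    Complex.exp_im, Complex.one_re, Complex.one_im]
  linear_combination (Real.exp v.re) ^ 2 * Real.sin_sq_add_cos_sq v.im

lemma le_norm_one_sub_exp {v : ℂ} {δ : ℝ} (hδ : 0 < δ) (hδ1 : δ ≤ 1) (hv : |v.im| ≤ Real.pi)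
    (hδv : δ ≤ ‖v‖) : δ / 8 ≤ ‖1 - Complex.exp v‖ := by
  refine le_of_sq_le_sq ?_ (norm_nonneg _)
  rw [norm_one_sub_exp_sq]
  have hcos : 0 ≤ 1 - Real.cos v.im := by linarith [Real.cos_le_one v.im]
  have hexp := Real.exp_pos v.re
  by_cases hx : δ / 2 ≤ |v.re|
  · have h1 : δ / 8 ≤ |1 - Real.exp v.re| := by
      rcases le_abs.1 hx with h | h
      · rw [abs_sub_comm]
        refine le_trans ?_ (le_abs_self _)
        linarith [Real.add_one_le_exp v.re]
      · refine le_trans ?_ (le_abs_self _)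
        have h2 : Real.exp v.re ≤ Real.exp (-(δ / 2)) := Real.exp_le_exp.2 (by linarith)
        have h3 : Real.exp (-(δ / 2)) * (1 + δ / 2) ≤ 1 := by
          have := Real.add_one_le_exp (δ / 2)
          calc Real.exp (-(δ / 2)) * (1 + δ / 2) ≤ Real.exp (-(δ / 2)) * Real.exp (δ / 2) := by
                gcongr; linarith
            _ = 1 := by rw [← Real.exp_add]; simp
        nlinarith
    have h2 : (δ / 8) ^ 2 ≤ (1 - Real.exp v.re) ^ 2 := by
      rw [← sq_abs (1 - Real.exp v.re)]
      gcongr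
    nlinarith [mul_nonneg hexp.le hcos]
  · rw [not_le] at hx
    have hy : δ / 2 ≤ |v.im| := by
      have := Complex.norm_le_abs_re_add_abs_im v
      linarith
    have h1 := Real.cos_le_one_sub_mul_cos_sq hv
    have h2 : 1 / 2 ≤ Real.exp v.re := by
      have := Real.add_one_le_exp v.re
      have := (abs_lt.1 hx).1
      linarith
    have h3 : 1 / 16 ≤ 2 / Real.pi ^ 2 := by
      rw [div_le_div_iff₀ (by norm_num) (by positivity)]
      nlinarith [Real.pi_lt_four, Real.pi_pos]
    have h4 : (δ / 2) ^ 2 ≤ v.im ^ 2 := by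
      rw [← sq_abs v.im]
      gcongr
    have h5 : 1 / 16 * (δ / 2) ^ 2 ≤ 1 - Real.cos v.im := by
      have : 1 / 16 * (δ / 2) ^ 2 ≤ 2 / Real.pi ^ 2 * v.im ^ 2 := by gcongr
      linarith
    nlinarith [sq_nonneg (1 - Real.exp v.re)]

/-- Away from its zeros `(2j + 1)πi` the function `1 + exp` is bounded below. -/
lemma le_norm_one_add_exp {w : ℂ} {δ : ℝ} (hδ : 0 < δ) (hδ1 : δ ≤ 1)
    (hw : ∀ j : ℤ, δ ≤ ‖w - (2 * j + 1) * Real.pi * Complex.I‖) :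
    δ / 8 ≤ ‖1 + Complex.exp w‖ := by
  set j : ℤ := ⌊w.im / (2 * Real.pi)⌋ with hj
  set v : ℂ := w - (2 * j + 1) * Real.pi * Complex.I with hv
  have h1 : Complex.exp w = -Complex.exp v := by
    have : w = v + Real.pi * Complex.I + j * (2 * Real.pi * Complex.I) := by rw [hv]; ring
    rw [this, Complex.exp_add, Complex.exp_int_mul_two_pi_mul_I, mul_one, Complex.exp_add,
      Complex.exp_pi_mul_I]
    ring
  have hpi := Real.pi_pos
  have him : v.im = w.im - (2 * j + 1) * Real.pi := by simp [hv]
  rw [h1, ← sub_eq_add_neg]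
  refine le_norm_one_sub_exp hδ hδ1 ?_ (hw j)
  have h2 := Int.floor_le (w.im / (2 * Real.pi))
  have h3 := Int.lt_floor_add_one (w.im / (2 * Real.pi))
  rw [← hj, le_div_iff₀ (by positivity)] at h2
  rw [← hj, div_lt_iff₀ (by positivity)] at h3
  rw [him, abs_le]
  exact ⟨by linarith, by linarith⟩

lemma norm_inv_one_add_exp_le {w : ℂ} {τ : ℝ} (hτ : Real.exp (-τ) ≤ 1 / 2) (hw : τ ≤ w.re) :
    ‖(1 + Complex.exp w)⁻¹‖ ≤ 2 * Real.exp (-τ) := by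
  have h1 : Real.exp w.re - 1 ≤ ‖1 + Complex.exp w‖ := by
    have := norm_sub_norm_le (Complex.exp w) (-1)
    rw [Complex.norm_exp, norm_neg, norm_one, sub_neg_eq_add, add_comm (Complex.exp w)] at this
    exact this
  have h2 : Real.exp τ ≤ Real.exp w.re := Real.exp_le_exp.2 hw
  have h3 : Real.exp (-τ) * Real.exp τ = 1 := by rw [← Real.exp_add]; simp
  have h4 := Real.exp_pos τ
  have h5 : 2 ≤ Real.exp τ := by nlinarith
  rw [norm_inv, inv_le_comm₀ (by linarith) (by positivity)]
  have h6 : (2 * Real.exp (-τ))⁻¹ = Real.exp τ / 2 := by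
    rw [Real.exp_neg]; field_simp
  rw [h6]
  linarith

lemma norm_inv_one_add_exp_sub_one_le {w : ℂ} {τ : ℝ} (hτ : Real.exp (-τ) ≤ 1 / 2)
    (hw : w.re ≤ -τ) : ‖(1 + Complex.exp w)⁻¹ - 1‖ ≤ 2 * Real.exp (-τ) := by
  have h1 : 1 - Real.exp w.re ≤ ‖1 + Complex.exp w‖ := by
    have := norm_sub_norm_le (1 : ℂ) (-Complex.exp w)
    rw [norm_neg, Complex.norm_exp, norm_one, sub_neg_eq_add] at this
    exact this
  have h2 : Real.exp w.re ≤ Real.exp (-τ) := Real.exp_le_exp.2 hw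
  have h3 : 1 / 2 ≤ ‖1 + Complex.exp w‖ := by linarith
  have h4 : 1 + Complex.exp w ≠ 0 := norm_pos_iff.1 (by linarith)
  have h5 : (1 + Complex.exp w)⁻¹ - 1 = -Complex.exp w / (1 + Complex.exp w) := by
    field_simp
    ring
  rw [h5, norm_div, norm_neg, Complex.norm_exp, div_le_iff₀ (by linarith)]
  nlinarith [Real.exp_pos (-τ)]

/-- An infinite product of functions `h k`, each a steep step down from `1` to `0` at abscissas
`t k ↑ b`. Near its own step `h k` is only bounded by `B k`, but there the previous factor is already
tiny, whence the hypothesis on `E k * (1 + B (k + 1))`. -/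
lemma exists_limit_of_steps {S : Set ℂ} {h : ℕ → ℂ → ℂ} {t E B : ℕ → ℝ} {b : ℝ}
    (hright : ∀ k, ∀ z ∈ S, t k ≤ z.re → ‖h k z‖ ≤ E k)
    (hleft : ∀ k, ∀ z ∈ S, z.re ≤ t k → ‖h (k + 1) z - 1‖ ≤ E (k + 1))
    (hB : ∀ k, ∀ z ∈ S, ‖h k z‖ ≤ B k) (hB0 : ∀ k, 0 ≤ B k) (hE0 : ∀ k, 0 ≤ E k)
    (hEB : ∀ k, E k * (1 + B (k + 1)) ≤ (1 / 4) ^ (k + 1)) (ht : ∀ k, t k < b)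
    (htb : Filter.Tendsto t Filter.atTop (nhds b)) (h0 : ∀ k, ∀ z ∈ S, h k z ≠ 0) :
    ∃ F : ℂ → ℂ, TendstoUniformlyOn (fun K z => ∏ k ∈ Finset.range K, h k z) F Filter.atTop S ∧
      ∀ z ∈ S, F z = 0 ↔ b ≤ z.re := by
  set P : ℕ → ℂ → ℂ := fun K z => ∏ k ∈ Finset.range K, h k z with hP
  have hPsucc : ∀ K z, P (K + 1) z = P K z * h K z := fun K z => Finset.prod_range_succ _ _
  have hE4 : ∀ k, E k ≤ (1 / 4) ^ (k + 1) := fun k => by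
    have := mul_nonneg (hE0 k) (hB0 (k + 1))
    linarith [hEB k]
  set β : ℝ := 1 + B 0 with hβ
  have hβ1 : 1 ≤ β := by linarith [hB0 0]
  have hh1 : ∀ k, ∀ z ∈ S, ‖h k z - 1‖ ≤ 1 + B k := fun k z hz => by
    refine (norm_sub_le _ _).trans ?_
    rw [norm_one]
    linarith [hB k z hz]
  have hquarter : ∀ k : ℕ, ((1 : ℝ) / 4) ^ k = ((1 / 2) ^ k) ^ 2 := fun k => by
    rw [← pow_mul, mul_comm k 2, pow_mul]; norm_num
  have hbound : ∀ K, ∀ z ∈ S, ‖P K z‖ ≤ β * (2 - (1 / 2) ^ K) ∧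
      ‖P (K + 1) z‖ ≤ β * (2 - (1 / 2) ^ (K + 1)) := by
    intro K z hz
    induction K with
    | zero =>
      refine ⟨?_, ?_⟩
      · simp only [hP, Finset.range_zero, Finset.prod_empty, norm_one, pow_zero]
        linarith
      · rw [hPsucc]
        simp only [hP, Finset.range_zero, Finset.prod_empty, one_mul]
        have := hB 0 z hz
        norm_num
        linarith
    | succ K ih =>
      refine ⟨ih.2, ?_⟩
      set q : ℝ := (1 / 2) ^ (K + 2) with hq
      have hq0 : 0 < q := by positivity
      have hq1 : q ≤ 1 := pow_le_one₀ (by norm_num) (by norm_num)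
      have e1 : ((1 : ℝ) / 2) ^ (K + 1) = 2 * q := by rw [hq, pow_succ _ (K + 1)]; ring
      have e2 : ((1 : ℝ) / 2) ^ K = 4 * q := by rw [hq, pow_succ, pow_succ]; ring
      rcases le_total z.re (t K) with hzt | hzt
      · have h1 := hleft K z hz hzt
        have h2 := hE4 (K + 1)
        rw [hquarter] at h2
        have h3 : ‖h (K + 1) z‖ ≤ 1 + q ^ 2 := by
          have := norm_le_norm_add_norm_sub' (h (K + 1) z) 1
          rw [norm_one] at this
          linarith
        rw [hPsucc, norm_mul]
        have h4 := ih.2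
        rw [e1] at h4
        have h5 : 0 ≤ β * (2 - 2 * q) := mul_nonneg (by linarith) (by linarith)
        calc ‖P (K + 1) z‖ * ‖h (K + 1) z‖ ≤ β * (2 - 2 * q) * (1 + q ^ 2) := by gcongr
          _ = β * (2 - q) - β * q * (1 - 2 * q + 2 * q ^ 2) := by ring
          _ ≤ β * (2 - q) := by
            have : 0 ≤ β * q * (1 - 2 * q + 2 * q ^ 2) :=
              mul_nonneg (by positivity) (by nlinarith [sq_nonneg (1 - 2 * q)])
            linarith
      · have h1 := hright K z hz hzt
        have h2 := hB (K + 1) z hz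
        have h3 : ‖h K z‖ * ‖h (K + 1) z‖ ≤ 1 := by
          calc ‖h K z‖ * ‖h (K + 1) z‖ ≤ E K * B (K + 1) := by
                gcongr
                exact hE0 K
            _ ≤ (1 / 4) ^ (K + 1) := by linarith [hEB K, hE0 K]
            _ ≤ 1 := pow_le_one₀ (by norm_num) (by norm_num)
        rw [hPsucc, hPsucc, norm_mul, norm_mul, mul_assoc]
        calc ‖P K z‖ * (‖h K z‖ * ‖h (K + 1) z‖) ≤ ‖P K z‖ * 1 := by gcongr
          _ ≤ β * (2 - 4 * q) := by rw [mul_one, ← e2]; exact ih.1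
          _ ≤ β * (2 - q) := by gcongr; linarith
  have hbound' : ∀ K, ∀ z ∈ S, ‖P K z‖ ≤ 2 * β := fun K z hz => by
    have : (0 : ℝ) < (1 / 2) ^ K := by positivity
    nlinarith [(hbound K z hz).1]
  have hincr : ∀ K, ∀ z ∈ S, ‖P (K + 1) z - P K z‖ ≤ 2 * β * (1 / 4) ^ K := by
    intro K z hz
    have e : P (K + 1) z - P K z = P K z * (h K z - 1) := by rw [hPsucc]; ring
    rw [e, norm_mul]
    cases K with
    | zero =>
      have := hh1 0 z hz
      simp only [hP, Finset.range_zero, Finset.prod_empty, norm_one, pow_zero, one_mul]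
      linarith
    | succ K =>
      rcases le_total z.re (t K) with hzt | hzt
      · have h1 : ‖h (K + 1) z - 1‖ ≤ (1 / 4) ^ (K + 1) := by
          refine (hleft K z hz hzt).trans ((hE4 (K + 1)).trans ?_)
          exact pow_le_pow_of_le_one (by norm_num) (by norm_num) (by omega)
        exact mul_le_mul (hbound' _ z hz) h1 (norm_nonneg _) (by linarith)
      · rw [hPsucc, norm_mul, mul_assoc]
        refine mul_le_mul (hbound' _ z hz) ?_ (by positivity) (by linarith)
        refine le_trans ?_ (hEB K)
        exact mul_le_mul (hright K z hz hzt) (hh1 _ z hz) (norm_nonneg _) (hE0 K)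
  have hsum : Summable fun K : ℕ => 2 * β * ((1 : ℝ) / 4) ^ K :=
    (summable_geometric_of_lt_one (by norm_num) (by norm_num)).mul_left _
  have hunif := tendstoUniformlyOn_tsum_nat hsum hincr
  set F : ℂ → ℂ := fun z => (∑' K, (P (K + 1) z - P K z)) + 1 with hF
  have hPF : TendstoUniformlyOn P F Filter.atTop S := by
    rw [Metric.tendstoUniformlyOn_iff] at hunif ⊢
    intro ε hε
    filter_upwards [hunif ε hε] with K hK z hz
    have h1 := hK z hz
    have e : ∑ n ∈ Finset.range K, (P (n + 1) z - P n z) = P K z - 1 := by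
      rw [Finset.sum_range_sub (fun n => P n z) K]
      simp [hP]
    rw [e, dist_eq_norm] at h1
    rw [dist_eq_norm]
    convert h1 using 2
    simp only [hF]
    ring
  have hlim : ∀ z ∈ S, Filter.Tendsto (fun K => P K z) Filter.atTop (nhds (F z)) := fun z hz =>
    hPF.tendsto_at hz
  refine ⟨F, hPF, fun z hz => ⟨fun hFz => ?_, fun hbz => ?_⟩⟩
  · by_contra hzb
    rw [not_le] at hzb
    obtain ⟨k₀, hk₀⟩ := Filter.eventually_atTop.1 (htb.eventually_const_le hzb)
    have hpos : 0 < ‖P (k₀ + 1) z‖ := norm_pos_iff.2 (Finset.prod_ne_zero_iff.2 fun k _ => h0 k z hz)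
    have hlow : ∀ i : ℕ, ‖P (k₀ + 1) z‖ * (1 / 2 + (1 / 2) ^ (i + 1)) ≤ ‖P (k₀ + 1 + i) z‖ := by
      intro i
      induction i with
      | zero => norm_num
      | succ i ih =>
        have h1 := hleft (k₀ + i) z hz (hk₀ _ (by omega))
        have h2 : ((1 : ℝ) / 4) ^ (k₀ + i + 1 + 1) ≤ (1 / 4) ^ (i + 1) :=
          pow_le_pow_of_le_one (by norm_num) (by norm_num) (by omega)
        have h3 := (h1.trans (hE4 _)).trans h2
        rw [hquarter] at h3
        set x : ℝ := (1 / 2) ^ (i + 1) with hx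
        have hx0 : 0 < x := by positivity
        have hx1 : x ≤ 1 / 2 := by
          rw [hx, pow_succ]
          have : ((1 : ℝ) / 2) ^ i ≤ 1 := pow_le_one₀ (by norm_num) (by norm_num)
          linarith
        have e1 : ((1 : ℝ) / 2) ^ (i + 1 + 1) = x / 2 := by rw [pow_succ, hx]; ring
        have h4 : 1 - x ^ 2 ≤ ‖h (k₀ + i + 1) z‖ := by
          have := norm_le_norm_add_norm_sub' 1 (h (k₀ + i + 1) z)
          rw [norm_one, norm_sub_rev] at this
          linarith
        have e2 : k₀ + 1 + (i + 1) = (k₀ + 1 + i) + 1 := by ring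
        have e3 : k₀ + 1 + i = k₀ + i + 1 := by ring
        have e4 : P (k₀ + 1 + (i + 1)) z = P (k₀ + i + 1) z * h (k₀ + i + 1) z := by
          rw [e2, hPsucc, e3]
        rw [e1, e4, norm_mul]
        rw [e3] at ih
        have h5 : 0 ≤ 1 - x ^ 2 := by nlinarith
        calc ‖P (k₀ + 1) z‖ * (1 / 2 + x / 2)
            ≤ ‖P (k₀ + 1) z‖ * ((1 / 2 + x) * (1 - x ^ 2)) := by
              gcongr
              nlinarith [mul_pos hx0 hx0]
          _ = ‖P (k₀ + 1) z‖ * (1 / 2 + x) * (1 - x ^ 2) := by ring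
          _ ≤ _ := by gcongr
    have hlim2 := ((hlim z hz).comp (Filter.tendsto_add_atTop_nat (k₀ + 1))).norm
    have hge : ‖P (k₀ + 1) z‖ / 2 ≤ ‖F z‖ := by
      refine ge_of_tendsto hlim2 (Filter.Eventually.of_forall fun i => ?_)
      have h1 := hlow i
      have h2 : (0 : ℝ) < (1 / 2) ^ (i + 1) := by positivity
      simp only [Function.comp_apply]
      rw [add_comm i]
      nlinarith
    rw [hFz, norm_zero] at hge
    linarith
  · refine tendsto_nhds_unique ((hlim z hz).comp (Filter.tendsto_add_atTop_nat 1)) ?_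
    refine squeeze_zero_norm (a := fun k => 2 * β * (1 / 4) ^ (k + 1)) (fun k => ?_) ?_
    · simp only [Function.comp_apply]
      rw [hPsucc, norm_mul]
      exact mul_le_mul (hbound' k z hz)
        ((hright k z hz ((ht k).le.trans hbz)).trans (hE4 k)) (norm_nonneg _) (by linarith)
    · have h1 : Filter.Tendsto (fun k : ℕ => ((1 : ℝ) / 4) ^ k) Filter.atTop (nhds 0) :=
        tendsto_pow_atTop_nhds_zero_of_lt_one (by norm_num) (by norm_num)
      simpa using (h1.comp (Filter.tendsto_add_atTop_nat 1)).const_mul (2 * β)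

/-- A choice of scale for the slopes `μ 4 ^ k` of the steps: the exponential smallness of one step
beats the bound, cubic in the slope, that the next step satisfies near its poles. -/
lemma exists_nat_step_scale {g η : ℝ} (hg : 0 < g) (hη : 0 < η) (hη1 : η ≤ 1) (R : ℝ) :
    ∃ μ : ℕ, 0 < μ ∧ R ≤ μ ∧ ∀ k : ℕ, 2 * Real.exp (-(μ * g * 2 ^ k)) *
      (1 + 2 * ((μ * 4 ^ (k + 1) : ℕ) : ℝ) ^ 3 / η) ≤ (1 / 4) ^ (k + 1) := by
  -- `exp (-x) ≤ 8! / x ^ 8` is enough, and `61931520 = 2 * 8! * 192 * 4`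
  obtain ⟨μ, hμ⟩ := exists_nat_ge (max (max R 1) (61931520 / (η * g ^ 8)))
  have h1 : R ≤ μ := ((le_max_left _ _).trans (le_max_left _ _)).trans hμ
  have h2 : (1 : ℝ) ≤ μ := ((le_max_right _ _).trans (le_max_left _ _)).trans hμ
  have h3 : 61931520 / (η * g ^ 8) ≤ μ := (le_max_right _ _).trans hμ
  have hμ0 : (0 : ℝ) < μ := by linarith
  refine ⟨μ, by exact_mod_cast hμ0, h1, fun k => ?_⟩
  set q : ℝ := 2 ^ k with hq
  have hq1 : 1 ≤ q := one_le_pow₀ (by norm_num)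
  have hq0 : 0 < q := by linarith
  have e4 : (4 : ℝ) ^ k = q ^ 2 := by rw [hq, ← pow_mul, mul_comm k 2, pow_mul]; norm_num
  have hm : ((μ * 4 ^ (k + 1) : ℕ) : ℝ) = 4 * μ * q ^ 2 := by
    push_cast
    rw [pow_succ, e4]
    ring
  have hexp : Real.exp (-(μ * g * q)) ≤ 40320 / (μ * g * q) ^ 8 := by
    have h4 := Real.pow_div_factorial_le_exp (μ * g * q) (by positivity) 8
    have h5 : ((Nat.factorial 8 : ℕ) : ℝ) = 40320 := by norm_num [Nat.factorial]
    rw [h5] at h4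
    rw [Real.exp_neg, inv_le_comm₀ (Real.exp_pos _) (by positivity), inv_div]
    exact h4
  have hB : 1 + 2 * (4 * μ * q ^ 2) ^ 3 / η ≤ 192 * μ ^ 3 * q ^ 6 / η := by
    have h6 : 1 ≤ (4 * μ * q ^ 2) ^ 3 / η := by
      rw [le_div_iff₀ hη, one_mul]
      refine hη1.trans (one_le_pow₀ ?_)
      nlinarith
    calc 1 + 2 * (4 * μ * q ^ 2) ^ 3 / η
        ≤ (4 * μ * q ^ 2) ^ 3 / η + 2 * (4 * μ * q ^ 2) ^ 3 / η := by linarith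
      _ = 192 * μ ^ 3 * q ^ 6 / η := by ring
  have hr : ((1 : ℝ) / 4) ^ (k + 1) = 1 / (4 * q ^ 2) := by
    rw [div_pow, one_pow, pow_succ, e4]
    ring
  rw [hm, hr]
  calc 2 * Real.exp (-(μ * g * q)) * (1 + 2 * (4 * μ * q ^ 2) ^ 3 / η)
      ≤ 2 * (40320 / (μ * g * q) ^ 8) * (192 * μ ^ 3 * q ^ 6 / η) := by gcongr
    _ = 61931520 / (η * g ^ 8) / (μ ^ 5) * (1 / (4 * q ^ 2)) := by
        field_simp
        ring
    _ ≤ 1 * (1 / (4 * q ^ 2)) := by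
        gcongr
        rw [div_le_one (by positivity)]
        exact h3.trans (le_self_pow₀ h2 (by norm_num))
    _ = 1 / (4 * q ^ 2) := one_mul _

/-- Holes around the poles of `1 / (1 + exp (2πm (z - c)))`, which lie on the line `Re z = c` at the
odd multiples of `1 / (2m)`; the sides of the square are midway between two of them. -/
lemma le_norm_one_add_exp_of_far {m : ℕ} (hm : 0 < m) {c η : ℝ} (hη : 0 < η) (hη1 : η ≤ 1 / 8)
    {z : ℂ} (hz : |z.im| ≤ 1)
    (hfar : ∀ j : Fin (2 * m), η / m ^ 4 ≤ ‖z - (⟨c, (2 * (j : ℕ) + 1 - 2 * m) / (2 * m)⟩ : ℂ)‖) :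
    ‖(1 + Complex.exp ((2 * Real.pi * m : ℝ) * (z - c)))⁻¹‖ ≤ 2 * (m : ℝ) ^ 3 / η ∧
      1 + Complex.exp ((2 * Real.pi * m : ℝ) * (z - c)) ≠ 0 := by
  have hm1 : (1 : ℝ) ≤ m := by exact_mod_cast hm
  have hm0 : (0 : ℝ) < m := by linarith
  have hpi := Real.pi_pos
  set δ : ℝ := 2 * Real.pi * η / m ^ 3 with hδ
  have hδ0 : 0 < δ := by positivity
  have hδ1 : δ ≤ 1 := by
    rw [hδ, div_le_one (by positivity)]
    have : (1 : ℝ) ≤ (m : ℝ) ^ 3 := one_le_pow₀ hm1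
    nlinarith [Real.pi_lt_four]
  have key : δ / 8 ≤ ‖1 + Complex.exp ((2 * Real.pi * m : ℝ) * (z - c))‖ := by
    refine le_norm_one_add_exp hδ0 hδ1 fun j => ?_
    have e : ((2 * Real.pi * m : ℝ) : ℂ) * (z - c) - (2 * j + 1) * Real.pi * Complex.I =
        (2 * Real.pi * m : ℝ) * (z - (⟨c, (2 * j + 1) / (2 * m)⟩ : ℂ)) := by
      apply Complex.ext
      · simp
      · simp
        field_simp
    rw [e, norm_mul, Complex.norm_real, Real.norm_of_nonneg (by positivity)]
    have hdist : η / m ^ 4 ≤ ‖z - (⟨c, (2 * j + 1) / (2 * m)⟩ : ℂ)‖ := by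
      by_cases hj : 0 ≤ j + m ∧ j + m < 2 * m
      · have hlt : (j + m).toNat < 2 * m := by omega
        have h1 := hfar ⟨(j + m).toNat, hlt⟩
        have h2 : (((j + m).toNat : ℕ) : ℝ) = j + m := by
          have : (((j + m).toNat : ℕ) : ℤ) = j + m := Int.toNat_of_nonneg hj.1
          exact_mod_cast this
        have h3 : (2 * (((j + m).toNat : ℕ) : ℝ) + 1 - 2 * m) / (2 * m) = (2 * j + 1) / (2 * m) := by
          rw [h2]; ring
        simp only [h3] at h1
        exact h1
      · have h1 : 2 * (m : ℝ) + 1 ≤ |2 * (j : ℝ) + 1| := by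
          have h2 : 2 * (m : ℤ) + 1 ≤ |2 * j + 1| := by
            rw [le_abs]
            omega
          exact_mod_cast h2
        have h2 : 1 + 1 / (2 * m) ≤ |(2 * (j : ℝ) + 1) / (2 * m)| := by
          rw [abs_div, abs_of_pos (by positivity : (0 : ℝ) < 2 * m), le_div_iff₀ (by positivity)]
          field_simp
          linarith
        have h3 := Complex.abs_im_le_norm (z - (⟨c, (2 * j + 1) / (2 * m)⟩ : ℂ))
        rw [Complex.sub_im] at h3
        have h4 := abs_sub_abs_le_abs_sub ((2 * (j : ℝ) + 1) / (2 * m)) z.im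
        rw [abs_sub_comm] at h4
        have h5 : η / m ^ 4 ≤ 1 / (2 * m) := by
          rw [div_le_div_iff₀ (by positivity) (by positivity)]
          have : (m : ℝ) ≤ m ^ 4 := le_self_pow₀ hm1 (by norm_num)
          nlinarith
        linarith
    calc δ = 2 * Real.pi * m * (η / m ^ 4) := by
          rw [hδ]; field_simp
      _ ≤ _ := by gcongr
  have hpos : 0 < ‖1 + Complex.exp ((2 * Real.pi * m : ℝ) * (z - c))‖ := by linarith
  refine ⟨?_, norm_pos_iff.1 hpos⟩
  rw [norm_inv, inv_le_comm₀ hpos (by positivity), inv_div]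
  refine le_trans ?_ key
  rw [hδ, div_div, div_le_div_iff₀ (by positivity) (by positivity)]
  have : (0 : ℝ) < η * m ^ 3 := by positivity
  nlinarith [Real.pi_gt_three]

/-- For every `b` there are holes of small weight off which some uniform limit of products of the
functions `1 / (1 + exp (L (z - c)))` vanishes exactly where `b ≤ Re z`. -/
lemma exists_strip_holes {b ε : ℝ} (hb : |b| < 1) (hε : 0 < ε) : ∃ H : HoleFamily,
    H.weight ≤ ENNReal.ofReal ε ∧ ∃ (L c : ℕ → ℝ) (F : ℂ → ℂ),
      (∀ z ∈ squareQ \ H.holes, ∀ k, 1 + Complex.exp (L k * (z - c k)) ≠ 0) ∧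
      TendstoUniformlyOn
        (fun K z => ∏ k ∈ Finset.range K, (1 + Complex.exp (L k * (z - c k)))⁻¹) F Filter.atTop
        (squareQ \ H.holes) ∧
      ∀ z ∈ squareQ \ H.holes, F z = 0 ↔ b ≤ z.re := by
  set g : ℝ := (1 - |b|) / 2 with hg
  have hg0 : 0 < g := by rw [hg]; linarith
  set η : ℝ := min (1 / 8) (ε / 64) with hη
  have hη0 : 0 < η := by positivity
  have hη1 : η ≤ 1 / 8 := min_le_left _ _
  have hη2 : η ≤ ε / 64 := min_le_right _ _
  obtain ⟨μ, hμ0, hμR, hμ⟩ := exists_nat_step_scale hg0 hη0 (by linarith) (1 / g)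
  set m : ℕ → ℕ := fun k => μ * 4 ^ k with hm
  have hm0 : ∀ k, 0 < m k := fun k => by positivity
  have hmμ : ∀ k, ((m k : ℕ) : ℝ) = μ * 4 ^ k := fun k => by simp [hm]
  have hμ1 : (1 : ℝ) ≤ μ := by exact_mod_cast hμ0
  have hm1 : ∀ k, (1 : ℝ) ≤ m k := fun k => by exact_mod_cast hm0 k
  have hmR : ∀ k, 1 / g ≤ m k := fun k => by
    rw [hmμ]
    refine hμR.trans (le_mul_of_one_le_right (by positivity) (one_le_pow₀ (by norm_num)))
  set c : ℕ → ℝ := fun k => b - g * (1 / 2) ^ k with hc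
  have hcabs : ∀ k, |c k| ≤ 1 - g := fun k => by
    have h1 : (0 : ℝ) < (1 / 2) ^ k := by positivity
    have h2 : ((1 : ℝ) / 2) ^ k ≤ 1 := pow_le_one₀ (by norm_num) (by norm_num)
    have h3 := abs_sub b (g * (1 / 2) ^ k)
    rw [abs_of_pos (by positivity : 0 < g * (1 / 2) ^ k)] at h3
    simp only [hc]
    nlinarith
  -- a hole together with its double and its gap takes at most `1 / (2m)`
  have hroom : ∀ k, 2 * (η / m k ^ 4) + 1 / (4 * m k) ≤ 1 / (2 * m k) := fun k => by
    have h0 : (0 : ℝ) < m k := by linarith [hm1 k]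
    have h1 : (m k : ℝ) ≤ m k ^ 4 := le_self_pow₀ (hm1 k) (by norm_num)
    have h2 : η / (m k : ℝ) ^ 4 ≤ 1 / 8 / m k := by gcongr
    have h3 : 2 * (1 / 8 / (m k : ℝ)) + 1 / (4 * m k) = 1 / (2 * m k) := by
      field_simp; norm_num
    linarith
  let H : HoleFamily :=
    { ι := Σ k, Fin (2 * m k)
      countable := inferInstance
      center := fun p => ⟨c p.1, (2 * (p.2 : ℕ) + 1 - 2 * m p.1) / (2 * m p.1)⟩
      radius := fun p => η / m p.1 ^ 4
      gap := fun p => 1 / (4 * m p.1)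
      radius_pos := fun p => by
        have := hm1 p.1
        positivity
      gap_pos := fun p => by
        have := hm1 p.1
        positivity
      re_le := fun p => by
        have h0 := hm1 p.1
        have h1 := hcabs p.1
        have h2 := hroom p.1
        have h3 : 1 / (2 * (m p.1 : ℝ)) ≤ g := by
          rw [div_le_iff₀ (by positivity)]
          have := hmR p.1
          rw [div_le_iff₀ hg0] at this
          nlinarith
        dsimp only
        linarith
      im_le := fun p => by
        have h0 := hm1 p.1
        have h2 := hroom p.1
        have h3 : |(2 * ((p.2 : ℕ) : ℝ) + 1 - 2 * m p.1) / (2 * m p.1)| ≤ 1 - 1 / (2 * m p.1) := by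
          rw [abs_div, abs_of_pos (by positivity : (0 : ℝ) < 2 * m p.1),
            div_le_iff₀ (by positivity)]
          have h4 : (1 - 1 / (2 * (m p.1 : ℝ))) * (2 * m p.1) = 2 * m p.1 - 1 := by
            field_simp
          have h5 : ((p.2 : ℕ) : ℝ) + 1 ≤ 2 * m p.1 := by exact_mod_cast p.2.2
          have h6 : (0 : ℝ) ≤ ((p.2 : ℕ) : ℝ) := Nat.cast_nonneg _
          rw [h4, abs_le]
          exact ⟨by linarith, by linarith⟩
        dsimp only
        linarith }
  set L : ℕ → ℝ := fun k => 2 * Real.pi * m k with hL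
  have hoff : ∀ k, ∀ z ∈ squareQ \ H.holes,
      ‖(1 + Complex.exp (L k * (z - c k)))⁻¹‖ ≤ 2 * (m k : ℝ) ^ 3 / η ∧
        1 + Complex.exp (L k * (z - c k)) ≠ 0 := by
    intro k z hz
    refine le_norm_one_add_exp_of_far (hm0 k) hη0 hη1 (mem_squareQ.1 hz.1).2 fun j => ?_
    by_contra h
    refine hz.2 (Set.mem_iUnion.2 ⟨⟨k, j⟩, ?_⟩)
    rw [Metric.mem_ball, dist_eq_norm]
    exact not_le.1 h
  have hτ : ∀ k : ℕ, ((1 : ℝ) / 2) ^ k * m k = μ * 2 ^ k := fun k => by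
    rw [hmμ, mul_left_comm, ← mul_pow]; norm_num
  have hpow : ∀ k : ℕ, Real.exp (-(μ * g * 2 ^ k)) ≤ 1 / 2 := fun k => by
    have h1 := hμ k
    have h2 : ((1 : ℝ) / 4) ^ (k + 1) ≤ 1 := pow_le_one₀ (by norm_num) (by norm_num)
    have h3 : (1 : ℝ) ≤ 1 + 2 * ((μ * 4 ^ (k + 1) : ℕ) : ℝ) ^ 3 / η := by
      have : (0 : ℝ) ≤ 2 * ((μ * 4 ^ (k + 1) : ℕ) : ℝ) ^ 3 / η := by positivity
      linarith
    nlinarith [Real.exp_pos (-(μ * g * 2 ^ k))]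
  have hre : ∀ (k : ℕ) (z : ℂ), ((L k : ℂ) * (z - c k)).re = L k * (z.re - c k) := fun k z => by
    simp
  obtain ⟨F, hF, hF0⟩ := exists_limit_of_steps (S := squareQ \ H.holes)
    (h := fun k z => (1 + Complex.exp (L k * (z - c k)))⁻¹)
    (t := fun k => b - 3 / 4 * g * (1 / 2) ^ k) (E := fun k => 2 * Real.exp (-(μ * g * 2 ^ k)))
    (B := fun k => 2 * (m k : ℝ) ^ 3 / η) (b := b)
    (fun k z hz hzt => by
      refine norm_inv_one_add_exp_le (hpow k) ?_
      have h0 : (0 : ℝ) < (1 / 2) ^ k := by positivity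
      have h1 : g / 4 * (1 / 2) ^ k ≤ z.re - c k := by
        simp only [hc]
        linarith
      rw [hre]
      have h2 : μ * g * 2 ^ k = m k * (g * (1 / 2) ^ k) := by linear_combination (-g) * hτ k
      have h3 : 4 * (m k : ℝ) ≤ L k := by
        simp only [hL]
        nlinarith [Real.pi_gt_three, hm1 k]
      have h4 := hm1 k
      calc μ * g * 2 ^ k = 4 * m k * (g / 4 * (1 / 2) ^ k) := by rw [h2]; ring
        _ ≤ L k * (z.re - c k) := by gcongr)
    (fun k z hz hzt => by
      refine norm_inv_one_add_exp_sub_one_le (hpow (k + 1)) ?_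
      have h0 : (0 : ℝ) < (1 / 2) ^ k := by positivity
      have h1 : g / 2 * (1 / 2) ^ (k + 1) ≤ c (k + 1) - z.re := by
        simp only [hc]
        rw [pow_succ]
        linarith
      rw [hre]
      have h2 : μ * g * 2 ^ (k + 1) = m (k + 1) * (g * (1 / 2) ^ (k + 1)) := by
        linear_combination (-g) * hτ (k + 1)
      have h3 : 2 * (m (k + 1) : ℝ) ≤ L (k + 1) := by
        simp only [hL]
        nlinarith [Real.pi_gt_three, hm1 (k + 1)]
      have h4 := hm1 (k + 1)
      have : μ * g * 2 ^ (k + 1) ≤ L (k + 1) * (c (k + 1) - z.re) := by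
        calc μ * g * 2 ^ (k + 1) = 2 * m (k + 1) * (g / 2 * (1 / 2) ^ (k + 1)) := by rw [h2]; ring
          _ ≤ L (k + 1) * (c (k + 1) - z.re) := by gcongr
      linarith)
    (fun k z hz => (hoff k z hz).1) (fun k => by positivity) (fun k => by positivity)
    (fun k => hμ k) (fun k => by have : (0 : ℝ) < g * (1 / 2) ^ k := by positivity
                                 linarith)
    (by
      have h1 : Filter.Tendsto (fun k : ℕ => ((1 : ℝ) / 2) ^ k) Filter.atTop (nhds 0) :=
        tendsto_pow_atTop_nhds_zero_of_lt_one (by norm_num) (by norm_num)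
      simpa using (h1.const_mul (3 / 4 * g)).const_sub b)
    (fun k z hz => inv_ne_zero (hoff k z hz).2)
  refine ⟨H, ?_, L, c, F, fun z hz k => (hoff k z hz).2, hF, hF0⟩
  have hw : H.weight = ∑' p : Σ k, Fin (2 * m k),
      ENNReal.ofReal (η / m p.1 ^ 4 / (1 / (4 * m p.1)) ^ 2) := rfl
  rw [hw, ENNReal.tsum_sigma']
  have h1 : ∀ k, ∑' _ : Fin (2 * m k), ENNReal.ofReal (η / m k ^ 4 / (1 / (4 * m k)) ^ 2) ≤
      ENNReal.ofReal (32 * η * (1 / 4) ^ k) := by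
    intro k
    have h0 : (0 : ℝ) < m k := by linarith [hm1 k]
    rw [tsum_fintype, Finset.sum_const, Finset.card_univ, Fintype.card_fin, nsmul_eq_mul,
      ← ENNReal.ofReal_natCast, ← ENNReal.ofReal_mul (Nat.cast_nonneg _)]
    refine ENNReal.ofReal_le_ofReal ?_
    have e : ((2 * m k : ℕ) : ℝ) * (η / m k ^ 4 / (1 / (4 * m k)) ^ 2) = 32 * η / m k := by
      push_cast
      field_simp
      norm_num
    rw [e, one_div, inv_pow, ← div_eq_mul_inv]
    gcongr
    rw [hmμ]
    exact le_mul_of_one_le_left (by positivity) hμ1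
  refine (ENNReal.tsum_le_tsum h1).trans ?_
  have hsumm : Summable fun k : ℕ => 32 * η * ((1 : ℝ) / 4) ^ k :=
    (summable_geometric_of_lt_one (by norm_num) (by norm_num)).mul_left _
  rw [← ENNReal.ofReal_tsum_of_nonneg (fun k => by positivity) hsumm, tsum_mul_left,
    tsum_geometric_of_lt_one (by norm_num) (by norm_num)]
  refine ENNReal.ofReal_le_ofReal ?_
  norm_num
  linarith

/-! ### Uniting the families of holes -/

namespace HoleFamily

/-- The family turned by a right angle. -/
noncomputable def rotate (H : HoleFamily) : HoleFamily where
  ι := H.ι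
  countable := H.countable
  center := fun i => Complex.I * H.center i
  radius := H.radius
  gap := H.gap
  radius_pos := H.radius_pos
  gap_pos := H.gap_pos
  re_le := fun i => by simpa using H.im_le i
  im_le := fun i => by simpa using H.re_le i

lemma neg_I_mul_notMem_holes {H : HoleFamily} {z : ℂ} (hz : z ∉ H.rotate.holes) :
    -Complex.I * z ∉ H.holes := by
  intro h
  obtain ⟨i, hi⟩ := Set.mem_iUnion.1 h
  refine hz (Set.mem_iUnion.2 ⟨i, ?_⟩)
  rw [Metric.mem_ball, dist_eq_norm] at hi ⊢
  have e : z - Complex.I * H.center i = Complex.I * (-Complex.I * z - H.center i) := by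
    linear_combination z * Complex.I_sq
  change ‖z - Complex.I * H.center i‖ < H.radius i
  rwa [e, norm_mul, Complex.norm_I, one_mul]

lemma weight_iterate_rotate (H : HoleFamily) (n : ℕ) : (rotate^[n] H).weight = H.weight := by
  induction n with
  | zero => rfl
  | succ n ih =>
    rw [Function.iterate_succ_apply']
    exact ih

lemma neg_I_pow_mul_notMem_holes {H : HoleFamily} (n : ℕ) {z : ℂ} (hz : z ∉ (rotate^[n] H).holes) :
    (-Complex.I) ^ n * z ∉ H.holes := by
  induction n generalizing z with
  | zero => simpa using hz
  | succ n ih =>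
    rw [Function.iterate_succ_apply'] at hz
    rw [pow_succ, mul_assoc]
    exact ih (neg_I_mul_notMem_holes hz)

/-- The union of countably many families. -/
def sigma {κ : Type} [Countable κ] (H : κ → HoleFamily) : HoleFamily where
  ι := Σ k, (H k).ι
  countable := by
    have := fun k => (H k).countable
    infer_instance
  center := fun p => (H p.1).center p.2
  radius := fun p => (H p.1).radius p.2
  gap := fun p => (H p.1).gap p.2
  radius_pos := fun p => (H p.1).radius_pos p.2
  gap_pos := fun p => (H p.1).gap_pos p.2
  re_le := fun p => (H p.1).re_le p.2
  im_le := fun p => (H p.1).im_le p.2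

lemma weight_sigma {κ : Type} [Countable κ] (H : κ → HoleFamily) :
    (sigma H).weight = ∑' k, (H k).weight :=
  ENNReal.tsum_sigma' fun p : Σ k, (H k).ι =>
    ENNReal.ofReal ((H p.1).radius p.2 / (H p.1).gap p.2 ^ 2)

lemma holes_subset_sigma {κ : Type} [Countable κ] (H : κ → HoleFamily) (k : κ) :
    (H k).holes ⊆ (sigma H).holes := fun _ hz => by
  obtain ⟨i, hi⟩ := Set.mem_iUnion.1 hz
  exact Set.mem_iUnion.2 ⟨⟨k, i⟩, hi⟩

end HoleFamily

lemma neg_I_pow_mul_mem_squareQ (n : ℕ) {z : ℂ} (hz : z ∈ squareQ) :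
    (-Complex.I) ^ n * z ∈ squareQ := by
  induction n with
  | zero => simpa using hz
  | succ n ih =>
    rw [pow_succ', mul_assoc, mem_squareQ]
    have := mem_squareQ.1 ih
    set w := (-Complex.I) ^ n * z
    have e1 : (-Complex.I * w).re = w.im := by simp
    have e2 : (-Complex.I * w).im = -w.re := by simp
    rw [e1, e2, abs_neg]
    exact this.symm

lemma norm_neg_I_pow (n : ℕ) : ‖(-Complex.I) ^ n‖ = 1 := by
  rw [norm_pow, norm_neg, Complex.norm_I, one_pow]

lemma neg_I_pow_ne_zero (n : ℕ) : (-Complex.I) ^ n ≠ 0 :=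
  norm_ne_zero_iff.1 (by rw [norm_neg_I_pow]; exact one_ne_zero)

/-- Near a boundary point of the square one may put a pole just outside the square. -/
lemma hasLargeDerivatives_of_mem_boundary {X : Set ℂ} (hX : X ⊆ squareQ) {x : ℂ} {n : ℕ}
    (hx : ((-Complex.I) ^ n * x).re = 1) : HasLargeDerivatives X x := by
  intro N
  set u : ℂ := (-Complex.I) ^ n with hu
  have hu0 : u ≠ 0 := neg_I_pow_ne_zero n
  have hu1 : ‖u‖ = 1 := norm_neg_I_pow n
  set ρ : ℝ := 1 / (N + 1) with hρ
  have hρ0 : 0 < ρ := by positivity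
  set a : ℂ := x + ρ * u⁻¹ with ha
  have hua : (u * a).re = 1 + ρ := by
    have : u * a = u * x + ρ := by rw [ha]; field_simp
    rw [this, Complex.add_re, hx, Complex.ofReal_re]
  have hle : ∀ z ∈ X, ρ ≤ ‖z - a‖ := by
    intro z hz
    have h1 := (le_abs_self _).trans (mem_squareQ.1 (neg_I_pow_mul_mem_squareQ n (hX hz))).1
    rw [← hu] at h1
    have h2 := Complex.abs_re_le_norm (u * (a - z))
    rw [norm_mul, hu1, one_mul, norm_sub_rev, mul_sub, Complex.sub_re, hua] at h2
    linarith [le_abs_self (1 + ρ - (u * z).re)]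
  refine ⟨Unit, Finset.univ, fun _ => ρ, fun _ => a, fun _ _ h => ?_, fun z hz => ?_, ?_⟩
  · have := hle a h
    rw [sub_self, norm_zero] at this
    linarith
  · rw [Finset.univ_unique, Finset.sum_singleton, norm_div, Complex.norm_real,
      Real.norm_of_nonneg hρ0.le]
    have := (div_le_one (hρ0.trans_le (hle z hz))).2 (hle z hz)
    linarith
  · rw [Finset.univ_unique, Finset.sum_singleton]
    have e : x - a = -(ρ * u⁻¹) := by rw [ha]; ring
    rw [e, neg_sq, norm_div, norm_pow, norm_mul, norm_inv, hu1, inv_one, mul_one,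
      Complex.norm_real, Real.norm_of_nonneg hρ0.le]
    have : ρ / ρ ^ 2 = N + 1 := by
      rw [hρ]; field_simp
    rw [this]
    linarith

/-- Some limit of rational functions vanishes on `X` exactly where `b ≤ Re (u z)`. -/
def HasStripFunction (X : Set ℂ) (u : ℂ) (b : ℝ) : Prop :=
  ∃ (L c : ℕ → ℝ) (F : ℂ → ℂ),
    (∀ z ∈ X, ∀ k, 1 + Complex.exp (L k * (u * z - c k)) ≠ 0) ∧
    TendstoUniformlyOn
      (fun K z => ∏ k ∈ Finset.range K, (1 + Complex.exp (L k * (u * z - c k)))⁻¹) F Filter.atTop X ∧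
    ∀ z ∈ X, F z = 0 ↔ b ≤ (u * z).re

/-- The union of strip families for the four axis directions and all rational abscissas, and of
lattice families of all orders. -/
lemma exists_hole_family {w : ℝ} (hw : 0 < w) : ∃ H : HoleFamily,
    Nonempty H.ι ∧ H.weight ≤ ENNReal.ofReal w ∧
    (∀ (n : ℕ) (q : ℚ), n < 4 → |(q : ℝ)| < 1 →
      HasStripFunction H.carrier ((-Complex.I) ^ n) q) ∧
    ∀ x ∈ H.carrier, HasLargeDerivatives H.carrier x := by
  let κ : Type := (Fin 4 × {q : ℚ // |(q : ℝ)| < 1}) ⊕ ℕ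
  obtain ⟨ε, hε0, hε⟩ := ENNReal.exists_pos_sum_of_countable
    (ENNReal.ofReal_pos.2 hw).ne' κ
  have hstrip : ∀ p : Fin 4 × {q : ℚ // |(q : ℝ)| < 1}, ∃ H : HoleFamily,
      H.weight ≤ ENNReal.ofReal (ε (Sum.inl p)) ∧ ∀ X : Set ℂ, X ⊆ squareQ → Disjoint X H.holes →
        HasStripFunction X ((-Complex.I) ^ (p.1 : ℕ)) p.2 := by
    intro p
    obtain ⟨H, hH, L, c, F, h1, h2, h3⟩ := exists_strip_holes p.2.2
      (NNReal.coe_pos.2 (hε0 (Sum.inl p)))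
    refine ⟨HoleFamily.rotate^[p.1] H, by rwa [H.weight_iterate_rotate], fun X hX hXH => ?_⟩
    have hrot : ∀ z ∈ X, (-Complex.I) ^ (p.1 : ℕ) * z ∈ squareQ \ H.holes := fun z hz =>
      ⟨neg_I_pow_mul_mem_squareQ _ (hX hz),
        HoleFamily.neg_I_pow_mul_notMem_holes _ fun h => Set.disjoint_left.1 hXH hz h⟩
    exact ⟨L, c, fun z => F ((-Complex.I) ^ (p.1 : ℕ) * z), fun z hz => h1 _ (hrot z hz),
      (h2.comp fun z => (-Complex.I) ^ (p.1 : ℕ) * z).mono hrot, fun z hz => h3 _ (hrot z hz)⟩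
  choose Hs hHs hHs' using hstrip
  have hlat := fun n : ℕ => exists_lattice_holes n (NNReal.coe_pos.2 (hε0 (Sum.inr n)))
  choose Hl hHl0 hHl hHl' using hlat
  let G : κ → HoleFamily := Sum.elim Hs Hl
  set H := HoleFamily.sigma G with hH
  have hsub : ∀ k, (G k).holes ⊆ H.holes := HoleFamily.holes_subset_sigma G
  refine ⟨H, ⟨⟨Sum.inr 0, (hHl0 0).some⟩⟩, ?_, fun n q hn hq => ?_, fun x hx => ?_⟩
  · rw [hH, HoleFamily.weight_sigma]
    refine le_trans (ENNReal.tsum_le_tsum fun k => ?_) hε.le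
    rcases k with p | n
    · exact (hHs p).trans_eq ENNReal.ofReal_coe_nnreal
    · exact (hHl n).trans_eq ENNReal.ofReal_coe_nnreal
  · refine hHs' (⟨n, hn⟩, ⟨q, hq⟩) _ (fun z hz => hz.1) ?_
    refine Set.disjoint_left.2 fun z hz hzH => hz.2 (hsub (Sum.inl _) hzH)
  · have hXQ : (H.carrier : Set ℂ) ⊆ squareQ := fun z hz => hz.1
    have hxQ := mem_squareQ.1 (hXQ hx)
    by_cases hin : |x.re| < 1 ∧ |x.im| < 1
    · intro n
      obtain ⟨N, hN⟩ := exists_nat_gt (max (n : ℝ) (max (1 / (1 - |x.re|)) (1 / (1 - |x.im|))))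
      have h1 : (n : ℝ) ≤ N := ((le_max_left _ _).trans_lt hN).le
      have key : ∀ t : ℝ, t < 1 → 1 / (1 - t) < N → t ≤ 1 - 1 / (N + 1) := fun t ht htN => by
        have hNp : (0 : ℝ) < N + 1 := by positivity
        rw [div_lt_iff₀ (by linarith)] at htN
        have : 1 / ((N : ℝ) + 1) ≤ 1 - t := by
          rw [div_le_iff₀ hNp]
          nlinarith
        linarith
      have h2 := key _ hin.1
        (((le_max_left _ _).trans (le_max_right _ _)).trans_lt hN)
      have h3 := key _ hin.2
        (((le_max_right _ _).trans (le_max_right _ _)).trans_lt hN)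
      have hsub' : (Hl N).holes ⊆ H.holes := hsub (Sum.inr N)
      obtain ⟨κ', s, c, b, e1, e2, e3⟩ := hHl' N x h2 h3 fun h => hx.2 (hsub' h)
      exact ⟨κ', s, c, b, fun k hk h => h.2 (hsub' (e1 k hk)),
        fun z hz => e2 z fun h => hz.2 (hsub' h), h1.trans e3⟩
    · have hn : ∃ n : ℕ, ((-Complex.I) ^ n * x).re = 1 := by
        rw [not_and_or, not_lt, not_lt] at hin
        have hI := Complex.I_sq
        rcases hin with h | h
        · rcases le_abs.1 h with h | h
          · exact ⟨0, by simpa using le_antisymm ((le_abs_self _).trans hxQ.1) h⟩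
          · refine ⟨2, ?_⟩
            rw [neg_sq, hI, neg_one_mul, Complex.neg_re]
            exact le_antisymm ((neg_le_abs _).trans hxQ.1) h
        · rcases le_abs.1 h with h | h
          · exact ⟨1, by simpa using le_antisymm ((le_abs_self _).trans hxQ.2) h⟩
          · refine ⟨3, ?_⟩
            have e : (-Complex.I) ^ 3 = Complex.I := by linear_combination (-Complex.I) * hI
            rw [e, Complex.I_mul_re]
            exact le_antisymm ((neg_le_abs _).trans hxQ.2) h
      obtain ⟨n, hn⟩ := hn
      exact hasLargeDerivatives_of_mem_boundary hXQ hn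

/-! ### The algebra `R(X)` -/

variable {X : Compacts ℂ}

lemma ratAlgebra_le_ratClosure : ratAlgebra X ≤ ratClosure X :=
  Subalgebra.le_topologicalClosure _

lemma isClosed_ratClosure : IsClosed (ratClosure X : Set C(X, ℂ)) :=
  Subalgebra.isClosed_topologicalClosure _

/-- The restriction of a rational function without poles on `X`, as a continuous function. -/
noncomputable def IsRationalOff.toContinuousMap {F : ℂ → ℂ} (hF : IsRationalOff X F) : C(X, ℂ) :=
  ⟨fun z => F z, continuousOn_iff_continuous_domRestrict.1 hF.continuousOn⟩

lemma IsRationalOff.toContinuousMap_mem {F : ℂ → ℂ} (hF : IsRationalOff X F) :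
    hF.toContinuousMap ∈ ratAlgebra X :=
  ⟨F, hF, fun _ => rfl⟩

lemma isRationalOff_id (S : Set ℂ) : IsRationalOff S fun z => z :=
  ⟨Polynomial.X, 1, by simp, by simp⟩

lemma isRationalOff_inv_sub {S : Set ℂ} {b : ℂ} (hb : b ∉ S) :
    IsRationalOff S fun z => (z - b)⁻¹ :=
  ⟨1, Polynomial.X - Polynomial.C b,
    fun z hz => by simpa [sub_eq_zero] using ne_of_mem_of_not_mem hz hb, by simp⟩

/-- The coordinate function `z`, as an element of `R(X)`. -/
noncomputable def coordinate (X : Compacts ℂ) : ratClosure X :=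
  ⟨_, ratAlgebra_le_ratClosure (isRationalOff_id X).toContinuousMap_mem⟩

/-- Evaluation at a point of `X`. -/
noncomputable def evalAt (z : X) : ratClosure X →ₐ[ℂ] ℂ :=
  ((Pi.evalAlgHom ℂ (fun _ : X => ℂ) z).comp (ContinuousMap.coeFnAlgHom ℂ)).comp (ratClosure X).val

lemma continuous_evalAt (z : X) : Continuous (evalAt z) :=
  (continuous_eval_const (F := C(X, ℂ)) z).comp continuous_subtype_val

lemma evalAt_coordinate (z : X) : evalAt z (coordinate X) = z := rfl

lemma evalAt_algebraMap (z : X) (c : ℂ) : evalAt z (algebraMap ℂ _ c) = c :=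
  (evalAt z).commutes c

lemma evalAt_smul (z : X) (c : ℂ) (f : ratClosure X) : evalAt z (c • f) = c * evalAt z f := rfl

lemma evalAt_add (z : X) (f g : ratClosure X) : evalAt z (f + g) = evalAt z f + evalAt z g := rfl

lemma evalAt_coordinate_sub (z : X) (c : ℂ) :
    evalAt z (coordinate X - algebraMap ℂ _ c) = z - c := by
  rw [map_sub, evalAt_algebraMap, evalAt_coordinate]

lemma isUniformAlgebra_ratClosure : IsUniformAlgebra (ratClosure X) :=
  ⟨isClosed_ratClosure, fun _ _ hxy =>
    ⟨_, ⟨_, (coordinate X).2, rfl⟩, fun h => hxy (Subtype.ext h)⟩⟩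

lemma ratAlgebra_inverse_mem {f : C(X, ℂ)} (hf : f ∈ ratAlgebra X) :
    Ring.inverse f ∈ ratAlgebra X := by
  by_cases hu : IsUnit f
  · obtain ⟨F, ⟨p, q, hq, hF⟩, hfF⟩ := hf
    have h0 : ∀ z : X, f z ≠ 0 := (ContinuousMap.isUnit_iff_forall_ne_zero f).1 hu
    refine ⟨fun z => q.eval z / p.eval z, ⟨q, p, fun z hz hp => h0 ⟨z, hz⟩ ?_, fun _ => rfl⟩,
      fun z => ?_⟩
    · rw [hfF, hF, hp, zero_div]
    · have := congrArg (fun g : C(X, ℂ) => g z) (Ring.mul_inverse_cancel f hu)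
      change f z * (Ring.inverse f) z = 1 at this
      rw [eq_inv_of_mul_eq_one_right this, hfF, hF, inv_div]
  · rw [Ring.inverse_non_unit f hu]
    exact zero_mem _

/-- `Ring.inverse` maps `R₀(X)` to itself, and it is continuous at `f`. -/
lemma ratClosure_inverse_mem {f : C(X, ℂ)} (hf : f ∈ ratClosure X) (hu : IsUnit f) :
    Ring.inverse f ∈ ratClosure X := by
  have hc : ContinuousAt Ring.inverse f := by
    obtain ⟨u, rfl⟩ := hu
    exact NormedRing.inverse_continuousAt u
  have hf' : f ∈ closure (ratAlgebra X : Set C(X, ℂ)) := hf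
  have := hc.continuousWithinAt.mem_closure_image (s := (ratAlgebra X : Set C(X, ℂ))) hf'
  exact closure_mono (Set.image_subset_iff.2 fun g hg => ratAlgebra_inverse_mem hg) this

lemma ratClosure_isUnit {f : ratClosure X} (hf : ∀ z : X, evalAt z f ≠ 0) :
    ∃ g : ratClosure X, f * g = 1 := by
  have hu := (ContinuousMap.isUnit_iff_forall_ne_zero (f : C(X, ℂ))).2 hf
  exact ⟨⟨_, ratClosure_inverse_mem f.2 hu⟩, Subtype.ext (Ring.mul_inverse_cancel _ hu)⟩

lemma eq_inv_of_algHom {A : Type*} [CommRing A] [Algebra ℂ A] (φ : A →ₐ[ℂ] ℂ) {f g : A}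
    (h : f * g = 1) : φ g = (φ f)⁻¹ :=
  eq_inv_of_mul_eq_one_right (by rw [← map_mul, h, map_one])

lemma ratClosure_exists_exp (f : ratClosure X) :
    ∃ g : ratClosure X, ∀ z, evalAt z g = Complex.exp (evalAt z f) := by
  refine ⟨⟨NormedSpace.exp (f : C(X, ℂ)), NormedSpace.exp_mem (R := ℂ) isClosed_ratClosure f.2⟩,
    fun z => ?_⟩
  rw [Complex.exp_eq_exp_ℂ]
  exact NormedSpace.map_exp
    ((Pi.evalRingHom (fun _ : X => ℂ) z).comp ContinuousMap.coeFnRingHom)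
    (continuous_eval_const (F := C(X, ℂ)) z) (f : C(X, ℂ))

lemma denseRange_inclusion :
    DenseRange (Subalgebra.inclusion (ratAlgebra_le_ratClosure (X := X))) := fun f => by
  rw [closure_subtype, ← Set.range_comp]
  have : f.1 ∈ closure (ratAlgebra X : Set C(X, ℂ)) := f.2
  convert this
  ext g
  exact ⟨fun ⟨h, e⟩ => e ▸ h.2, fun h => ⟨⟨g, h⟩, rfl⟩⟩

/-- `R(X)` is generated, as a closed subalgebra stable under inverses, by the coordinate
function. -/
lemma ratClosure_eq_top {S : Subalgebra ℂ (ratClosure X)} (hS : IsClosed (S : Set (ratClosure X)))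
    (hz : coordinate X ∈ S) (hinv : ∀ f g, f ∈ S → f * g = 1 → g ∈ S) (f : ratClosure X) :
    f ∈ S := by
  refine denseRange_inclusion.induction_on f hS fun h => ?_
  obtain ⟨h, F, ⟨p, q, hq, hF⟩, hh⟩ := h
  have hpoly : ∀ r : Polynomial ℂ, Polynomial.aeval (coordinate X) r ∈ S := fun r =>
    Polynomial.aeval_mem_adjoin_singleton ℂ (coordinate X) |> fun h =>
      (Algebra.adjoin_le (Set.singleton_subset_iff.2 hz)) h
  have heval : ∀ (r : Polynomial ℂ) (z : X),
      evalAt z (Polynomial.aeval (coordinate X) r) = r.eval (z : ℂ) := fun r z => by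
    rw [← Polynomial.aeval_algHom_apply, evalAt_coordinate, Polynomial.coe_aeval_eq_eval]
  obtain ⟨g, hg⟩ := ratClosure_isUnit (f := Polynomial.aeval (coordinate X) q) fun z => by
    rw [heval]
    exact hq z z.2
  have e : Subalgebra.inclusion ratAlgebra_le_ratClosure ⟨h, F, ⟨p, q, hq, hF⟩, hh⟩ =
      Polynomial.aeval (coordinate X) p * g := by
    refine Subtype.ext (ContinuousMap.ext fun z => ?_)
    change h z = evalAt z (Polynomial.aeval (coordinate X) p * g)
    rw [map_mul, eq_inv_of_algHom _ hg, heval, heval, hh, hF, div_eq_mul_inv]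
  rw [e]
  exact S.mul_mem (hpoly p) (hinv _ _ (hpoly q) hg)

/-- The character space of `R(X)` is `X`. -/
lemma character_eq_eval (φ : WeakDual.characterSpace ℂ (ratClosure X)) :
    ∃ x : X, ∀ f : ratClosure X, φ f = evalAt x f := by
  have hx : φ (coordinate X) ∈ X := by
    by_contra h
    obtain ⟨g, hg⟩ := ratClosure_isUnit
      (f := coordinate X - algebraMap ℂ _ (φ (coordinate X))) fun z hz => by
        rw [evalAt_coordinate_sub] at hz
        exact h (by rw [← sub_eq_zero.1 hz]; exact z.2)
    have := congrArg φ hg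
    rw [map_mul, map_sub, AlgHomClass.commutes, map_one] at this
    simp at this
  refine ⟨⟨_, hx⟩, fun f => ?_⟩
  refine ratClosure_eq_top
    (S := AlgHom.equalizer (WeakDual.CharacterSpace.toAlgHom φ) (evalAt ⟨_, hx⟩))
    (isClosed_eq (map_continuous φ) (continuous_evalAt _)) rfl (fun f g hf hfg => ?_) f
  change WeakDual.CharacterSpace.toAlgHom φ f = _ at hf
  change WeakDual.CharacterSpace.toAlgHom φ g = _
  rw [eq_inv_of_algHom _ hfg, eq_inv_of_algHom _ hfg, hf]

/-! ### Point derivations -/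

/-- A bounded point derivation at `x` maps `1 / (z - b)` to `-(x - b)⁻²` times its value at the
coordinate function `z`, which is therefore zero if bounded functions have large derivatives at
`x`. -/
lemma boundedPointDerivation_eq_zero (hX : ∀ x ∈ X, HasLargeDerivatives X x)
    (φ : WeakDual.characterSpace ℂ (ratClosure X)) (d : ratClosure X →L[ℂ] ℂ)
    (hd : IsBoundedPointDerivation φ d) : d = 0 := by
  obtain ⟨x, hφ⟩ := character_eq_eval φ
  have h1 : d 1 = 0 := by
    have := hd 1 1
    rw [mul_one, map_one φ, one_mul] at this
    linear_combination -this
  have hinv : ∀ f g, f * g = 1 → d g = -(φ g) ^ 2 * d f := fun f g hfg => by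
    have h2 := hd f g
    have h3 := congrArg φ hfg
    rw [map_mul, map_one] at h3
    rw [hfg, h1] at h2
    linear_combination (-φ g) * h2 - d g * h3
  have hz : d (coordinate X) = 0 := by
    by_contra h0
    have h0' := norm_pos_iff.2 h0
    obtain ⟨n, hn⟩ := exists_nat_gt (2 * ‖d‖ / ‖d (coordinate X)‖)
    obtain ⟨κ, s, c, b, hb, hle, hge⟩ := hX x x.2 n
    let f : κ → ratClosure X := fun k =>
      coordinate X - algebraMap ℂ (ratClosure X) (b k)
    have hf : ∀ k ∈ s, ∃ g, f k * g = 1 := fun k hk => ratClosure_isUnit fun z hz => by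
      rw [evalAt_coordinate_sub] at hz
      exact hb k hk (by rw [← sub_eq_zero.1 hz]; exact z.2)
    choose! g hg using hf
    have hφg : ∀ k ∈ s, φ (g k) = (x - b k)⁻¹ := fun k hk => by
      rw [hφ, eq_inv_of_algHom _ (hg k hk), evalAt_coordinate_sub]
    have hdf : ∀ k, d (f k) = d (coordinate X) := fun k => by
      rw [map_sub, Algebra.algebraMap_eq_smul_one, map_smul, h1, smul_zero, sub_zero]
    have hdG : d (∑ k ∈ s, c k • g k) = -(∑ k ∈ s, c k / (x - b k) ^ 2) * d (coordinate X) := by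
      rw [map_sum, ← Finset.sum_neg_distrib, Finset.sum_mul]
      refine Finset.sum_congr rfl fun k hk => ?_
      rw [map_smul, hinv _ _ (hg k hk), hφg k hk, hdf, smul_eq_mul, div_eq_mul_inv, inv_pow]
      ring
    have hG : ‖∑ k ∈ s, c k • g k‖ ≤ 2 := by
      refine (ContinuousMap.norm_le _ zero_le_two).2 fun z => ?_
      refine le_of_eq_of_le (congrArg _ ?_) (hle z z.2)
      change evalAt z (∑ k ∈ s, c k • g k) = _
      rw [map_sum]
      refine Finset.sum_congr rfl fun k hk => ?_
      rw [evalAt_smul, eq_inv_of_algHom _ (hg k hk), evalAt_coordinate_sub, div_eq_mul_inv]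
    have h4 := (d.le_opNorm _).trans (mul_le_mul_of_nonneg_left hG (norm_nonneg d))
    rw [hdG, norm_mul, norm_neg] at h4
    rw [div_lt_iff₀ h0'] at hn
    nlinarith
  refine ContinuousLinearMap.ext fun f => ?_
  let S : Subalgebra ℂ (ratClosure X) :=
    { carrier := {f | d f = 0}
      mul_mem' := fun {f g} hf hg => by
        change d (f * g) = 0
        rw [hd, hf, hg, mul_zero, mul_zero, add_zero]
      add_mem' := fun {f g} hf hg => by
        change d (f + g) = 0
        rw [map_add, hf, hg, add_zero]
      algebraMap_mem' := fun r => by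
        change d (algebraMap ℂ _ r) = 0
        rw [Algebra.algebraMap_eq_smul_one, map_smul, h1, smul_zero] }
  refine ratClosure_eq_top (S := S) (isClosed_eq d.continuous continuous_const) hz
    (fun f g hf hfg => ?_) f
  change d g = 0
  rw [hinv f g hfg, show d f = 0 from hf, mul_zero]

/-! ### Regularity -/

lemma HasStripFunction.exists_mem_ratClosure {u : ℂ} {b : ℝ} (h : HasStripFunction X u b) :
    ∃ f : ratClosure X, ∀ z : X, evalAt z f = 0 ↔ b ≤ (u * z).re := by
  obtain ⟨L, c, F, hne, hlim, hF⟩ := h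
  have hstep : ∀ k, ∃ g : ratClosure X, ∀ z : X,
      evalAt z g = (1 + Complex.exp (L k * (u * z - c k)))⁻¹ := fun k => by
    obtain ⟨e, he⟩ := ratClosure_exists_exp
      ((L k : ℂ) • (u • coordinate X - algebraMap ℂ (ratClosure X) (c k)))
    have h1 : ∀ z : X, evalAt z (1 + e) = 1 + Complex.exp (L k * (u * z - c k)) := fun z => by
      rw [evalAt_add, map_one, he, evalAt_smul, map_sub, evalAt_smul, evalAt_algebraMap,
        evalAt_coordinate]
    obtain ⟨g, hg⟩ := ratClosure_isUnit (f := 1 + e) fun z => by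
      rw [h1]
      exact hne z z.2 k
    exact ⟨g, fun z => by rw [eq_inv_of_algHom _ hg, h1]⟩
  choose g hg using hstep
  have hprod : ∀ K (z : X), evalAt z (∏ k ∈ Finset.range K, g k) =
      ∏ k ∈ Finset.range K, (1 + Complex.exp (L k * (u * z - c k)))⁻¹ := fun K z => by
    rw [map_prod]
    exact Finset.prod_congr rfl fun k _ => hg k z
  have hlim' : TendstoUniformly (fun K (z : X) => evalAt z (∏ k ∈ Finset.range K, g k))
      (fun z : X => F z) Filter.atTop := by
    simp only [hprod]
    exact tendstoUniformlyOn_iff_tendstoUniformly_comp_coe.1 hlim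
  have hcont : Continuous fun z : X => F z :=
    hlim'.continuous (Filter.Eventually.frequently (Filter.Eventually.of_forall fun K =>
      (∏ k ∈ Finset.range K, g k : ratClosure X).1.continuous))
  exact ⟨⟨⟨_, hcont⟩, isClosed_ratClosure.mem_of_tendsto
    (ContinuousMap.tendsto_iff_tendstoUniformly.2 hlim')
    (Filter.Eventually.of_forall fun K => (∏ k ∈ Finset.range K, g k : ratClosure X).2)⟩,
    fun z => hF z z.2⟩

/-- Strip functions in the four axis directions cut a neighbourhood of any point of `X` out of
the square. -/
lemma isRegularOnCharacters_ratClosure (hXQ : (X : Set ℂ) ⊆ squareQ)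
    (hX : ∀ (n : ℕ) (q : ℚ), n < 4 → |(q : ℝ)| < 1 → HasStripFunction X ((-Complex.I) ^ n) q) :
    IsRegularOnCharacters (ratClosure X) := by
  intro φ K hK hφ
  obtain ⟨x, hx⟩ := character_eq_eval φ
  have hcont : Continuous fun ψ : WeakDual.characterSpace ℂ (ratClosure X) =>
      ψ (coordinate X) :=
    (WeakDual.eval_continuous (coordinate X)).comp continuous_subtype_val
  have hxK : (x : ℂ) ∉ (fun ψ : WeakDual.characterSpace ℂ (ratClosure X) =>
      ψ (coordinate X)) '' K := by
    rintro ⟨ψ, hψ, hψx⟩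
    obtain ⟨y, hy⟩ := character_eq_eval ψ
    have hyx : y = x := Subtype.ext ((hy (coordinate X)).symm.trans hψx)
    exact hφ (by rwa [show φ = ψ from WeakDual.CharacterSpace.ext fun f => by rw [hx, hy, hyx]])
  obtain ⟨ε, hε, hball⟩ := Metric.isOpen_iff.1 (hK.image hcont).isClosed.isOpen_compl x hxK
  -- a function of `R(X)` for each direction, non-zero at `x`
  have hdir : ∀ n < 4, ∃ f : ratClosure X, evalAt x f ≠ 0 ∧
      ∀ y : X, ((-Complex.I) ^ n * x).re + ε / 2 ≤ ((-Complex.I) ^ n * y).re → evalAt y f = 0 := by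
    intro n hn
    have hQ : ∀ y : X, |((-Complex.I) ^ n * y).re| ≤ 1 := fun y =>
      (mem_squareQ.1 (neg_I_pow_mul_mem_squareQ n (hXQ y.2))).1
    by_cases h1 : ((-Complex.I) ^ n * x).re < 1
    · obtain ⟨q, hq1, hq2⟩ := exists_rat_btwn
        (lt_min h1 (lt_add_of_pos_right ((-Complex.I) ^ n * (x : ℂ)).re (half_pos hε)))
      obtain ⟨f, hf⟩ := (hX n q hn (abs_lt.2 ⟨(abs_le.1 (hQ x)).1.trans_lt hq1,
        hq2.trans_le (min_le_left _ _)⟩)).exists_mem_ratClosure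
      exact ⟨f, fun h => ((hf x).1 h).not_gt hq1,
        fun y hy => (hf y).2 ((hq2.trans_le (min_le_right _ _)).le.trans hy)⟩
    -- otherwise no point of the square lies further in this direction
    · exact ⟨1, by simp, fun y hy => by linarith [(abs_le.1 (hQ y)).2]⟩
  choose! f hf0 hf using hdir
  set p : ratClosure X := ∏ n ∈ Finset.range 4, f n with hp
  have hp0 : evalAt x p ≠ 0 := by
    rw [hp, map_prod]
    exact Finset.prod_ne_zero_iff.2 fun n hn => hf0 n (Finset.mem_range.1 hn)
  refine ⟨(evalAt x p)⁻¹ • p, ?_, fun ψ hψ => ?_⟩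
  · rw [hx, evalAt_smul, inv_mul_cancel₀ hp0]
  · obtain ⟨y, hy⟩ := character_eq_eval ψ
    have hyx : ε ≤ ‖(y : ℂ) - x‖ := by
      by_contra! h
      exact hball (mem_ball_iff_norm.2 h) ⟨ψ, hψ, hy _⟩
    have hn : ∃ n < 4, ((-Complex.I) ^ n * x).re + ε / 2 ≤ ((-Complex.I) ^ n * y).re := by
      by_contra! h
      have h0 := h 0 (by norm_num)
      have h1 := h 1 (by norm_num)
      have h2 := h 2 (by norm_num)
      have h3 := h 3 (by norm_num)
      have e3 : (-Complex.I) ^ 3 = Complex.I := by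
        rw [pow_succ, neg_sq, Complex.I_sq]
        ring
      rw [neg_sq, Complex.I_sq] at h2
      rw [e3] at h3
      simp at h0 h1 h2 h3
      have h4 := Complex.norm_le_abs_re_add_abs_im ((y : ℂ) - x)
      have h5 : |((y : ℂ) - x).re| < ε / 2 := by
        rw [Complex.sub_re, abs_lt]
        constructor <;> linarith
      have h6 : |((y : ℂ) - x).im| < ε / 2 := by
        rw [Complex.sub_im, abs_lt]
        constructor <;> linarith
      linarith
    obtain ⟨n, hn4, hn⟩ := hn
    have hpy : evalAt y p = 0 := by
      rw [hp, map_prod]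
      exact Finset.prod_eq_zero (Finset.mem_range.2 hn4) (hf n hn4 y hn)
    rw [hy, evalAt_smul, hpy, mul_zero]

/-! ### The derivation defined by the bilinear form -/

lemma IsRationalOff.mul {S : Set ℂ} {F G : ℂ → ℂ} (hF : IsRationalOff S F)
    (hG : IsRationalOff S G) : IsRationalOff S fun z => F z * G z := by
  obtain ⟨p, q, hq, hF⟩ := hF
  obtain ⟨r, s, hs, hG⟩ := hG
  exact ⟨p * r, q * s, fun z hz => by simpa using ⟨hq z hz, hs z hz⟩, fun z => by
    simp [hF, hG, div_mul_div_comm]⟩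

lemma IsRationalOff.analyticAt {S : Set ℂ} {F : ℂ → ℂ} (hF : IsRationalOff S F) {z : ℂ}
    (hz : z ∈ S) : AnalyticAt ℂ F z := by
  obtain ⟨p, q, hq, hF⟩ := hF
  rw [funext hF]
  exact analyticAt_eval_div_eval (hq z hz)

lemma IsRationalOff.continuousOn_deriv_mul {S : Set ℂ} {F G : ℂ → ℂ} (hF : IsRationalOff S F)
    (hG : IsRationalOff S G) : ContinuousOn (fun z => deriv F z * G z) S := fun _ hz =>
  ((hF.analyticAt hz).deriv.continuousAt.mul (hG.analyticAt hz).continuousAt).continuousWithinAt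

/-- The form `∫ F' G` depends only on the values of `F` on `X`, in a linear way: by the estimate
it vanishes if `F` vanishes on `X`. -/
lemma integral_deriv_mul_linear {C : ℝ} (hfr : frontier squareQ ⊆ (X : Set ℂ))
    (hE : ∀ f g : ℂ → ℂ, IsRationalOff X f → IsRationalOff X g →
      ‖integralBoundaryQ (fun z => deriv f z * g z)‖ ≤ C * supNormOn X f * supNormOn X g)
    {F F₁ F₂ G : ℂ → ℂ} (hF : IsRationalOff X F) (hF₁ : IsRationalOff X F₁)
    (hF₂ : IsRationalOff X F₂) (hG : IsRationalOff X G) {c : ℂ}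
    (h : ∀ z ∈ X, F z = F₁ z + c * F₂ z) :
    integralBoundaryQ (fun z => deriv F z * G z) =
      integralBoundaryQ (fun z => deriv F₁ z * G z) +
        c * integralBoundaryQ (fun z => deriv F₂ z * G z) := by
  obtain ⟨p, q, hq, e⟩ := id hF
  obtain ⟨p₁, q₁, hq₁, e₁⟩ := id hF₁
  obtain ⟨p₂, q₂, hq₂, e₂⟩ := id hF₂
  set N : Polynomial ℂ := (p * q₁ * q₂ - q * (p₁ * q₂ + Polynomial.C c * p₂ * q₁)) with hN
  set D : ℂ → ℂ := fun z => N.eval z / (q * q₁ * q₂).eval z with hD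
  have hDr : IsRationalOff X D :=
    ⟨N, q * q₁ * q₂, fun z hz => by simpa using ⟨⟨hq z hz, hq₁ z hz⟩, hq₂ z hz⟩, fun _ => rfl⟩
  have hDeq : ∀ z, q.eval z ≠ 0 → q₁.eval z ≠ 0 → q₂.eval z ≠ 0 →
      F z = D z + (F₁ z + c * F₂ z) := fun z h0 h1 h2 => by
    simp only [hD, hN, e, e₁, e₂, Polynomial.eval_sub, Polynomial.eval_mul, Polynomial.eval_add,
      Polynomial.eval_C]
    field_simp
    ring
  have hD0 : supNormOn X D = 0 := by
    refine le_antisymm (Real.sSup_le ?_ le_rfl) (supNormOn_nonneg _ _)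
    rintro _ ⟨z, hz, rfl⟩
    have h1 := hDeq z (hq z hz) (hq₁ z hz) (hq₂ z hz)
    rw [h z hz, right_eq_add] at h1
    exact (norm_eq_zero.2 h1).le
  have hDI : integralBoundaryQ (fun z => deriv D z * G z) = 0 := by
    have h1 := hE D G hDr hG
    rw [hD0, mul_zero, zero_mul] at h1
    exact norm_le_zero_iff.1 h1
  have hder : ∀ z ∈ frontier squareQ, deriv F z * G z =
      deriv D z * G z + (deriv F₁ z * G z + c * (deriv F₂ z * G z)) := fun z hz => by
    have hzX := hfr hz
    have hev : F =ᶠ[nhds z] fun z => D z + (F₁ z + c * F₂ z) := by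
      filter_upwards [q.continuous.continuousAt.eventually_ne (hq z hzX),
        q₁.continuous.continuousAt.eventually_ne (hq₁ z hzX),
        q₂.continuous.continuousAt.eventually_ne (hq₂ z hzX)] with w
      exact hDeq w
    have d0 := (hDr.analyticAt hzX).differentiableAt
    have d1 := (hF₁.analyticAt hzX).differentiableAt
    have d2 := (hF₂.analyticAt hzX).differentiableAt
    rw [hev.deriv_eq, deriv_fun_add d0 (d1.fun_add (d2.const_mul c)),
      deriv_fun_add d1 (d2.const_mul c), deriv_const_mul _ d2]
    ring
  rw [integralBoundaryQ_congr hder, integralBoundaryQ_add, integralBoundaryQ_add, hDI, zero_add,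
    integralBoundaryQ_const_mul]
  · exact (hF₁.continuousOn_deriv_mul hG).mono hfr
  · exact ((hF₂.continuousOn_deriv_mul hG).mono hfr).const_mul c
  · exact (hDr.continuousOn_deriv_mul hG).mono hfr
  · exact ((hF₁.continuousOn_deriv_mul hG).mono hfr).add
      (((hF₂.continuousOn_deriv_mul hG).mono hfr).const_mul c)

/-- The form `∫ F' G` as a continuous bilinear form on `R₀(X)`. -/
lemma exists_form_ratAlgebra {C : ℝ} (hC : 0 ≤ C) (hfr : frontier squareQ ⊆ (X : Set ℂ))
    (hE : ∀ f g : ℂ → ℂ, IsRationalOff X f → IsRationalOff X g →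
      ‖integralBoundaryQ (fun z => deriv f z * g z)‖ ≤ C * supNormOn X f * supNormOn X g) :
    ∃ B : ratAlgebra X →L[ℂ] ratAlgebra X →L[ℂ] ℂ, ∀ (f g : ratAlgebra X) (F G : ℂ → ℂ),
      IsRationalOff X F → IsRationalOff X G → (∀ z : X, (f : C(X, ℂ)) z = F z) →
      (∀ z : X, (g : C(X, ℂ)) z = G z) → B f g = integralBoundaryQ (fun z => deriv F z * G z) := by
  have hrep : ∀ f : ratAlgebra X, ∃ F : ℂ → ℂ, IsRationalOff X F ∧ ∀ z : X, (f : C(X, ℂ)) z = F z :=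
    fun f => f.2
  choose R hR hR' using hrep
  have hRX : ∀ (f : ratAlgebra X) (z : ℂ) (hz : z ∈ X), R f z = (f : C(X, ℂ)) ⟨z, hz⟩ :=
    fun f z hz => (hR' f ⟨z, hz⟩).symm
  have hlin := fun {F F₁ F₂ G : ℂ → ℂ} hF hF₁ hF₂ hG {c : ℂ} =>
    integral_deriv_mul_linear hfr hE (F := F) (F₁ := F₁) (F₂ := F₂) (G := G) (c := c) hF hF₁ hF₂ hG
  have hcont : ∀ f g : ratAlgebra X,
      ContinuousOn (fun z => deriv (R f) z * R g z) (frontier squareQ) := fun f g =>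
    ((hR f).continuousOn_deriv_mul (hR g)).mono hfr
  let B₀ : ratAlgebra X →ₗ[ℂ] ratAlgebra X →ₗ[ℂ] ℂ := LinearMap.mk₂ ℂ
    (fun f g => integralBoundaryQ (fun z => deriv (R f) z * R g z))
    (fun f₁ f₂ g => by
      rw [hlin (hR (f₁ + f₂)) (hR f₁) (hR f₂) (hR g) (c := 1), one_mul]
      intro z hz
      rw [hRX _ z hz, hRX _ z hz, hRX _ z hz, one_mul]
      rfl)
    (fun c f g => by
      rw [hlin (hR (c • f)) (hR 0) (hR f) (hR g) (c := c),
        hlin (hR 0) (hR 0) (hR 0) (hR g) (c := -1), neg_one_mul, add_neg_cancel, zero_add,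
        smul_eq_mul]
      · intro z hz
        rw [hRX _ z hz]
        change (0 : ℂ) = 0 + -1 * 0
        ring
      · intro z hz
        rw [hRX _ z hz, hRX _ z hz, hRX _ z hz]
        exact (zero_add _).symm)
    (fun f g₁ g₂ => by
      rw [← integralBoundaryQ_add (hcont f g₁) (hcont f g₂)]
      refine integralBoundaryQ_congr fun z hz => ?_
      rw [hRX _ z (hfr hz), hRX g₁ z (hfr hz), hRX g₂ z (hfr hz), ← mul_add]
      rfl)
    (fun c f g => by
      rw [smul_eq_mul, ← integralBoundaryQ_const_mul]
      refine integralBoundaryQ_congr fun z hz => ?_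
      rw [hRX _ z (hfr hz), hRX g z (hfr hz), mul_left_comm]
      rfl)
  have hsup : ∀ f : ratAlgebra X, supNormOn X (R f) ≤ ‖f‖ := fun f => by
    refine Real.sSup_le ?_ (norm_nonneg _)
    rintro _ ⟨z, hz, rfl⟩
    change ‖R f z‖ ≤ ‖(f : C(X, ℂ))‖
    rw [hRX f z hz]
    exact ContinuousMap.norm_coe_le_norm _ _
  refine ⟨B₀.mkContinuous₂ C fun f g => (hE _ _ (hR f) (hR g)).trans ?_,
    fun f g F G hF hG hf hg => ?_⟩
  · exact mul_le_mul (mul_le_mul_of_nonneg_left (hsup f) hC) (hsup g) (supNormOn_nonneg _ _)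
      (mul_nonneg hC (norm_nonneg _))
  · change integralBoundaryQ (fun z => deriv (R f) z * R g z) = _
    rw [hlin (hR f) hF hF (hR g) (c := 0), zero_mul, add_zero]
    · refine integralBoundaryQ_congr fun z hz => ?_
      rw [hRX g z (hfr hz), hg]
    · intro z hz
      rw [hRX f z hz, hf, zero_mul, add_zero]

lemma exists_extend_bilinear {E E' : Type*} [NormedAddCommGroup E] [NormedSpace ℂ E]
    [NormedAddCommGroup E'] [NormedSpace ℂ E'] (e : E →L[ℂ] E') (he : DenseRange e)
    (hi : IsUniformInducing e) (B : E →L[ℂ] E →L[ℂ] ℂ) :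
    ∃ B' : E' →L[ℂ] E' →L[ℂ] ℂ, ∀ f g, B' (e f) (e g) = B f g :=
  ⟨((B.extend e).flip.extend e).flip, fun f g => by
    rw [ContinuousLinearMap.flip_apply, ContinuousLinearMap.extend_eq _ he hi,
      ContinuousLinearMap.flip_apply, ContinuousLinearMap.extend_eq _ he hi]⟩

/-- A non-zero bounded bilinear form `B` with `B (f g, h) = B (g, f h) + B (f, g h)` is a derivation
into the dual of the algebra. -/
lemma not_isWeaklyAmenable_of_form {A : Type} [NormedCommRing A] [NormedAlgebra ℂ A]
    (B : A →L[ℂ] A →L[ℂ] ℂ) (hB : B ≠ 0)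
    (h : ∀ a b x : A, B (a * b) x = B b (a * x) + B a (b * x)) : ¬ IsWeaklyAmenable A := fun hW => by
  let act : A →L[ℂ] (A →L[ℂ] ℂ) →L[ℂ] (A →L[ℂ] ℂ) :=
    ((ContinuousLinearMap.compL ℂ A A ℂ).flip).comp (ContinuousLinearMap.mul ℂ A)
  have hact : ∀ (a : A) (φ : A →L[ℂ] ℂ) (x : A), act a φ x = φ (a * x) := fun _ _ _ => rfl
  refine hB (hW (A →L[ℂ] ℂ) act (fun a b φ => ContinuousLinearMap.ext fun x => ?_) B
    fun a b => ContinuousLinearMap.ext fun x => ?_)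
  · rw [hact, hact, hact, mul_comm a b, mul_assoc]
  · rw [add_apply, hact, hact]
    exact h a b x

/-- If the form `∫ F' G` is bounded, then it extends to `R(X)` and defines a derivation into the
dual of `R(X)`. This derivation is not zero: if `a` lies in a hole, then `∫ z' (z - a)⁻¹` is
`2πi`. -/
lemma not_isWeaklyAmenable_ratClosure {C : ℝ} (hC : 0 ≤ C) (hfr : frontier squareQ ⊆ (X : Set ℂ))
    (hE : ∀ f g : ℂ → ℂ, IsRationalOff X f → IsRationalOff X g →
      ‖integralBoundaryQ (fun z => deriv f z * g z)‖ ≤ C * supNormOn X f * supNormOn X g)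
    {a : ℂ} (haQ : |a.re| < 1 ∧ |a.im| < 1) (haX : a ∉ X) :
    ¬ IsWeaklyAmenable (ratClosure X) := by
  obtain ⟨B₀, hB₀⟩ := exists_form_ratAlgebra hC hfr hE
  let e : ratAlgebra X →L[ℂ] ratClosure X :=
    ⟨(Subalgebra.inclusion (ratAlgebra_le_ratClosure (X := X))).toLinearMap,
      continuous_inclusion (ratAlgebra_le_ratClosure (X := X))⟩
  have hi : IsUniformInducing e :=
    AddMonoidHomClass.isometry_of_norm e (fun _ => rfl) |>.isUniformInducing
  have he : DenseRange e := denseRange_inclusion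
  obtain ⟨B, hB⟩ := exists_extend_bilinear e he hi B₀
  have hder : ∀ f g h : ratClosure X, B (f * g) h = B g (f * h) + B f (g * h) := by
    intro f g h
    refine he.induction_on₃ (p := fun f g h => B (f * g) h = B g (f * h) + B f (g * h))
      (isClosed_eq (by fun_prop) (by fun_prop)) (fun f g h => ?_) f g h
    have e1 : e f * e g = e (f * g) := rfl
    have e2 : e f * e h = e (f * h) := rfl
    have e3 : e g * e h = e (g * h) := rfl
    obtain ⟨F, hF, hf⟩ := f.2
    obtain ⟨G, hG, hg⟩ := g.2
    obtain ⟨K, hK, hk⟩ := h.2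
    rw [e1, e2, e3, hB, hB, hB,
      hB₀ (f * g) h _ K (hF.mul hG) hK (fun z => congrArg₂ (· * ·) (hf z) (hg z)) hk,
      hB₀ g (f * h) G _ hG (hF.mul hK) hg fun z => congrArg₂ (· * ·) (hf z) (hk z),
      hB₀ f (g * h) F _ hF (hG.mul hK) hf fun z => congrArg₂ (· * ·) (hg z) (hk z),
      ← integralBoundaryQ_add ((hG.continuousOn_deriv_mul (hF.mul hK)).mono hfr)
        ((hF.continuousOn_deriv_mul (hG.mul hK)).mono hfr)]
    refine integralBoundaryQ_congr fun z hz => ?_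
    rw [deriv_fun_mul (hF.analyticAt (hfr hz)).differentiableAt
      (hG.analyticAt (hfr hz)).differentiableAt]
    ring
  refine not_isWeaklyAmenable_of_form B (fun hB0 => ?_) hder
  have h1 : B (e ⟨_, (isRationalOff_id X).toContinuousMap_mem⟩)
      (e ⟨_, (isRationalOff_inv_sub haX).toContinuousMap_mem⟩) = 2 * Real.pi * Complex.I := by
    rw [hB, hB₀ _ _ _ _ (isRationalOff_id X) (isRationalOff_inv_sub haX) (fun _ => rfl)
      fun _ => rfl, ← integralBoundaryQ_sub_inv haQ]
    exact integralBoundaryQ_congr fun z _ => by rw [deriv_id'', one_mul]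
  rw [hB0] at h1
  exact Complex.two_pi_I_ne_zero h1.symm

/-! ### The compact set -/

lemma isJordanDomain_ball (a : ℂ) {r : ℝ} (hr : 0 < r) : IsJordanDomain (Metric.ball a r) := by
  have hr' : (r : ℂ) ≠ 0 := Complex.ofReal_ne_zero.2 hr.ne'
  have hrange : Set.range (fun ζ : Circle => a + r * (ζ : ℂ)) = Metric.sphere a r := by
    ext z
    rw [mem_sphere_iff_norm]
    constructor
    · rintro ⟨ζ, rfl⟩
      rw [add_sub_cancel_left, norm_mul, Circle.norm_coe, mul_one, Complex.norm_real,
        Real.norm_of_nonneg hr.le]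
    · intro hz
      refine ⟨⟨(z - a) / r, ?_⟩, ?_⟩
      · refine mem_sphere_zero_iff_norm.2 ?_
        rw [norm_div, hz, Complex.norm_real, Real.norm_of_nonneg hr.le, div_self hr.ne']
      · change a + r * ((z - a) / r) = z
        field_simp
        ring
  have haS : a ∉ Metric.sphere a r := by
    rw [mem_sphere_iff_norm, sub_self, norm_zero]
    exact hr.ne
  refine ⟨fun ζ => a + r * (ζ : ℂ), by fun_prop, fun ζ ξ h => ?_, Metric.isBounded_ball, a, ?_, ?_⟩
  · exact Circle.ext (mul_left_cancel₀ hr' (add_left_cancel h))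
  · rw [hrange]
    exact haS
  · rw [hrange]
    have ha : a ∈ Metric.ball a r := Metric.mem_ball_self hr
    refine Set.Subset.antisymm ((convex_ball a r).isPreconnected.subset_connectedComponentIn ha
      fun z hz hz' => (Metric.mem_ball.1 hz).ne hz') ?_
    refine isPreconnected_connectedComponentIn.subset_left_of_subset_union Metric.isOpen_ball
      (Metric.isClosed_closedBall (x := a) (ε := r)).isOpen_compl
      (Set.disjoint_compl_right_iff_subset.2 Metric.ball_subset_closedBall) (fun z hz => ?_)
      ⟨a, mem_connectedComponentIn haS, ha⟩
    have hzS : z ∉ Metric.sphere a r := connectedComponentIn_subset _ _ hz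
    rcases lt_or_gt_of_ne (show dist z a ≠ r from hzS) with h | h
    · exact Or.inl h
    · exact Or.inr fun h' => (Metric.mem_closedBall.1 h').not_gt h

theorem theorem1p1 (C : ℝ) (hC : 0 < C) :
    ∃ (X : TopologicalSpace.Compacts ℂ) (𝒰 : Set (Set ℂ)),
      𝒰.Countable ∧ (∀ U ∈ 𝒰, IsJordanDomain U ∧ U ⊆ squareQ) ∧
      (X : Set ℂ) = squareQ \ ⋃₀ 𝒰 ∧
      frontier squareQ ⊆ (X : Set ℂ) ∧
      IsUniformAlgebra (ratClosure X) ∧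
      IsRegularOnCharacters (ratClosure X) ∧
      (∀ (φ : WeakDual.characterSpace ℂ (ratClosure X)) (d : ratClosure X →L[ℂ] ℂ),
        IsBoundedPointDerivation φ d → d = 0) ∧
      (∀ f g : ℂ → ℂ, IsRationalOff X f → IsRationalOff X g →
        ‖integralBoundaryQ (fun z => deriv f z * g z)‖ ≤
          C * supNormOn X f * supNormOn X g) ∧
      ¬ IsWeaklyAmenable (ratClosure X) := by
  obtain ⟨M, hM, hest⟩ := exists_norm_integral_deriv_mul_le
  obtain ⟨H, ⟨i⟩, hHw, hstrip, hlarge⟩ := exists_hole_family (div_pos hC hM)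
  have hE := hest H (C / M) (div_pos hC hM).le hHw
  rw [mul_div_cancel₀ C hM.ne'] at hE
  have hball := fun j => (H.ball_subset_innerQ j).trans innerQ_subset_squareQ
  have hi : H.center i ∈ Metric.ball (H.center i) (H.radius i) :=
    Metric.mem_ball_self (H.radius_pos i)
  refine ⟨H.carrier, Set.range fun j => Metric.ball (H.center j) (H.radius j), ?_, ?_, ?_,
    H.frontier_subset_diff, isUniformAlgebra_ratClosure,
    isRegularOnCharacters_ratClosure Set.sdiff_subset hstrip,
    boundedPointDerivation_eq_zero hlarge, hE,
    not_isWeaklyAmenable_ratClosure hC.le H.frontier_subset_diff hE (H.ball_subset_innerQ i hi)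
      fun h => h.2 (Set.mem_iUnion.2 ⟨i, hi⟩)⟩
  · have := H.countable
    exact Set.countable_range _
  · rintro _ ⟨j, rfl⟩
    exact ⟨isJordanDomain_ball _ (H.radius_pos j), hball j⟩
  · rw [H.coe_carrier, Set.sUnion_range]
    rfl
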